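/- Consider pairs $(\omega,v)$ of measures on $\mathbb R$ of the form $\omega=\sum_{i=1}^n\omega_i\delta_{x_i}$, $v=\sum_{i=1}^n v_i\delta_{x_i}$ with any finite number $n$ of points $x_1<\dots<x_n$, $\omega_i\in\mathbb R$, $v_i\ge 0$ and $|\omega_i|+v_i>0$. For $z\in\mathbb C$, a solution of $$-f''+\tfrac14 f=z\,\omega f+z^2 v f \tag{1}$$ is a continuous function $f$ on $\mathbb R$ that satisfies $-f''+\frac14 f=0$ on $\mathbb R\setminus\{x_1,\dots,x_n\}$ and $f'(x_i-)=f'(x_i+)+z\omega_i f(x_i)+z^2v_i f(x_i)$ for every $i$. The eigenvalues of $(\omega,v)$ are the $z$ for which (1) has a nontrivial bounded solution; they are real, nonzero and finite in number, and we write them as $\lambda_1<\dots<\lambda_N$. Let $\phi_+(z,\cdot)$ be the solution of (1) with $\phi_+(z,x)=e^{-x/2}$ for all large $x$, and put $$\gamma_{\lambda}^2=\int|\phi_+(\lambda,x)|^2\,d\omega(x)+2\lambda\int|\phi_+(\lambda,x)|^2\,dv(x),\qquad \varphi_i(x)=\frac{\phi_+(\lambda_i,x)}{\sqrt{\lambda_i\gamma_{\lambda_i}^2}},$$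 where $\lambda_i\gamma_{\lambda_i}^2>0$. For $a\in\mathbb R$ the collection $\{\lambda_i,\varphi_i(a)\}_{i=1}^N$ is called the interior spectral data of $(\omega,v)$ at $a$. **Theorem.** Let $a\in\mathbb R$ and let $\{\lambda_i,\varphi_i(a)\}_{i=1}^N$ be the interior spectral data at $a$ of some pair $(\omega,v)$ with $N\ge 1$. Assume that $\alpha:=1-\sum_{i=1}^N|\varphi_i(a)|^2\neq 0$ and that $\varphi_i(a)\ne0$ for $i=1,\dots,N$. (i) If $\lambda_1>0$ or $\lambda_N<0$, then exactly two pairs $(\omega,v)$ have the given interior spectral data at $a$. (ii) If $\lambda_{j_0}<0<\lambda_{j_0+1}$ for some $j_0\in\{1,\dots,N-1\}$, then exactly four pairs $(\omega,v)$ have the given interior spectral data at $a$. -/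

import Mathlib

open Filter Topology
open scoped NNReal

namespace Multipeakon

/-- A pair `(ω, v)` of finitely supported measures on the line, `ω = ∑ ω(x) δ_x` with real
weights and `v = ∑ v(x) δ_x` with nonnegative weights.  A finite linear combination of Dirac
measures is recorded by its (finitely supported) weight function; the number of mass points is
arbitrary. -/
abbrev DiscretePair : Type := (ℝ →₀ ℝ) × (ℝ →₀ ℝ≥0)

/-- The mass points `x_1 < ⋯ < x_n` of the pair: the points with `|ω_i| + v_i > 0`. -/
noncomputable def massPoints (p : DiscretePair) : Finset ℝ := p.1.support ∪ p.2.support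

/-- `f` solves `-f'' + f / 4 = z ω f + z² v f` in the sense of distributions: it is continuous,
solves `-f'' + f / 4 = 0` away from the mass points, and at each mass point `x` has one-sided
derivatives with `f'(x-) = f'(x+) + z ω({x}) f(x) + z² v({x}) f(x)`. -/
structure IsSolution (p : DiscretePair) (z : ℂ) (f : ℝ → ℂ) : Prop where
  continuous : Continuous f
  differentiableAt : ∀ x ∉ massPoints p, DifferentiableAt ℝ f x
  ode : ∀ x ∉ massPoints p, HasDerivAt (deriv f) (f x / 4) x
  jump : ∀ x ∈ massPoints p, ∃ l r : ℂ,
    Tendsto (deriv f) (𝓝[<] x) (𝓝 l) ∧ Tendsto (deriv f) (𝓝[>] x) (𝓝 r) ∧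
      l = r + z * (p.1 x : ℂ) * f x + z ^ 2 * ((p.2 x : ℝ) : ℂ) * f x

/-- The spectrum: all complex `z` for which there is a nontrivial bounded solution. -/
def spectrum (p : DiscretePair) : Set ℂ :=
  {z | ∃ f : ℝ → ℂ, IsSolution p z f ∧ f ≠ 0 ∧ ∃ C : ℝ, ∀ x, ‖f x‖ ≤ C}

/-- `f` is the solution `φ₊(z, ·)`: it equals `exp (-x / 2)` for all `x` near `+∞`. -/
def IsPhiPlus (p : DiscretePair) (z : ℂ) (f : ℝ → ℂ) : Prop :=
  IsSolution p z f ∧ ∀ᶠ x : ℝ in atTop, f x = (Real.exp (-x / 2) : ℂ)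

/-- `γ² = ∫ |f|² dω + 2 λ ∫ |f|² dv`; for an eigenvalue `λ` and `f = φ₊(λ, ·)`, the number
`λ γ²` is the (modified) norming constant. -/
noncomputable def gammaSq (p : DiscretePair) (lam : ℝ) (f : ℝ → ℂ) : ℝ :=
  (p.1.sum fun x w => w * ‖f x‖ ^ 2) + 2 * lam * (p.2.sum fun x m => (m : ℝ) * ‖f x‖ ^ 2)

/-- `c` is the value at `a` of the normalized eigenfunction
`φ(x) = φ₊(λ, x) / √(λ γ²)` belonging to the eigenvalue `λ`. -/
def IsNormalizedEigenfunctionValue (p : DiscretePair) (lam a c : ℝ) : Prop :=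
  ∃ f : ℝ → ℂ, IsPhiPlus p (lam : ℂ) f ∧
    (c : ℂ) = f a / (Real.sqrt (lam * gammaSq p lam f) : ℂ)

/-- `{λ_i, c_i}` is the interior spectral data of the pair at `a`: `λ_1 < ⋯ < λ_N` are all the
eigenvalues, and `c_i = φ_i(a)`. -/
structure IsInteriorSpectralData (p : DiscretePair) (a : ℝ) {N : ℕ} (lam c : Fin N → ℝ) :
    Prop where
  strictMono : StrictMono lam
  spectrum_eq : spectrum p = Set.range fun i => (lam i : ℂ)
  value : ∀ i, IsNormalizedEigenfunctionValue p (lam i) a (c i)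

end Multipeakon

/-! Everything is expressed through rational Herglotz–Nevanlinna functions `nev c d r`, that is `c z
+ d + ∑ r(μ)/(μ - z)` with `c ≥ 0` and `r ≥ 0`. To the right of `a`, write `φ₊'/φ₊ + 1/2 = z m₊(z)`;
then `m₊ = nev 0 0 rp`, its poles are the zeros of `φ₊(·, a)`, and `φ₊(z, a)` is `exp (-a/2) ∏ (1 -
z/μ)` over these poles. Reflection gives `m₋ = nev 0 0 rm` for the left side. Crossing one point
mass is one step of a continued fraction (`exists_nev_step`, inverted by `exists_nev_peel`), so the
part of the pair on one side of `a` corresponds bijectively to residues `r ≥ 0` with `r 0 = 0`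
(`exists_pair_of_rightData`, `IsRightData.pair_unique`).

Matching `φ₊` and `φ₋` at `a` shows that, when `φ₊` and `φ₋` have no common zero there, the
eigenvalues are the zeros of `M(z) = v({a}) z + ω({a}) + m₊ + m₋ - 1/z`. A Wronskian identity gives
`λ M'(λ) φ₊(λ, a)² = γ²`, so `-1/M` has residue parameters `λ_i² φ_i(a)²` at the `λ_i`. Since `M`
behaves like `-1/z` at `0`, the function `-1/M` vanishes there with derivative `1`; this fixes its
linear part, whose leading coefficient is `α`. Hence the data determine `M`. As `α ≠ 0`, comparison
of degrees gives `α > 0`, no mass at `a`, and exactly `N` nonzero poles of `M`, which together with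
`0` interlace the eigenvalues.

All that remains free is how the poles of `m₊ + m₋` are distributed between `m₊` and `m₋`. The
squares `φ_i(a)²` do not see this choice; the signs do, since `φ_i(a)` has the sign of `∏ (1 -
λ_i/μ)` over the poles of `m₊`. Moving a set `D` of poles to the other side preserves all signs
exactly when every point of `D` lies outside the range of the eigenvalues
(`Interlaces.signProd_pos_iff`): a pole between two neighbouring eigenvalues would flip one sign but
not the other. Interlacing leaves only the two extreme points of the poles together with `0` as
candidates, and `0` itself is not movable. If all eigenvalues have one sign, `0` is extreme and one
movable pole is left, giving `2` pairs; otherwise there are two, giving `4`. -/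

namespace Multipeakon

open Polynomial Lagrange

/-! ### Rational Herglotz–Nevanlinna functions and their numerators -/

/-- The rational function `c z + d + ∑ r(μ) / (μ - z)`. -/
noncomputable def nev (c d : ℝ) (r : ℝ →₀ ℝ) (z : ℂ) : ℂ :=
  c * z + d + r.sum fun μ w => (w : ℂ) / (μ - z)

/-- The derivative of `nev` at real points. -/
noncomputable def nevDeriv (c : ℝ) (r : ℝ →₀ ℝ) (x : ℝ) : ℝ :=
  c + r.sum fun μ w => w / (μ - x) ^ 2

/-- The numerator of `nev` over the common denominator `∏ (z - μ)`. -/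
noncomputable def nevNum (c d : ℝ) (r : ℝ →₀ ℝ) : ℝ[X] :=
  (C c * X + C d) * nodal r.support id - ∑ μ ∈ r.support, C (r μ) * nodal (r.support.erase μ) id

theorem nev_add (c c' d d' : ℝ) (r r' : ℝ →₀ ℝ) (z : ℂ) :
    nev (c + c') (d + d') (r + r') z = nev c d r z + nev c' d' r' z := by
  unfold nev
  rw [Finsupp.sum_add_index' (by simp) (by intros; push_cast; ring)]
  push_cast; ring

theorem nev_smul (k c d : ℝ) (r : ℝ →₀ ℝ) (z : ℂ) :
    nev (k * c) (k * d) (k • r) z = k * nev c d r z := by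
  unfold nev
  rw [Finsupp.sum_smul_index' (by simp), mul_add, Finsupp.mul_sum]
  simp only [smul_eq_mul]
  push_cast
  congr 1
  · ring
  · exact Finsupp.sum_congr fun _ _ => by ring

@[simp] theorem nev_zero (z : ℂ) : nev 0 0 0 z = 0 := by simp [nev]

theorem nev_single_zero (w : ℝ) (z : ℂ) : nev 0 0 (Finsupp.single 0 w) z = -w / z := by
  simp [nev, div_neg, neg_div]

theorem aeval_nodal (S : Finset ℝ) (z : ℂ) : aeval z (nodal S id) = ∏ μ ∈ S, (z - (μ : ℂ)) := by
  simp [nodal, map_prod]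

theorem aeval_nodal_ne_zero {S : Finset ℝ} {z : ℂ} (hz : ∀ μ ∈ S, z ≠ (μ : ℂ)) :
    aeval z (nodal S id) ≠ 0 := by
  rw [aeval_nodal]
  exact Finset.prod_ne_zero_iff.2 fun μ hμ => sub_ne_zero.2 (hz μ hμ)

theorem aeval_nodal_erase {S : Finset ℝ} {z : ℂ} {μ : ℝ} (hμ : μ ∈ S) (hz : z ≠ (μ : ℂ)) :
    aeval z (nodal (S.erase μ) id) = aeval z (nodal S id) / (z - μ) := by
  rw [eq_div_iff (sub_ne_zero.2 hz), nodal_eq_mul_nodal_erase hμ]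
  simp [mul_comm]

theorem aeval_nevNum (c d : ℝ) (r : ℝ →₀ ℝ) {z : ℂ} (hz : ∀ μ ∈ r.support, z ≠ (μ : ℂ)) :
    aeval z (nevNum c d r) = nev c d r z * aeval z (nodal r.support id) := by
  unfold nevNum nev
  simp only [map_mul, map_add, aeval_C, aeval_X, map_sum, Finsupp.sum, add_mul,
    Finset.sum_mul, sub_eq_add_neg, ← Finset.sum_neg_distrib, map_neg]
  congr 1
  refine Finset.sum_congr rfl fun μ hμ => ?_
  rw [aeval_nodal_erase hμ (hz μ hμ), ← sub_eq_add_neg]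
  have h1 : z - (μ : ℂ) ≠ 0 := sub_ne_zero.2 (hz μ hμ)
  have h2 : (μ : ℂ) - z ≠ 0 := sub_ne_zero.2 (hz μ hμ).symm
  have : (μ : ℂ) - z = -(z - μ) := by ring
  simp only [Complex.coe_algebraMap]
  rw [this]
  field_simp

/-- At a pole only the summand omitting that node survives. Thus numerator and common denominator
are coprime, and roots of the numerator are genuine zeros of `nev`. -/
theorem eval_nevNum_node (c d : ℝ) (r : ℝ →₀ ℝ) {μ : ℝ} (hμ : μ ∈ r.support) :
    (nevNum c d r).eval μ ≠ 0 := by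
  have : (nevNum c d r).eval μ = -(r μ * (nodal (r.support.erase μ) id).eval μ) := by
    unfold nevNum
    simp only [eval_sub, eval_mul, eval_finsetSum]
    rw [show eval μ (nodal r.support id) = 0 from eval_nodal_at_node (v := id) hμ,
      Finset.sum_eq_single_of_mem μ hμ]
    · simp
    · intro ν _ hν
      rw [show eval μ (nodal (r.support.erase ν) id) = 0 from
        eval_nodal_at_node (v := id) (Finset.mem_erase.2 ⟨hν.symm, hμ⟩)]
      simp
  rw [this, neg_ne_zero]
  refine mul_ne_zero (Finsupp.mem_support_iff.1 hμ) ?_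
  rw [eval_nodal]
  exact Finset.prod_ne_zero_iff.2 fun ν hν => sub_ne_zero.2 (Finset.ne_of_mem_erase hν).symm

theorem eventually_cofinite_ne_coe (S : Finset ℝ) : ∀ᶠ z : ℂ in cofinite, ∀ μ ∈ S, z ≠ (μ : ℂ) := by
  have : {z : ℂ | ¬ ∀ μ ∈ S, z ≠ (μ : ℂ)} ⊆ ((S.image fun μ : ℝ => (μ : ℂ) : Finset ℂ) : Set ℂ) := by
    intro z hz
    simp only [Set.mem_ofPred_eq, not_forall, not_not] at hz
    obtain ⟨μ, hμ, rfl⟩ := hz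
    exact Finset.mem_coe.2 (Finset.mem_image_of_mem _ hμ)
  exact (Finset.finite_toSet _).subset this

theorem nevNum_ne_zero {c d : ℝ} {r : ℝ →₀ ℝ} (h : c ≠ 0 ∨ d ≠ 0 ∨ r ≠ 0) :
    nevNum c d r ≠ 0 := by
  intro h0
  have hr : r = 0 := by
    by_contra hr
    obtain ⟨μ, hμ⟩ := Finsupp.support_nonempty_iff.2 hr
    exact eval_nevNum_node c d r hμ (by rw [h0, eval_zero])
  subst hr
  have h1 : C c * X + C d = (0 : ℝ[X]) := by simpa [nevNum] using h0
  have hc : c = 0 := by simpa using congrArg (fun p => coeff p 1) h1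
  have hd : d = 0 := by simpa using congrArg (fun p => coeff p 0) h1
  simp_all

theorem eq_zero_of_aeval_eventually {P : ℝ[X]} (h : ∀ᶠ z : ℂ in cofinite, aeval z P = 0) :
    P = 0 := by
  have : P.map (algebraMap ℝ ℂ) = 0 := by
    refine Polynomial.eq_zero_of_infinite_isRoot _ ?_
    have := (Filter.eventually_cofinite.1 h)
    refine Set.infinite_of_finite_compl (this.subset ?_)
    intro z hz hz'
    exact hz (by simpa [aeval_def, eval_map] using hz')
  exact (Polynomial.map_eq_zero_iff (algebraMap ℝ ℂ).injective).1 this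

theorem nev_eq_zero_iff {c d : ℝ} {r : ℝ →₀ ℝ} (h : ∀ᶠ z : ℂ in cofinite, nev c d r z = 0) :
    c = 0 ∧ d = 0 ∧ r = 0 := by
  by_contra hcon
  have hne : c ≠ 0 ∨ d ≠ 0 ∨ r ≠ 0 := by tauto
  refine nevNum_ne_zero hne (eq_zero_of_aeval_eventually ?_)
  filter_upwards [h, eventually_cofinite_ne_coe r.support] with z h1 h2
  rw [aeval_nevNum c d r h2, h1, zero_mul]

/-- Uniqueness of partial fractions. Equality is asked only off a finite set because at a pole
division by zero makes the value of `nev` meaningless. -/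
theorem nev_injective {c d c' d' : ℝ} {r r' : ℝ →₀ ℝ}
    (h : ∀ᶠ z : ℂ in cofinite, nev c d r z = nev c' d' r' z) : c = c' ∧ d = d' ∧ r = r' := by
  have := nev_eq_zero_iff (c := c + -1 * c') (d := d + -1 * d') (r := r + (-1 : ℝ) • r') (by
    filter_upwards [h] with z hz
    rw [nev_add, nev_smul, hz]; push_cast; ring)
  obtain ⟨h1, h2, h3⟩ := this
  refine ⟨by linarith, by linarith, ?_⟩
  rw [neg_smul, one_smul] at h3
  exact add_neg_eq_zero.1 h3

theorem hasDerivAt_nev (c d : ℝ) (r : ℝ →₀ ℝ) {x : ℝ} (hx : x ∉ r.support) :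
    HasDerivAt (nev c d r) (nevDeriv c r x : ℂ) (x : ℂ) := by
  unfold nev nevDeriv Finsupp.sum
  have h : ∀ μ ∈ r.support, HasDerivAt (fun z : ℂ => (r μ : ℂ) / (μ - z))
      ((r μ / (μ - x) ^ 2 : ℝ) : ℂ) (x : ℂ) := by
    intro μ hμ
    have hne : (μ : ℂ) - x ≠ 0 := by
      rw [sub_ne_zero]; rintro h; exact hx (by rwa [← Complex.ofReal_inj.1 h])
    have := (hasDerivAt_const (x : ℂ) (r μ : ℂ)).div ((hasDerivAt_id (x : ℂ)).const_sub (μ : ℂ)) hne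
    exact this.congr_deriv (by push_cast; simp)
  have := (((hasDerivAt_id (x : ℂ)).const_mul (c : ℂ)).add_const (d : ℂ)).add
    (HasDerivAt.fun_sum h)
  exact this.congr_deriv (by push_cast; simp)

theorem nevDeriv_pos {c : ℝ} {r : ℝ →₀ ℝ} (hc : 0 ≤ c) (hr : 0 ≤ r) (h : c ≠ 0 ∨ r ≠ 0)
    {x : ℝ} (hx : x ∉ r.support) : 0 < nevDeriv c r x := by
  unfold nevDeriv Finsupp.sum
  have hne : ∀ μ ∈ r.support, 0 < r μ / (μ - x) ^ 2 := by
    intro μ hμ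
    have : μ - x ≠ 0 := sub_ne_zero.2 fun h => hx (h ▸ hμ)
    have h1 : 0 < r μ := lt_of_le_of_ne (hr μ) (Finsupp.mem_support_iff.1 hμ).symm
    positivity
  rcases h with h | h
  · have : 0 < c := lt_of_le_of_ne hc h.symm
    have := Finset.sum_nonneg fun μ hμ => (hne μ hμ).le
    linarith
  · have := Finset.sum_pos hne (Finsupp.support_nonempty_iff.2 h)
    linarith

/-- The Herglotz property: the imaginary part is `Im z` times a positive number. It forces all zeros
to be real. -/
theorem nev_im_pos {c d : ℝ} {r : ℝ →₀ ℝ} (hc : 0 ≤ c) (hr : 0 ≤ r) (h : c ≠ 0 ∨ r ≠ 0)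
    {z : ℂ} (hz : z.im ≠ 0) : (nev c d r z).im ≠ 0 := by
  have key : (nev c d r z).im =
      z.im * (c + ∑ μ ∈ r.support, r μ / Complex.normSq (μ - z)) := by
    unfold nev Finsupp.sum
    simp only [Complex.add_im, Complex.im_sum, Complex.mul_im, Complex.ofReal_re, Complex.ofReal_im,
      Complex.div_im, Complex.sub_re, Complex.sub_im]
    rw [mul_add, Finset.mul_sum]
    congr 1
    · ring
    · refine Finset.sum_congr rfl fun μ _ => ?_
      ring
  rw [key]
  refine mul_ne_zero hz (ne_of_gt ?_)
  have hne : ∀ μ ∈ r.support, 0 < r μ / Complex.normSq (μ - z) := by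
    intro μ hμ
    have : (μ : ℂ) - z ≠ 0 := fun h => hz (by simpa using congrArg Complex.im h)
    have h1 : 0 < r μ := lt_of_le_of_ne (hr μ) (Finsupp.mem_support_iff.1 hμ).symm
    have h2 := Complex.normSq_pos.2 this
    positivity
  rcases h with h | h
  · have : 0 < c := lt_of_le_of_ne hc h.symm
    have := Finset.sum_nonneg fun μ hμ => (hne μ hμ).le
    linarith
  · have := Finset.sum_pos hne (Finsupp.support_nonempty_iff.2 h)
    linarith

section Numerator

variable {c d : ℝ} {r : ℝ →₀ ℝ}

theorem nev_ne_zero_of_im (hc : 0 ≤ c) (hr : 0 ≤ r) (h : c ≠ 0 ∨ d ≠ 0 ∨ r ≠ 0) {z : ℂ}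
    (hz : z.im ≠ 0) : nev c d r z ≠ 0 := by
  by_cases h' : c ≠ 0 ∨ r ≠ 0
  · intro h0
    exact nev_im_pos (d := d) hc hr h' hz (by rw [h0]; rfl)
  · push Not at h'
    obtain ⟨rfl, rfl⟩ := h'
    simpa [nev] using h

theorem notMem_support_of_isRoot {x : ℝ} (hx : (nevNum c d r).IsRoot x) : x ∉ r.support :=
  fun h => eval_nevNum_node c d r h hx

theorem coe_ne_of_notMem {S : Finset ℝ} {x : ℝ} (hx : x ∉ S) : ∀ μ ∈ S, (x : ℂ) ≠ (μ : ℂ) :=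
  fun μ hμ h => hx (by rwa [Complex.ofReal_inj.1 h])

theorem nev_eq_zero_of_isRoot {x : ℝ} (hx : (nevNum c d r).IsRoot x) : nev c d r x = 0 := by
  have h := coe_ne_of_notMem (notMem_support_of_isRoot hx)
  have h1 := aeval_nevNum c d r h
  rw [show ((x : ℝ) : ℂ) = algebraMap ℝ ℂ x from rfl, aeval_algebraMap_apply, coe_aeval_eq_eval,
    hx.eq_zero, map_zero] at h1
  exact (mul_eq_zero.1 h1.symm).resolve_right (aeval_nodal_ne_zero h)

theorem nontrivial_of_isRoot (h : c ≠ 0 ∨ d ≠ 0 ∨ r ≠ 0) {x : ℝ} (hx : (nevNum c d r).IsRoot x) :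
    c ≠ 0 ∨ r ≠ 0 := by
  by_contra h'
  push Not at h'
  have h1 := nev_eq_zero_of_isRoot hx
  obtain ⟨rfl, rfl⟩ := h'
  simp [nev] at h1
  simp_all

/-- Product rule for `nev` times the denominator; the other term drops out at a zero. It gives
simplicity of the zeros and later the residues of the reciprocal. -/
theorem eval_derivative_nevNum {x : ℝ} (hx : (nevNum c d r).IsRoot x) :
    (derivative (nevNum c d r)).eval x = nevDeriv c r x * (nodal r.support id).eval x := by
  have hS := notMem_support_of_isRoot hx
  have h1 : HasDerivAt (fun z : ℂ => aeval z (nevNum c d r))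
      (aeval (x : ℂ) (derivative (nevNum c d r))) (x : ℂ) := Polynomial.hasDerivAt_aeval _ _
  have h2 : HasDerivAt (fun z : ℂ => nev c d r z * aeval z (nodal r.support id)) _ (x : ℂ) :=
    (hasDerivAt_nev c d r hS).mul (Polynomial.hasDerivAt_aeval _ _)
  have h3 : (fun z : ℂ => aeval z (nevNum c d r)) =ᶠ[𝓝 (x : ℂ)]
      fun z : ℂ => nev c d r z * aeval z (nodal r.support id) := by
    have : ∀ᶠ z : ℂ in 𝓝 (x : ℂ), ∀ μ ∈ r.support, z ≠ (μ : ℂ) := by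
      rw [Filter.eventually_all_finset]
      intro μ hμ
      exact isOpen_ne.mem_nhds (coe_ne_of_notMem hS μ hμ)
    filter_upwards [this] with z hz using aeval_nevNum c d r hz
  have h4 := h1.unique (h2.congr_of_eventuallyEq h3)
  rw [nev_eq_zero_of_isRoot hx, zero_mul, add_zero] at h4
  have h5 : ∀ p : ℝ[X], aeval (x : ℂ) p = (p.eval x : ℝ) := fun p =>
    (aeval_algebraMap_apply ℂ x p).trans (by rw [coe_aeval_eq_eval]; rfl)
  rw [h5, h5] at h4
  exact_mod_cast h4

theorem nevNum_splits (hc : 0 ≤ c) (hr : 0 ≤ r) (h : c ≠ 0 ∨ d ≠ 0 ∨ r ≠ 0) :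
    (nevNum c d r).Splits := by
  refine Splits.of_splits_map (algebraMap ℝ ℂ) (IsAlgClosed.splits _) fun z hz => ?_
  have h0 : aeval z (nevNum c d r) = 0 := by
    have := (mem_roots'.1 hz).2
    simpa [aeval_def, eval_map] using this
  by_cases him : z.im = 0
  · exact ⟨z.re, Complex.ext rfl (by simp [him])⟩
  · exfalso
    have hS : ∀ μ ∈ r.support, z ≠ (μ : ℂ) := fun μ _ hz => him (by simp [hz])
    rw [aeval_nevNum c d r hS] at h0
    exact (mul_ne_zero (nev_ne_zero_of_im hc hr h him) (aeval_nodal_ne_zero hS)) h0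

theorem nodup_roots_nevNum (hc : 0 ≤ c) (hr : 0 ≤ r) (h : c ≠ 0 ∨ d ≠ 0 ∨ r ≠ 0) :
    (nevNum c d r).roots.Nodup := by
  rw [Multiset.nodup_iff_count_le_one]
  intro x
  rw [count_roots]
  by_contra hlt
  push Not at hlt
  obtain ⟨h1, h2⟩ := (one_lt_rootMultiplicity_iff_isRoot (nevNum_ne_zero h)).1 hlt
  rw [IsRoot, eval_derivative_nevNum h1] at h2
  have hS := notMem_support_of_isRoot h1
  refine mul_ne_zero (nevDeriv_pos hc hr (nontrivial_of_isRoot h h1) hS).ne' ?_ h2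
  rw [eval_nodal]
  exact Finset.prod_ne_zero_iff.2 fun μ hμ => sub_ne_zero.2 fun h => hS (h ▸ hμ)

theorem nevNum_eq_nodal (hc : 0 ≤ c) (hr : 0 ≤ r) (h : c ≠ 0 ∨ d ≠ 0 ∨ r ≠ 0) :
    nevNum c d r =
      C (nevNum c d r).leadingCoeff * nodal (nevNum c d r).roots.toFinset id := by
  conv_lhs => rw [(nevNum_splits hc hr h).eq_prod_roots]
  rw [nodal, Finset.prod_eq_multiset_prod, Multiset.toFinset_val,
    (nodup_roots_nevNum hc hr h).dedup]
  rfl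

theorem degree_sum_nodal_erase_lt (r : ℝ →₀ ℝ) :
    (∑ μ ∈ r.support, C (r μ) * nodal (r.support.erase μ) id).degree < r.support.card := by
  refine lt_of_le_of_lt (degree_sum_le _ _) ?_
  rw [Finset.sup_lt_iff (WithBot.bot_lt_coe _)]
  intro μ hμ
  rw [degree_C_mul (Finsupp.mem_support_iff.1 hμ), degree_nodal]
  exact_mod_cast Finset.card_erase_lt_of_mem hμ

theorem coeff_sum_nodal_erase (r : ℝ →₀ ℝ) :
    (∑ μ ∈ r.support, C (r μ) * nodal (r.support.erase μ) id).coeff (r.support.card - 1) =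
      ∑ μ ∈ r.support, r μ := by
  rw [finsetSum_coeff]
  refine Finset.sum_congr rfl fun μ hμ => ?_
  rw [coeff_C_mul, ← Finset.card_erase_of_mem hμ, ← natDegree_nodal (R := ℝ) (v := id),
    nodal_monic.coeff_natDegree, mul_one]

theorem degree_linear_mul_nodal {S : Finset ℝ} (hc : c ≠ 0) :
    ((C c * X + C d) * nodal S id).degree = ((S.card + 1 : ℕ) : WithBot ℕ) := by
  rw [degree_mul, degree_linear hc, degree_nodal, add_comm]; norm_cast

end Numerator

/-! ### Negative reciprocals -/

/-- The rational function with data `c', d', r'` is the negative reciprocal of the one with data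
`c, d, r`. -/
structure IsNegInv (c d : ℝ) (r : ℝ →₀ ℝ) (c' d' : ℝ) (r' : ℝ →₀ ℝ) : Prop where
  nonneg : 0 ≤ r'
  eq_zero_iff : ∀ z : ℂ, (∀ μ ∈ r.support, z ≠ μ) → (nev c d r z = 0 ↔ ∃ ν ∈ r'.support, z = ν)
  disjoint : Disjoint r.support r'.support
  mul_eq : ∀ z : ℂ, (∀ μ ∈ r.support, z ≠ μ) → (∀ μ ∈ r'.support, z ≠ μ) →
    nev c d r z * nev c' d' r' z = -1
  residue : ∀ ν ∈ r'.support, r' ν = 1 / nevDeriv c r ν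
  prod_eq : ∃ k : ℂ, k ≠ 0 ∧ ∀ z : ℂ, (∀ μ ∈ r.support, z ≠ μ) →
    nev c d r z * ∏ μ ∈ r.support, (z - (μ : ℂ)) = k * ∏ ν ∈ r'.support, (z - (ν : ℂ))
  card_of_ne : c ≠ 0 → r'.support.card = r.support.card + 1 ∧ c' = 0 ∧ d' = 0
  card_of_eq_of_ne : c = 0 → d ≠ 0 →
    r'.support.card = r.support.card ∧ c' = 0 ∧ d' = -1 / d
  card_of_eq : c = 0 → d = 0 → r'.support.card + 1 = r.support.card ∧ 0 < c'

/-- The quotient is the polynomial part of `-1/nev`. With `n` poles the numerator has degree `n +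
1`, `n` or `n - 1` in the three cases, so the quotient has degree at most one. In the last case the
numerator has leading coefficient `-∑ r < 0`, whence `c' > 0`. -/
theorem exists_quotient {c d : ℝ} {r : ℝ →₀ ℝ} (hr : 0 ≤ r) (h : c ≠ 0 ∨ d ≠ 0 ∨ r ≠ 0) :
    ∃ c' d' : ℝ,
      (-nodal r.support id - (C c' * X + C d') * nevNum c d r).degree < (nevNum c d r).degree ∧
      (c ≠ 0 → (nevNum c d r).degree = (r.support.card + 1 : ℕ) ∧ c' = 0 ∧ d' = 0) ∧
      (c = 0 → d ≠ 0 → (nevNum c d r).degree = r.support.card ∧ c' = 0 ∧ d' = -1 / d) ∧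
      (c = 0 → d = 0 → (nevNum c d r).degree + 1 = r.support.card ∧ 0 < c') := by
  have hL := degree_sum_nodal_erase_lt r
  have hQ : (nodal r.support id).degree = (r.support.card : WithBot ℕ) := degree_nodal (R := ℝ)
  by_cases hc : c = 0
  · by_cases hd : d = 0
    · have hr0 : r ≠ 0 := by tauto
      have hpos : 0 < r.support.card := Finset.card_pos.2 (Finsupp.support_nonempty_iff.2 hr0)
      have hσ : 0 < ∑ μ ∈ r.support, r μ := Finset.sum_pos
        (fun μ hμ => lt_of_le_of_ne (hr μ) (Finsupp.mem_support_iff.1 hμ).symm)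
        (Finsupp.support_nonempty_iff.2 hr0)
      have hco := coeff_sum_nodal_erase r
      set L := ∑ μ ∈ r.support, C (r μ) * nodal (r.support.erase μ) id with hLdef
      have hP : nevNum c d r = -L := by simp [nevNum, hc, hd, hLdef]
      have hdeg : L.degree = (r.support.card - 1 : ℕ) := by
        refine le_antisymm ?_ (le_degree_of_ne_zero (by rw [hco]; exact hσ.ne'))
        refine degree_le_of_natDegree_le ?_
        have : L ≠ 0 := fun h0 => by rw [h0, coeff_zero] at hco; exact hσ.ne hco
        rw [degree_eq_natDegree this] at hL
        have : L.natDegree < r.support.card := by exact_mod_cast hL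
        omega
      have hLne : L ≠ 0 := fun h0 => by rw [h0, degree_zero] at hdeg; exact absurd hdeg (by simp)
      have hle : L.degree ≤ (-nodal r.support id).degree := by
        rw [degree_neg, hQ]; exact hL.le
      have hlc : L.leadingCoeff = ∑ μ ∈ r.support, r μ := by
        rw [leadingCoeff, natDegree_eq_of_degree_eq_some hdeg, hco]
      set D := (-nodal r.support id) / (-L) with hD
      have hDdeg : L.degree + D.degree = (-nodal r.support id).degree := by
        rw [← degree_neg L]
        exact degree_add_div (neg_ne_zero.2 hLne) (by rwa [degree_neg])
      have hD1 : D.degree = 1 := by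
        rw [degree_neg, hQ, hdeg] at hDdeg
        have hDne : D ≠ 0 := fun h0 => by
          rw [h0, degree_zero] at hDdeg; exact absurd hDdeg (by simp)
        rw [degree_eq_natDegree hDne] at hDdeg ⊢
        have : r.support.card - 1 + D.natDegree = r.support.card := by exact_mod_cast hDdeg
        have : D.natDegree = 1 := by omega
        rw [this]; rfl
      have hDeq : D = C (D.coeff 1) * X + C (D.coeff 0) := eq_X_add_C_of_degree_le_one hD1.le
      refine ⟨D.coeff 1, D.coeff 0, ?_, fun h => absurd hc h, fun _ h => absurd hd h, fun _ _ => ?_⟩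
      · rw [← hDeq, hP]
        have := degree_mod_lt (-nodal r.support id) (neg_ne_zero.2 hLne)
        rwa [EuclideanDomain.mod_eq_sub_mul_div, mul_comm] at this
      · constructor
        · rw [hP, degree_neg, hdeg]
          exact_mod_cast Nat.sub_add_cancel hpos
        · have h1 : D.leadingCoeff = D.coeff 1 := by
            rw [leadingCoeff, natDegree_eq_of_degree_eq_some hD1]; rfl
          rw [← h1, hD, leadingCoeff_div (by rwa [degree_neg]), leadingCoeff_neg, leadingCoeff_neg,
            hlc, nodal_monic.leadingCoeff, neg_div_neg_eq]
          positivity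
    · have hP : nevNum c d r = C d * nodal r.support id -
          ∑ μ ∈ r.support, C (r μ) * nodal (r.support.erase μ) id := by simp [nevNum, hc]
      have hdeg : (nevNum c d r).degree = r.support.card := by
        rw [hP, degree_sub_eq_left_of_degree_lt] <;> rw [degree_C_mul hd, hQ]
        exact hL
      refine ⟨0, -1 / d, ?_, fun h => absurd hc h, fun _ _ => ⟨hdeg, rfl, rfl⟩, fun _ h => absurd h hd⟩
      rw [hdeg, hP]
      have : -nodal r.support id - (C 0 * X + C (-1 / d)) * (C d * nodal r.support id -
          ∑ μ ∈ r.support, C (r μ) * nodal (r.support.erase μ) id) =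
          C (-1 / d) * ∑ μ ∈ r.support, C (r μ) * nodal (r.support.erase μ) id := by
        have h1 : C (-1 / d) * C d = (-1 : ℝ[X]) := by
          rw [← C_mul, div_mul_cancel₀ _ hd]; simp
        rw [C_0]
        linear_combination (-nodal r.support id) * h1
      rw [this, degree_C_mul (div_ne_zero (by norm_num) hd)]
      exact hL
  · have hdeg : (nevNum c d r).degree = (r.support.card + 1 : ℕ) := by
      unfold nevNum
      rw [degree_sub_eq_left_of_degree_lt] <;> rw [degree_linear_mul_nodal hc]
      exact hL.trans (by exact_mod_cast Nat.lt_succ_self _)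
    refine ⟨0, 0, ?_, fun _ => ⟨hdeg, rfl, rfl⟩, fun h => absurd h hc, fun h => absurd h hc⟩
    rw [hdeg]
    simp only [C_0, zero_mul, add_zero, sub_zero, degree_neg, hQ]
    exact_mod_cast Nat.lt_succ_self _

/-- The zeros of `nev` are real and simple, so `-1/nev` is a linear polynomial plus simple poles;
positivity of the derivative at the zeros makes the new residues positive. -/
theorem exists_isNegInv {c d : ℝ} {r : ℝ →₀ ℝ} (hc : 0 ≤ c) (hr : 0 ≤ r)
    (h : c ≠ 0 ∨ d ≠ 0 ∨ r ≠ 0) : ∃ (c' d' : ℝ) (r' : ℝ →₀ ℝ), IsNegInv c d r c' d' r' := by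
  obtain ⟨c', d', hdeg, h1, h2, h3⟩ := exists_quotient hr h
  have hPne := nevNum_ne_zero h
  set P := nevNum c d r with hPdef
  set T := P.roots.toFinset with hT
  have hPT : P = C P.leadingCoeff * nodal T id := nevNum_eq_nodal hc hr h
  have hlc : P.leadingCoeff ≠ 0 := leadingCoeff_ne_zero.2 hPne
  have hPdeg : P.degree = T.card := by
    rw [hPT, degree_C_mul hlc, degree_nodal]
  have hroot : ∀ ν ∈ T, P.IsRoot ν := fun ν hν => (mem_roots'.1 (Multiset.mem_toFinset.1 hν)).2
  have hTS : ∀ ν ∈ T, ν ∉ r.support := fun ν hν => notMem_support_of_isRoot (hroot ν hν)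
  have hdpos : ∀ ν ∈ T, 0 < nevDeriv c r ν := fun ν hν =>
    nevDeriv_pos hc hr (nontrivial_of_isRoot h (hroot ν hν)) (hTS ν hν)
  let r' : ℝ →₀ ℝ := Finsupp.onFinset T (fun ν => if ν ∈ T then 1 / nevDeriv c r ν else 0)
    (fun ν hν => by by_contra h; simp [h] at hν)
  have hr' : ∀ ν ∈ T, r' ν = 1 / nevDeriv c r ν := fun ν hν => by
    simp [r', hν]
  have hsupp : r'.support = T := by
    ext ν
    rw [Finsupp.mem_support_iff]
    by_cases hν : ν ∈ T
    · simp [hν, hr' ν hν, (hdpos ν hν).ne']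
    · simp [r', hν]
  have hfactor : ∀ z : ℂ, aeval z P = P.leadingCoeff * aeval z (nodal T id) := fun z => by
    conv_lhs => rw [hPT]
    simp
  refine ⟨c', d', r', ?_, ?_, ?_, ?_, ?_, ?_, ?_, ?_, ?_⟩
  · intro ν
    by_cases hν : ν ∈ T
    · rw [hr' ν hν]; have := hdpos ν hν; simp only [Finsupp.coe_zero, Pi.zero_apply]; positivity
    · simp [r', hν]
  · intro z hz
    have hQ := aeval_nodal_ne_zero hz
    have := aeval_nevNum c d r hz
    rw [← hPdef, hfactor] at this
    rw [hsupp]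
    constructor
    · intro h0
      rw [h0, zero_mul] at this
      have h4 := (mul_eq_zero.1 this).resolve_left (by exact_mod_cast hlc)
      by_contra hne
      push Not at hne
      exact aeval_nodal_ne_zero hne h4
    · rintro ⟨ν, hν, rfl⟩
      exact nev_eq_zero_of_isRoot (hroot ν hν)
  · rw [hsupp, Finset.disjoint_left]
    exact fun ν hν hν' => hTS ν hν' hν
  · intro z hz hz'
    rw [hsupp] at hz'
    have hQ := aeval_nodal_ne_zero hz
    have hN := aeval_nodal_ne_zero hz'
    have hPz := aeval_nevNum c d r hz
    rw [← hPdef] at hPz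
    have hPz0 : aeval z P ≠ 0 := by
      rw [hfactor]; exact mul_ne_zero (by exact_mod_cast hlc) hN
    -- The remainder has degree below the number of roots of `P` and agrees with `-nodal` at them,
    -- so it is a Lagrange interpolant; the barycentric form of interpolation is the partial
    -- fraction expansion sought.
    set R := -nodal r.support id - (C c' * X + C d') * P with hR
    have hRi : R = interpolate T id fun ν => -(nodal r.support id).eval ν := by
      refine eq_interpolate_of_eval_eq _ (fun _ _ _ _ h => h) (by rwa [← hPdeg]) fun ν hν => ?_
      have := hroot ν hν
      rw [IsRoot] at this
      simp [hR, this]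
    have hRz : aeval z R = aeval z P * r'.sum fun μ w => (w : ℂ) / (μ - z) := by
      rw [hRi, interpolate_eq_nodalWeight_mul_nodal_div_X_sub_C, Finsupp.sum, hsupp, map_sum,
        Finset.mul_sum]
      refine Finset.sum_congr rfl fun ν hν => ?_
      have hνS : (nodal r.support id).eval ν ≠ 0 := by
        rw [eval_nodal]
        exact Finset.prod_ne_zero_iff.2 fun μ hμ => sub_ne_zero.2 fun h => hTS ν hν (h ▸ hμ)
      have hder : (derivative P).eval ν = nevDeriv c r ν * (nodal r.support id).eval ν :=
        eval_derivative_nevNum (hroot ν hν)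
      have hder2 : (derivative P).eval ν = P.leadingCoeff * (derivative (nodal T id)).eval ν := by
        conv_lhs => rw [hPT]
        simp
      have hw : nodalWeight T id ν = P.leadingCoeff * (nevDeriv c r ν)⁻¹ *
          ((nodal r.support id).eval ν)⁻¹ := by
        rw [nodalWeight_eq_eval_derivative_nodal hν]
        have h5 : nevDeriv c r ν ≠ 0 := (hdpos ν hν).ne'
        have h6 : (derivative (nodal T id)).eval ν =
            (P.leadingCoeff)⁻¹ * (nevDeriv c r ν * (nodal r.support id).eval ν) := by
          rw [← hder, hder2]; field_simp
        simp only [id]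
        rw [h6]
        field_simp
      rw [← nodal_erase_eq_nodal_div hν]
      simp only [map_mul, aeval_C, hfactor, hr' ν hν]
      rw [aeval_nodal_erase hν (hz' ν hν), hw]
      have hzν : z - (ν : ℂ) ≠ 0 := sub_ne_zero.2 (hz' ν hν)
      have h5 : (nevDeriv c r ν : ℂ) ≠ 0 := by exact_mod_cast (hdpos ν hν).ne'
      have h7 : (((nodal r.support id).eval ν : ℝ) : ℂ) ≠ 0 := by exact_mod_cast hνS
      have : (ν : ℂ) - z = -(z - ν) := by ring
      rw [this]
      simp only [Complex.coe_algebraMap]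
      push_cast
      field_simp
    have hRz2 : aeval z R = -aeval z (nodal r.support id) - (c' * z + d') * aeval z P := by
      simp [hR]
    have hK : aeval z P * nev c' d' r' z = -aeval z (nodal r.support id) := by
      unfold nev
      rw [mul_add, ← hRz, hRz2]; ring
    rw [hPz] at hK
    refine mul_right_cancel₀ hQ ?_
    linear_combination hK
  · rw [hsupp]; exact hr'
  · refine ⟨P.leadingCoeff, by exact_mod_cast hlc, fun z hz => ?_⟩
    rw [hsupp, ← aeval_nodal, ← aeval_nodal, ← hfactor, ← aeval_nevNum c d r hz]
  · intro h0
    obtain ⟨h4, h5⟩ := h1 h0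
    rw [hPdeg] at h4
    exact ⟨by rw [hsupp]; exact_mod_cast h4, h5⟩
  · intro h0 h0'
    obtain ⟨h4, h5⟩ := h2 h0 h0'
    rw [hPdeg] at h4
    exact ⟨by rw [hsupp]; exact_mod_cast h4, h5⟩
  · intro h0 h0'
    obtain ⟨h4, h5⟩ := h3 h0 h0'
    rw [hPdeg] at h4
    exact ⟨by rw [hsupp]; exact_mod_cast h4, h5⟩

end Multipeakon

namespace Multipeakon

/-! ### Expansion at the origin and the continued fraction step -/

/-- The finitely supported function `μ ↦ g μ * r μ`. -/
noncomputable def weighted (g : ℝ → ℝ) (r : ℝ →₀ ℝ) : ℝ →₀ ℝ :=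
  Finsupp.onFinset r.support (fun μ => g μ * r μ) fun μ h => by
    rw [Finsupp.mem_support_iff]; exact right_ne_zero_of_mul h

@[simp] theorem weighted_apply (g : ℝ → ℝ) (r : ℝ →₀ ℝ) (μ : ℝ) : weighted g r μ = g μ * r μ := rfl

theorem support_weighted {g : ℝ → ℝ} {r : ℝ →₀ ℝ} (h : ∀ μ ∈ r.support, g μ ≠ 0) :
    (weighted g r).support = r.support := by
  ext μ
  simp only [Finsupp.mem_support_iff, weighted_apply] at *
  exact ⟨right_ne_zero_of_mul, fun h' => mul_ne_zero (h μ h') h'⟩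

theorem nev_weighted (c d : ℝ) {g : ℝ → ℝ} {r : ℝ →₀ ℝ} (h : ∀ μ ∈ r.support, g μ ≠ 0) (z : ℂ) :
    nev c d (weighted g r) z = c * z + d + ∑ μ ∈ r.support, (g μ * r μ : ℂ) / (μ - z) := by
  simp [nev, Finsupp.sum, support_weighted h]

/-- Termwise, `1/(μ - z) = 1/μ + z/μ² + z²/(μ²(μ - z))`. The remainder is `z²` times a function of
the same class, with residues divided by `μ²`. -/
theorem nev_taylor (c d : ℝ) {r : ℝ →₀ ℝ} (h0 : r 0 = 0) {z : ℂ} (hz : ∀ μ ∈ r.support, z ≠ μ) :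
    nev c d r z = nev c d r 0 + nevDeriv c r 0 * z +
      z ^ 2 * nev 0 0 (weighted (fun μ => (μ ^ 2)⁻¹) r) z := by
  have hne : ∀ μ ∈ r.support, μ ≠ 0 := fun μ hμ h => Finsupp.mem_support_iff.1 hμ (h ▸ h0)
  rw [nev_weighted 0 0 fun μ hμ => inv_ne_zero (pow_ne_zero 2 (hne μ hμ))]
  have : ∑ μ ∈ r.support, (r μ : ℂ) / (μ - z) = ∑ μ ∈ r.support, ((r μ : ℂ) / (μ - 0) +
      ((r μ / (μ - 0) ^ 2 : ℝ) : ℂ) * z + z ^ 2 * (((μ ^ 2)⁻¹ : ℝ) * r μ / (μ - z))) := by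
    refine Finset.sum_congr rfl fun μ hμ => ?_
    have h1 : (μ : ℂ) ≠ 0 := by exact_mod_cast hne μ hμ
    have h2 : (μ : ℂ) - z ≠ 0 := sub_ne_zero.2 (hz μ hμ).symm
    push_cast
    simp only [sub_zero]
    field_simp
    ring
  simp only [nev, nevDeriv, Finsupp.sum, this, Finset.sum_add_distrib, ← Finset.mul_sum,
    ← Finset.sum_mul]
  push_cast
  ring

theorem continuousAt_nev (c d : ℝ) (r : ℝ →₀ ℝ) {x : ℝ} (hx : x ∉ r.support) :
    ContinuousAt (nev c d r) x := (hasDerivAt_nev c d r hx).continuousAt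

theorem nev_eq_erase (c d : ℝ) (r : ℝ →₀ ℝ) (μ : ℝ) (z : ℂ) :
    nev c d r z = nev c d (r.erase μ) z + r μ / (μ - z) := by
  conv_lhs => rw [← Finsupp.single_add_erase μ r]
  have := nev_add 0 c 0 d (Finsupp.single μ (r μ)) (r.erase μ) z
  simp only [zero_add] at this
  rw [this, add_comm]
  simp [nev]

theorem eventually_nhdsNE_ne_coe (S : Finset ℝ) (x : ℂ) :
    ∀ᶠ z : ℂ in 𝓝[≠] x, ∀ μ ∈ S, z ≠ (μ : ℂ) := by
  rw [Filter.eventually_all_finset]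
  intro μ _
  by_cases h : x = μ
  · rw [h]; exact eventually_mem_nhdsWithin
  · exact eventually_nhdsWithin_of_eventually_nhds (isOpen_ne.mem_nhds h)

/-- Near the pole `(z - μ) nev` tends to `-r μ`. A limit is needed because the product relation is
unavailable at `μ`; it yields both the value `0` and the derivative `1 / r μ` of the reciprocal
there. -/
theorem IsNegInv.tendsto_slope {c d : ℝ} {r : ℝ →₀ ℝ} {c' d' : ℝ} {r' : ℝ →₀ ℝ}
    (h : IsNegInv c d r c' d' r') {μ : ℝ} (hμ : μ ∈ r.support) :
    Tendsto (fun z : ℂ => nev c' d' r' z / (z - μ)) (𝓝[≠] (μ : ℂ)) (𝓝 (1 / r μ : ℂ)) := by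
  have hr : (r μ : ℂ) ≠ 0 := by exact_mod_cast Finsupp.mem_support_iff.1 hμ
  have h1 : Tendsto (fun z : ℂ => (z - μ) * nev c d (r.erase μ) z - r μ) (𝓝 (μ : ℂ))
      (𝓝 ((μ - μ) * nev c d (r.erase μ) μ - r μ)) := by
    refine ContinuousAt.tendsto (f := fun z : ℂ => (z - μ) * nev c d (r.erase μ) z - r μ) ?_
    have : μ ∉ (r.erase μ).support := by simp
    have := continuousAt_nev c d _ this
    fun_prop
  rw [sub_self, zero_mul, zero_sub] at h1
  have h2 := ((h1.inv₀ (neg_ne_zero.2 hr)).neg).mono_left (nhdsWithin_le_nhds (s := {(μ : ℂ)}ᶜ))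
  have h3 : -(-(r μ : ℂ))⁻¹ = 1 / r μ := by rw [inv_neg, neg_neg, one_div]
  rw [h3] at h2
  refine h2.congr' ?_
  filter_upwards [eventually_nhdsNE_ne_coe r.support μ, eventually_nhdsNE_ne_coe r'.support μ,
    eventually_mem_nhdsWithin] with z hz hz' hzμ
  have hm := h.mul_eq z hz hz'
  have hne : z - (μ : ℂ) ≠ 0 := sub_ne_zero.2 hzμ
  have hne' : (μ : ℂ) - z ≠ 0 := sub_ne_zero.2 (Ne.symm hzμ)
  rw [nev_eq_erase c d r μ] at hm
  have e : (z - μ) * nev c d (r.erase μ) z - r μ =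
      (z - μ) * (nev c d (r.erase μ) z + r μ / (μ - z)) := by
    field_simp
    ring
  rw [e]
  have hN : nev c d (r.erase μ) z + r μ / (μ - z) ≠ 0 := by
    intro h0; rw [h0, zero_mul] at hm; norm_num at hm
  have hK : nev c' d' r' z = -(nev c d (r.erase μ) z + r μ / (μ - z))⁻¹ := by
    rw [← mul_right_inj' hN, hm, mul_neg, mul_inv_cancel₀ hN]
  rw [hK, mul_inv, neg_div, mul_comm, ← div_eq_mul_inv _ (z - (μ : ℂ))]

theorem IsNegInv.nev_eq_zero {c d : ℝ} {r : ℝ →₀ ℝ} {c' d' : ℝ} {r' : ℝ →₀ ℝ}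
    (h : IsNegInv c d r c' d' r') {μ : ℝ} (hμ : μ ∈ r.support) : nev c' d' r' μ = 0 := by
  have hμ' : μ ∉ r'.support := Finset.disjoint_left.1 h.disjoint hμ
  have h1 := (h.tendsto_slope hμ).mul
    (((continuous_id.sub continuous_const).tendsto' (μ : ℂ) 0 (by simp)).mono_left
      (nhdsWithin_le_nhds (s := {(μ : ℂ)}ᶜ)) : Tendsto (fun z : ℂ => z - (μ : ℂ)) _ _)
  rw [mul_zero] at h1
  have h2 := (continuousAt_nev c' d' r' hμ').tendsto.mono_left
    (nhdsWithin_le_nhds (s := {(μ : ℂ)}ᶜ))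
  refine tendsto_nhds_unique h2 (h1.congr' ?_)
  filter_upwards [eventually_mem_nhdsWithin] with z hz
  exact div_mul_cancel₀ _ (sub_ne_zero.2 hz)

theorem IsNegInv.nevDeriv_eq {c d : ℝ} {r : ℝ →₀ ℝ} {c' d' : ℝ} {r' : ℝ →₀ ℝ}
    (h : IsNegInv c d r c' d' r') {μ : ℝ} (hμ : μ ∈ r.support) : nevDeriv c' r' μ = 1 / r μ := by
  have hμ' : μ ∉ r'.support := Finset.disjoint_left.1 h.disjoint hμ
  have h1 := hasDerivAt_iff_tendsto_slope.1 (hasDerivAt_nev c' d' r' hμ')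
  have h2 := tendsto_nhds_unique h1 ((h.tendsto_slope hμ).congr fun z => by
    rw [slope_def_field, h.nev_eq_zero hμ, sub_zero])
  exact_mod_cast h2

theorem prod_sub_eq {S : Finset ℝ} (h0 : (0 : ℝ) ∉ S) (z : ℂ) :
    ∏ μ ∈ S, (z - (μ : ℂ)) = (∏ μ ∈ S, -(μ : ℂ)) * ∏ μ ∈ S, (1 - z / μ) := by
  rw [← Finset.prod_mul_distrib]
  refine Finset.prod_congr rfl fun μ hμ => ?_
  have : (μ : ℂ) ≠ 0 := by exact_mod_cast fun h : μ = 0 => h0 (h ▸ hμ)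
  field_simp
  ring

theorem prod_neg_ne_zero {S : Finset ℝ} (h0 : (0 : ℝ) ∉ S) : ∏ μ ∈ S, -(μ : ℂ) ≠ 0 :=
  Finset.prod_ne_zero_iff.2 fun μ hμ =>
    neg_ne_zero.2 (by exact_mod_cast fun h : μ = 0 => h0 (h ▸ hμ))

/-- Moving the base point across one point mass. -/
theorem exists_nev_step {l v ω : ℝ} {r₁ : ℝ →₀ ℝ} (hl : 0 < l) (hl1 : l < 1) (hv : 0 ≤ v)
    (hr : 0 ≤ r₁) (h0 : r₁ 0 = 0) (hne : v ≠ 0 ∨ ω ≠ 0) :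
    ∃ r : ℝ →₀ ℝ, 0 ≤ r ∧ r 0 = 0 ∧ l * (r.sum fun _ w => w) = 1 - l ∧
      (∀ z : ℂ, (∀ μ ∈ r₁.support, z ≠ μ) →
        (∏ μ ∈ r₁.support, (1 - z / μ)) * (1 - l * z * nev v ω r₁ z) =
          ∏ μ ∈ r.support, (1 - z / μ)) ∧
      (∀ z : ℂ, (∀ μ ∈ r₁.support, z ≠ μ) → (∀ μ ∈ r.support, z ≠ μ) →
        z * ((1 - l) * nev v ω r₁ z) = z * (nev 0 0 r z * (1 - l * z * nev v ω r₁ z))) := by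
  -- With `F = nev v ω r₁` put `H = F - 1/(l z)`, so `1 - l z F = -l z H`. Then `K = -1/H` satisfies
  -- `K(0) = 0`, `K'(0) = l`, and `(1 - l) F / (1 - l z F) = ((1 - l)/l²) (K - l z)/z²`, which by
  -- `nev_taylor` again has positive residues.
  set rH : ℝ →₀ ℝ := r₁ + Finsupp.single 0 (1 / l) with hrH
  have hH0 : rH 0 = 1 / l := by simp [hrH, h0]
  have hHx : ∀ μ, μ ≠ 0 → rH μ = r₁ μ := fun μ hμ => by
    simp [hrH, hμ]
  have h0r : (0 : ℝ) ∉ r₁.support := by simp [h0]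
  have hsupp : rH.support = insert 0 r₁.support := by
    ext μ
    by_cases hμ : μ = 0
    · subst hμ; simp [hH0, hl.ne']
    · simp [hHx μ hμ, hμ]
  have hrH0 : 0 ≤ rH := by
    refine add_nonneg hr ?_
    rw [Finsupp.single_nonneg]; positivity
  obtain ⟨c', d', r', hK⟩ := exists_isNegInv (d := ω) hv hrH0 (by tauto)
  have hc' : c' = 0 := by
    by_cases hv0 : v = 0
    · exact (hK.card_of_eq_of_ne hv0 (by tauto)).2.1
    · exact (hK.card_of_ne hv0).2.1
  have h0H : (0 : ℝ) ∈ rH.support := by rw [hsupp]; exact Finset.mem_insert_self _ _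
  have h0r' : (0 : ℝ) ∉ r'.support := Finset.disjoint_left.1 hK.disjoint h0H
  have hK0 := hK.nev_eq_zero h0H
  have hK1 := hK.nevDeriv_eq h0H
  rw [hH0, one_div_one_div] at hK1
  rw [Complex.ofReal_zero] at hK0
  have hne' : ∀ μ ∈ r'.support, (μ ^ 2)⁻¹ ≠ (0 : ℝ) := fun μ hμ =>
    inv_ne_zero (pow_ne_zero 2 fun h => h0r' (h ▸ hμ))
  set κ : ℝ := (1 - l) / l ^ 2 with hκ
  have hκ0 : 0 < κ := div_pos (by linarith) (by positivity)
  have hlC : (l : ℂ) ≠ 0 := by exact_mod_cast hl.ne'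
  set r : ℝ →₀ ℝ := κ • weighted (fun μ => (μ ^ 2)⁻¹) r' with hrdef
  have hrs : r.support = r'.support := by
    rw [hrdef, Finsupp.support_smul_eq hκ0.ne', support_weighted hne']
  have hHz : ∀ z : ℂ, nev v ω rH z = nev v ω r₁ z - 1 / l / z := fun z => by
    have := nev_add v 0 ω 0 r₁ (Finsupp.single 0 (1 / l)) z
    rw [add_zero, add_zero, nev_single_zero] at this
    rw [hrH, this]; push_cast; ring
  have hzS : ∀ {z : ℂ}, (∀ μ ∈ r₁.support, z ≠ μ) → z ≠ 0 → ∀ μ ∈ rH.support, z ≠ μ := by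
    intro z hz hz0 μ hμ
    rw [hsupp, Finset.mem_insert] at hμ
    rcases hμ with rfl | hμ
    · simpa using hz0
    · exact hz μ hμ
  refine ⟨r, ?_, ?_, ?_, ?_, ?_⟩
  · intro μ
    have := hK.nonneg μ
    simp only [Finsupp.coe_zero, Pi.zero_apply] at this
    simp only [hrdef, Finsupp.coe_zero, Pi.zero_apply, Finsupp.coe_smul, Pi.smul_apply,
      weighted_apply, smul_eq_mul]
    positivity
  · simp [hrdef]
  · have : (r.sum fun _ w => w) = κ * nevDeriv c' r' 0 := by
      rw [Finsupp.sum, hrs, nevDeriv, Finsupp.sum, hc', zero_add, Finset.mul_sum]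
      refine Finset.sum_congr rfl fun μ _ => ?_
      simp only [hrdef, Finsupp.coe_smul, Pi.smul_apply, weighted_apply, smul_eq_mul]
      ring
    rw [this, hK1, hκ]
    field_simp
  · intro z hz
    obtain ⟨k, hk, hprod⟩ := hK.prod_eq
    set k' : ℂ := -l * k * (∏ μ ∈ r'.support, -(μ : ℂ)) / ∏ μ ∈ r₁.support, -(μ : ℂ) with hk'
    have hA := prod_neg_ne_zero h0r
    have key : ∀ w : ℂ, (∀ μ ∈ r₁.support, w ≠ μ) → w ≠ 0 →
        (∏ μ ∈ r₁.support, (1 - w / μ)) * (1 - l * w * nev v ω r₁ w) =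
          k' * ∏ μ ∈ r'.support, (1 - w / μ) := by
      intro w hw hw0
      have h1 := hprod w (hzS hw hw0)
      rw [hsupp, Finset.prod_insert h0r, prod_sub_eq h0r, prod_sub_eq h0r', hHz] at h1
      rw [hk']
      rw [Complex.ofReal_zero, sub_zero] at h1
      field_simp
      have e : (nev v ω r₁ w - 1 / l / w) * (w * ((∏ μ ∈ r₁.support, -(μ : ℂ)) *
          ∏ μ ∈ r₁.support, (1 - w / μ))) = -(1 / l) * ((1 - l * w * nev v ω r₁ w) *
          ((∏ μ ∈ r₁.support, -(μ : ℂ)) * ∏ μ ∈ r₁.support, (1 - w / μ))) := by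
        field_simp
        ring
      rw [e] at h1
      have h2 := congrArg (fun t => -(l : ℂ) * t) h1
      field_simp at h2
      linear_combination h2
    -- Both sides are continuous at `0` and agree nearby; at `0` the left side is `1`, which fixes
    -- the constant.
    have hk1 : k' = 1 := by
      have hcF := continuousAt_nev v ω r₁ h0r
      rw [Complex.ofReal_zero] at hcF
      have hL : ContinuousAt (fun w : ℂ => (∏ μ ∈ r₁.support, (1 - w / μ)) *
          (1 - l * w * nev v ω r₁ w)) 0 := by fun_prop
      have hR : ContinuousAt (fun w : ℂ => k' * ∏ μ ∈ r'.support, (1 - w / μ)) 0 := by fun_prop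
      have hL' := hL.tendsto.mono_left (nhdsWithin_le_nhds (s := {(0 : ℂ)}ᶜ))
      have hR' := hR.tendsto.mono_left (nhdsWithin_le_nhds (s := {(0 : ℂ)}ᶜ))
      have := tendsto_nhds_unique hL' (hR'.congr' (by
        filter_upwards [eventually_nhdsNE_ne_coe r₁.support 0, eventually_mem_nhdsWithin]
          with w hw hw0 using (key w hw hw0).symm))
      simpa using this.symm
    by_cases hz0 : z = 0
    · simp [hz0]
    · rw [key z hz hz0, hk1, one_mul, hrs]
  · intro z hz hz'
    rw [hrs] at hz'
    by_cases hz0 : z = 0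
    · simp [hz0]
    · have hm := hK.mul_eq z (hzS hz hz0) hz'
      have ht := nev_taylor c' d' (by simpa using h0r' : r' 0 = 0) hz'
      rw [hK0, hK1, zero_add] at ht
      have hG : nev 0 0 r z = κ * nev 0 0 (weighted (fun μ => (μ ^ 2)⁻¹) r') z := by
        have := nev_smul κ 0 0 (weighted (fun μ => (μ ^ 2)⁻¹) r') z
        simpa using this
      rw [hHz, ht] at hm
      rw [hG, hκ]
      push_cast
      generalize nev v ω r₁ z = F at *
      generalize nev 0 0 (weighted (fun μ => (μ ^ 2)⁻¹) r') z = G at *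
      field_simp at hm
      have h2 : z * (F * l ^ 2 - G * (1 - l * z * F)) = 0 := by linear_combination hm
      have h3 := sub_eq_zero.1 ((mul_eq_zero.1 h2).resolve_left hz0)
      have h4 : (1 - l) * F = (1 - l) / l ^ 2 * (F * l ^ 2) := by field_simp
      rw [h4, h3]; ring

/-- Removing the point mass next to the base point. -/
theorem exists_nev_peel {r : ℝ →₀ ℝ} (hr : 0 ≤ r) (h0 : r 0 = 0) (hne : r ≠ 0) :
    ∃ (l v ω : ℝ) (r₁ : ℝ →₀ ℝ), 0 < l ∧ l < 1 ∧ 0 ≤ v ∧ 0 ≤ r₁ ∧ r₁ 0 = 0 ∧ (v ≠ 0 ∨ ω ≠ 0) ∧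
      r₁.support.card < r.support.card ∧
      ∀ᶠ z : ℂ in cofinite, (1 - l) * nev v ω r₁ z = nev 0 0 r z * (1 - l * z * nev v ω r₁ z) := by
  have h0r : (0 : ℝ) ∉ r.support := by simp [h0]
  have hne0 : ∀ μ ∈ r.support, μ ≠ 0 := fun μ hμ h => h0r (h ▸ hμ)
  have hne2 : ∀ μ ∈ r.support, μ ^ 2 ≠ 0 := fun μ hμ => pow_ne_zero 2 (hne0 μ hμ)
  set s := ∑ μ ∈ r.support, r μ with hs
  have hs0 : 0 < s := Finset.sum_pos
    (fun μ hμ => lt_of_le_of_ne (hr μ) (Finsupp.mem_support_iff.1 hμ).symm)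
    (Finsupp.support_nonempty_iff.2 hne)
  set t := ∑ μ ∈ r.support, r μ * μ with ht
  set rJ := weighted (fun μ => μ ^ 2) r with hrJ
  have hsJ : rJ.support = r.support := support_weighted hne2
  have hJnn : 0 ≤ rJ := fun μ => mul_nonneg (sq_nonneg μ) (hr μ)
  have hJne : rJ ≠ 0 := by
    rw [Ne, ← Finsupp.support_eq_empty, hsJ, Finsupp.support_eq_empty]; exact hne
  -- Up to a factor this is the `K` of the forward step: `z² G + s z`, where `G = nev 0 0 r` and `s`
  -- is the residue sum. It vanishes at `0` with derivative `s`, so its negative reciprocal has a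
  -- pole at `0` with residue parameter `1/s`.
  have hJ : ∀ z : ℂ, (∀ μ ∈ r.support, z ≠ μ) →
      nev 0 (-t) rJ z = z ^ 2 * nev 0 0 r z + z * s := by
    intro z hz
    rw [hrJ, nev_weighted _ _ hne2, nev, Finsupp.sum, hs, ht]
    push_cast
    simp only [zero_mul, zero_add, Finset.mul_sum, ← Finset.sum_neg_distrib,
      ← Finset.sum_add_distrib]
    refine Finset.sum_congr rfl fun μ hμ => ?_
    have h2 : (μ : ℂ) - z ≠ 0 := sub_ne_zero.2 (hz μ hμ).symm
    field_simp
    ring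
  obtain ⟨c', d', r', hK⟩ := exists_isNegInv (c := 0) (d := -t) le_rfl hJnn (by tauto)
  have hz0 : ∀ μ ∈ rJ.support, (0 : ℂ) ≠ μ := by
    intro μ hμ h; rw [hsJ] at hμ; exact hne0 μ hμ (by exact_mod_cast h.symm)
  have h0' : (0 : ℝ) ∈ r'.support := by
    obtain ⟨ν, hν, h⟩ := (hK.eq_zero_iff 0 hz0).1 (by rw [hJ 0 (by rwa [hsJ] at hz0)]; simp)
    have : ν = 0 := by exact_mod_cast h.symm
    rwa [this] at hν
  have hd : nevDeriv 0 rJ 0 = s := by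
    rw [nevDeriv, Finsupp.sum, hsJ, zero_add]
    refine Finset.sum_congr rfl fun μ hμ => ?_
    have := hne0 μ hμ
    simp only [hrJ, weighted_apply, sub_zero]
    field_simp
  have hres : r' 0 = 1 / s := by rw [hK.residue 0 h0', hd]
  set κ := s * (s + 1) with hκ
  have hκ0 : 0 < κ := by positivity
  have hcard : r'.support.card ≤ r.support.card := by
    rw [← hsJ]
    by_cases ht0 : -t = 0
    · have := (hK.card_of_eq rfl ht0).1; omega
    · exact (hK.card_of_eq_of_ne rfl ht0).1.le
  have hc' : 0 ≤ c' := by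
    by_cases ht0 : -t = 0
    · exact (hK.card_of_eq rfl ht0).2.le
    · exact (hK.card_of_eq_of_ne rfl ht0).2.1.ge
  have hs1 : (1 + s : ℂ) ≠ 0 := by exact_mod_cast (by positivity : 1 + s ≠ 0)
  have hsC : (s : ℂ) ≠ 0 := by exact_mod_cast hs0.ne'
  -- The sum rule `l s = 1 - l` forces `l = 1/(1 + s)`, and `κ = s(s + 1)` equals `(1 - l)/l²`.
  -- Erasing the pole at `0` removes the term `-1/(l z)` from the rescaled reciprocal and makes the
  -- number of poles drop, so the peeling terminates.
  refine ⟨1 / (1 + s), κ * c', κ * d', κ • r'.erase 0, by positivity, ?_, by positivity, ?_, ?_, ?_,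
    ?_, ?_⟩
  · rw [div_lt_one (by positivity)]; linarith
  · intro μ
    have h1 := hK.nonneg μ
    simp only [Finsupp.coe_zero, Pi.zero_apply] at h1
    by_cases hμ : μ = 0
    · simp [hμ]
    · simp only [Finsupp.coe_zero, Pi.zero_apply, Finsupp.coe_smul, Pi.smul_apply, smul_eq_mul,
        Finsupp.erase_ne hμ]
      positivity
  · simp
  · by_cases ht0 : -t = 0
    · exact Or.inl (mul_ne_zero hκ0.ne' (hK.card_of_eq rfl ht0).2.ne')
    · refine Or.inr (mul_ne_zero hκ0.ne' ?_)
      rw [(hK.card_of_eq_of_ne rfl ht0).2.2]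
      exact div_ne_zero (by norm_num) ht0
  · rw [Finsupp.support_smul_eq hκ0.ne', Finsupp.support_erase]
    exact lt_of_lt_of_le (Finset.card_erase_lt_of_mem h0') hcard
  · filter_upwards [eventually_cofinite_ne_coe r.support, eventually_cofinite_ne_coe r'.support,
      eventually_cofinite_ne_coe {0}] with z hz hz' hz0
    have hz0 : z ≠ 0 := by simpa using hz0
    have hm := hK.mul_eq z (by rwa [hsJ]) hz'
    rw [hJ z hz, nev_eq_erase c' d' r' 0, hres] at hm
    rw [nev_smul]
    generalize nev c' d' (r'.erase 0) z = G at *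
    generalize nev 0 0 r z = F at *
    rw [hκ]
    push_cast at *
    rw [zero_sub] at hm
    field_simp at hm ⊢
    have h2 : z * (G * s * (s + z * F) - F) = 0 := by linear_combination hm
    have h3 := (mul_eq_zero.1 h2).resolve_left hz0
    linear_combination (1 + (s : ℂ)) * h3

/-! ### The solution at `+∞` by transfer across the mass points -/

/-- The weight `z ω({x}) + z² v({x})`. -/
noncomputable def potential (p : DiscretePair) (z : ℂ) (x : ℝ) : ℂ :=
  z * (p.1 x : ℂ) + z ^ 2 * ((p.2 x : ℝ) : ℂ)

theorem notMem_massPoints {p : DiscretePair} {x : ℝ} :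
    x ∉ massPoints p ↔ p.1 x = 0 ∧ p.2 x = 0 := by
  simp [massPoints]

theorem potential_eq_zero {p : DiscretePair} {x : ℝ} (hx : x ∉ massPoints p) (z : ℂ) :
    potential p z x = 0 := by
  obtain ⟨h1, h2⟩ := notMem_massPoints.1 hx
  simp [potential, h1, h2]

theorem potential_eq_mul_nev (p : DiscretePair) (z : ℂ) (x : ℝ) :
    potential p z x = z * nev (p.2 x) (p.1 x) 0 z := by
  simp [potential, nev]; ring

/-- The effect of the point mass at `x` on the coefficients of `exp (-x / 2)`, `exp (x / 2)`. -/
noncomputable def transfer (p : DiscretePair) (z : ℂ) (x : ℝ) (u : ℂ × ℂ) : ℂ × ℂ :=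
  (u.1 - potential p z x * (u.1 + u.2 * Real.exp x),
    u.2 + potential p z x * (u.1 * Real.exp (-x) + u.2))

/-- The mass points to the right of `a`. -/
noncomputable def rightPoints (p : DiscretePair) (a : ℝ) : Finset ℝ := (massPoints p).filter (a < ·)

/-- The coefficients of `φ₊(z, ·)` immediately to the right of `a` with respect to
`exp (-x / 2)`, `exp (x / 2)`. -/
noncomputable def coef (p : DiscretePair) (z : ℂ) (a : ℝ) : ℂ × ℂ :=
  ((rightPoints p a).sort (· ≤ ·)).foldr (transfer p z) (1, 0)

/-- `x` is the first mass point to the right of `a`. -/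
structure IsNext (p : DiscretePair) (a x : ℝ) : Prop where
  lt : a < x
  mem : x ∈ massPoints p
  le : ∀ y ∈ massPoints p, a < y → x ≤ y

theorem mem_rightPoints {p : DiscretePair} {a x : ℝ} :
    x ∈ rightPoints p a ↔ x ∈ massPoints p ∧ a < x := Finset.mem_filter

theorem self_notMem_rightPoints (p : DiscretePair) (a : ℝ) : a ∉ rightPoints p a := by
  simp [mem_rightPoints]

theorem IsNext.rightPoints_eq {p : DiscretePair} {a x : ℝ} (h : IsNext p a x) :
    rightPoints p a = insert x (rightPoints p x) := by
  ext y
  simp only [mem_rightPoints, Finset.mem_insert]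
  constructor
  · rintro ⟨h1, h2⟩
    rcases (h.le y h1 h2).eq_or_lt with h3 | h3
    · exact Or.inl h3.symm
    · exact Or.inr ⟨h1, h3⟩
  · rintro (rfl | ⟨h1, h2⟩)
    · exact ⟨h.mem, h.lt⟩
    · exact ⟨h1, h.lt.trans h2⟩

theorem exists_isNext {p : DiscretePair} {a : ℝ} (h : (rightPoints p a).Nonempty) :
    ∃ x, IsNext p a x := by
  have := mem_rightPoints.1 ((rightPoints p a).min'_mem h)
  exact ⟨_, this.2, this.1, fun y hy hay => Finset.min'_le _ _ (mem_rightPoints.2 ⟨hy, hay⟩)⟩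

theorem right_induction (p : DiscretePair) {P : ℝ → Prop}
    (h0 : ∀ a, rightPoints p a = ∅ → P a) (h1 : ∀ a x, IsNext p a x → P x → P a) (a : ℝ) : P a := by
  induction hn : (rightPoints p a).card generalizing a with
  | zero => exact h0 a (Finset.card_eq_zero.1 hn)
  | succ n ih =>
    obtain ⟨x, hx⟩ := exists_isNext (p := p) (a := a) (Finset.card_pos.1 (by omega))
    refine h1 a x hx (ih x ?_)
    rw [hx.rightPoints_eq, Finset.card_insert_of_notMem (self_notMem_rightPoints p x)] at hn
    omega

theorem coef_of_eq_empty {p : DiscretePair} {a : ℝ} (h : rightPoints p a = ∅) (z : ℂ) :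
    coef p z a = (1, 0) := by simp [coef, h]

theorem IsNext.coef_eq {p : DiscretePair} {a x : ℝ} (h : IsNext p a x) (z : ℂ) :
    coef p z a = transfer p z x (coef p z x) := by
  unfold coef
  rw [h.rightPoints_eq, Finset.sort_insert (· ≤ ·)
    (fun b hb => (mem_rightPoints.1 hb).2.le) (self_notMem_rightPoints p x), List.foldr_cons]

/-- The value of `φ₊(z, ·)`, times `exp (a / 2)`. -/
noncomputable def rightValue (p : DiscretePair) (z : ℂ) (a : ℝ) : ℂ :=
  (coef p z a).1 + (coef p z a).2 * Real.exp a

/-- The coefficient of the growing exponential in `φ₊(z, ·)`, times `exp a`. -/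
noncomputable def rightSlope (p : DiscretePair) (z : ℂ) (a : ℝ) : ℂ := (coef p z a).2 * Real.exp a

/-- The function `φ₊(z, ·)`. -/
noncomputable def phiPlus (p : DiscretePair) (z : ℂ) (a : ℝ) : ℂ :=
  Real.exp (-a / 2) * rightValue p z a

theorem rightValue_of_eq_empty {p : DiscretePair} {a : ℝ} (h : rightPoints p a = ∅) (z : ℂ) :
    rightValue p z a = 1 := by simp [rightValue, coef_of_eq_empty h]

theorem rightSlope_of_eq_empty {p : DiscretePair} {a : ℝ} (h : rightPoints p a = ∅) (z : ℂ) :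
    rightSlope p z a = 0 := by simp [rightSlope, coef_of_eq_empty h]

/-- The mass at `x` adds `potential` times the value to the slope; free propagation from `x` to `a`
then multiplies the slope by `exp (a - x)` and keeps value minus slope constant. -/
theorem IsNext.rightSlope_eq {p : DiscretePair} {a x : ℝ} (h : IsNext p a x) (z : ℂ) :
    rightSlope p z a =
      Real.exp (a - x) * (rightSlope p z x + potential p z x * rightValue p z x) := by
  unfold rightSlope rightValue
  rw [h.coef_eq]
  have h1 : Real.exp (a - x) = Real.exp a * Real.exp (-x) := by rw [← Real.exp_add]; ring_nf
  have h2 : (Real.exp (-x) : ℂ) * Real.exp x = 1 := by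
    rw [← Complex.ofReal_mul, ← Real.exp_add]; simp
  rw [h1]
  simp only [transfer]
  push_cast at *
  linear_combination (-(coef p z x).2 - potential p z x * (coef p z x).2) * Complex.exp a * h2

theorem IsNext.rightValue_eq {p : DiscretePair} {a x : ℝ} (h : IsNext p a x) (z : ℂ) :
    rightValue p z a = rightValue p z x - (1 - Real.exp (a - x)) *
      (rightSlope p z x + potential p z x * rightValue p z x) := by
  unfold rightSlope rightValue
  rw [h.coef_eq]
  have h1 : Real.exp (a - x) = Real.exp a * Real.exp (-x) := by rw [← Real.exp_add]; ring_nf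
  have h2 : (Real.exp (-x) : ℂ) * Real.exp x = 1 := by
    rw [← Complex.ofReal_mul, ← Real.exp_add]; simp
  rw [h1]
  simp only [transfer]
  push_cast at *
  linear_combination (-(coef p z x).2 - potential p z x * (coef p z x).2) * Complex.exp a * h2

theorem exp_half_mul (x y : ℝ) : (Real.exp (-x / 2) : ℂ) * Real.exp (y / 2) = Real.exp ((y - x) / 2) := by
  rw [← Complex.ofReal_mul, ← Real.exp_add]; ring_nf

/-- Unrolling the transfer recursion into a sum over masses links it to the Green function
representation of solutions. -/
theorem coef_fst (p : DiscretePair) (z : ℂ) (a : ℝ) :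
    (coef p z a).1 =
      1 - ∑ x ∈ rightPoints p a, potential p z x * phiPlus p z x * Real.exp (x / 2) := by
  induction a using right_induction p with
  | h0 a h => simp [coef_of_eq_empty h, h]
  | h1 a x h ih =>
    rw [h.rightPoints_eq, Finset.sum_insert (self_notMem_rightPoints p x), h.coef_eq]
    simp only [transfer]
    have e : phiPlus p z x =
        Real.exp (-x / 2) * ((coef p z x).1 + (coef p z x).2 * Real.exp x) := rfl
    have h2 : (Real.exp (-x / 2) : ℂ) * Real.exp (x / 2) = 1 := by rw [exp_half_mul]; simp
    linear_combination ih + potential p z x * Real.exp (x / 2) * e +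
      potential p z x * ((coef p z x).1 + (coef p z x).2 * Real.exp x) * h2

theorem coef_snd (p : DiscretePair) (z : ℂ) (a : ℝ) :
    (coef p z a).2 =
      ∑ x ∈ rightPoints p a, potential p z x * phiPlus p z x * Real.exp (-x / 2) := by
  induction a using right_induction p with
  | h0 a h => simp [coef_of_eq_empty h, h]
  | h1 a x h ih =>
    rw [h.rightPoints_eq, Finset.sum_insert (self_notMem_rightPoints p x), h.coef_eq]
    simp only [transfer]
    have e : phiPlus p z x =
        Real.exp (-x / 2) * ((coef p z x).1 + (coef p z x).2 * Real.exp x) := rfl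
    have h2 : (Real.exp (-x / 2) : ℂ) * Real.exp (-x / 2) = Real.exp (-x) := by
      rw [← Complex.ofReal_mul, ← Real.exp_add]; ring_nf
    have h3 : (Real.exp (-x) : ℂ) * Real.exp x = 1 := by
      rw [← Complex.ofReal_mul, ← Real.exp_add]; simp
    linear_combination ih - potential p z x * Real.exp (-x / 2) * e
      -potential p z x * ((coef p z x).1 + (coef p z x).2 * Real.exp x) * h2 -
        potential p z x * (coef p z x).2 * h3

/-- Locality: this lets the two sides of `a` be prescribed independently. -/
theorem coef_congr {p p' : DiscretePair} {a : ℝ}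
    (h : ∀ x, a < x → p.1 x = p'.1 x ∧ p.2 x = p'.2 x) (z : ℂ) : coef p z a = coef p' z a := by
  have hm : ∀ x, a < x → (x ∈ massPoints p ↔ x ∈ massPoints p') := fun x hx => by
    rw [← not_iff_not, notMem_massPoints, notMem_massPoints, (h x hx).1, (h x hx).2]
  induction a using right_induction p with
  | h0 a h0 =>
    have h1 : rightPoints p' a = ∅ := by
      rw [Finset.eq_empty_iff_forall_notMem] at h0 ⊢
      intro x hx
      obtain ⟨h1, h2⟩ := mem_rightPoints.1 hx
      exact h0 x (mem_rightPoints.2 ⟨(hm x h2).2 h1, h2⟩)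
    rw [coef_of_eq_empty h0, coef_of_eq_empty h1]
  | h1 a x hx ih =>
    have hx' : IsNext p' a x := ⟨hx.lt, (hm x hx.lt).1 hx.mem, fun y hy hay =>
      hx.le y ((hm y hay).2 hy) hay⟩
    rw [hx.coef_eq, hx'.coef_eq, ih (fun y hy => h y (hx.lt.trans hy))
      fun y hy => hm y (hx.lt.trans hy)]
    simp [transfer, potential, h x hx.lt]

theorem continuous_coef (p : DiscretePair) (a : ℝ) : Continuous fun z => coef p z a := by
  induction a using right_induction p with
  | h0 a h => simp only [coef_of_eq_empty h]; exact continuous_const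
  | h1 a x h ih =>
    simp only [h.coef_eq, transfer, potential]
    fun_prop

theorem continuous_rightValue (p : DiscretePair) (a : ℝ) : Continuous fun z => rightValue p z a := by
  have := continuous_coef p a
  unfold rightValue
  fun_prop

theorem continuous_rightSlope (p : DiscretePair) (a : ℝ) : Continuous fun z => rightSlope p z a := by
  have := continuous_coef p a
  unfold rightSlope
  fun_prop

theorem continuous_phiPlus (p : DiscretePair) (a : ℝ) : Continuous fun z => phiPlus p z a := by
  have := continuous_rightValue p a
  unfold phiPlus
  fun_prop

/-! ### One-sided inverse problem: residues and masses -/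

/-- `r` is the residue data of the logarithmic derivative of `φ₊(z, ·)` immediately to the right
of `a`. -/
structure IsRightData (p : DiscretePair) (a : ℝ) (r : ℝ →₀ ℝ) : Prop where
  nonneg : 0 ≤ r
  zero : r 0 = 0
  value : ∀ z, rightValue p z a = ∏ μ ∈ r.support, (1 - z / μ)
  slope : ∀ z : ℂ, (∀ μ ∈ r.support, z ≠ μ) →
    rightSlope p z a = z * nev 0 0 r z * rightValue p z a
  slope_ne : ∀ z, rightValue p z a = 0 → rightSlope p z a ≠ 0

theorem IsRightData.value_ne_zero {p : DiscretePair} {a : ℝ} {r : ℝ →₀ ℝ} (h : IsRightData p a r)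
    {z : ℂ} (hz : ∀ μ ∈ r.support, z ≠ μ) : rightValue p z a ≠ 0 := by
  rw [h.value, Finset.prod_ne_zero_iff]
  intro μ hμ h0
  have hμ0 : (μ : ℂ) ≠ 0 := by
    exact_mod_cast fun h' : μ = 0 => Finsupp.mem_support_iff.1 hμ (h' ▸ h.zero)
  rw [sub_eq_zero, eq_comm, div_eq_one_iff_eq hμ0] at h0
  exact hz μ hμ h0

theorem IsRightData.value_eq_zero {p : DiscretePair} {a : ℝ} {r : ℝ →₀ ℝ} (h : IsRightData p a r)
    {μ : ℝ} (hμ : μ ∈ r.support) : rightValue p μ a = 0 := by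
  have hμ0 : (μ : ℂ) ≠ 0 := by
    exact_mod_cast fun h' : μ = 0 => Finsupp.mem_support_iff.1 hμ (h' ▸ h.zero)
  rw [h.value]
  exact Finset.prod_eq_zero hμ (by rw [div_self hμ0, sub_self])

theorem IsRightData.eq_of_eventually {p : DiscretePair} {a : ℝ} {r r' : ℝ →₀ ℝ}
    (h : IsRightData p a r)
    (h' : ∀ᶠ z in cofinite, rightSlope p z a = z * nev 0 0 r' z * rightValue p z a) : r = r' := by
  refine (nev_injective (c := 0) (d := 0) (c' := 0) (d' := 0) ?_).2.2
  filter_upwards [h', eventually_cofinite_ne_coe r.support, eventually_cofinite_ne_coe {0}]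
    with z hz hzr hz0
  have hz0 : z ≠ 0 := by simpa using hz0
  rw [h.slope z hzr] at hz
  exact mul_left_cancel₀ hz0 (mul_right_cancel₀ (h.value_ne_zero hzr) hz)

theorem isRightData_zero {p : DiscretePair} {a : ℝ} (h : rightPoints p a = ∅) :
    IsRightData p a 0 where
  nonneg := le_rfl
  zero := rfl
  value z := by simp [rightValue_of_eq_empty h]
  slope z _ := by simp [rightSlope_of_eq_empty h]
  slope_ne z hz := by simp [rightValue_of_eq_empty h] at hz

theorem IsNext.exp_lt_one {p : DiscretePair} {a x : ℝ} (h : IsNext p a x) : Real.exp (a - x) < 1 :=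
  Real.exp_lt_one_iff.2 (by linarith [h.lt])

theorem potential_add_nev (p : DiscretePair) (z : ℂ) (x : ℝ) (r : ℝ →₀ ℝ) :
    z * nev (p.2 x) (p.1 x) r z = potential p z x + z * nev 0 0 r z := by
  rw [potential_eq_mul_nev, ← mul_add, ← nev_add]; simp

/-- Inserting the Weyl function into the recursions multiplies the value by `1 - l z F` with `l = 1
- exp (a - x)`, which is the situation of `exists_nev_step`. The last two conclusions serve
uniqueness: the residue sum recovers `x`, and the relation recovers `F`, hence the weights at `x`
and the data beyond. -/
theorem IsRightData.step {p : DiscretePair} {a x : ℝ} {r₁ : ℝ →₀ ℝ} (h : IsRightData p x r₁)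
    (hx : IsNext p a x) :
    ∃ r, IsRightData p a r ∧
      (1 - Real.exp (a - x)) * (r.sum fun _ w => w) = Real.exp (a - x) ∧
      ∀ᶠ z : ℂ in cofinite, Real.exp (a - x) * nev (p.2 x) (p.1 x) r₁ z =
        nev 0 0 r z * (1 - (1 - Real.exp (a - x)) * z * nev (p.2 x) (p.1 x) r₁ z) := by
  have he := hx.exp_lt_one
  have he0 := Real.exp_pos (a - x)
  set e := Real.exp (a - x) with hedef
  have hne : ((p.2 x : ℝ≥0) : ℝ) ≠ 0 ∨ p.1 x ≠ 0 := by
    by_contra hcon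
    push Not at hcon
    exact notMem_massPoints.2 ⟨hcon.2, by exact_mod_cast hcon.1⟩ hx.mem
  obtain ⟨r, hr, hr0, hsum, hprod, hrel⟩ := exists_nev_step (l := 1 - e) (v := p.2 x) (ω := p.1 x)
    (by linarith) (by linarith) (p.2 x).2 h.nonneg h.zero hne
  have hval : ∀ z : ℂ, (∀ μ ∈ r₁.support, z ≠ μ) → rightValue p z a = rightValue p z x *
      (1 - (1 - e) * z * nev (p.2 x) (p.1 x) r₁ z) := fun z hz => by
    rw [hx.rightValue_eq, h.slope z hz, mul_assoc _ z, potential_add_nev, ← hedef]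
    ring
  have hslo : ∀ z : ℂ, (∀ μ ∈ r₁.support, z ≠ μ) → rightSlope p z a = e * rightValue p z x *
      (z * nev (p.2 x) (p.1 x) r₁ z) := fun z hz => by
    rw [hx.rightSlope_eq, h.slope z hz, potential_add_nev, ← hedef]
    ring
  refine ⟨r, ⟨hr, hr0, ?_, ?_, ?_⟩, by linarith, ?_⟩
  · have hc1 := continuous_rightValue p a
    have hc2 : Continuous fun z : ℂ => ∏ μ ∈ r.support, (1 - z / μ) := by fun_prop
    have hden : Dense {z : ℂ | ∀ μ ∈ r₁.support, z ≠ μ} :=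
      (Set.Countable.dense_compl ℝ (s := {z : ℂ | ¬ ∀ μ ∈ r₁.support, z ≠ μ})
        (Set.Finite.countable (eventually_cofinite_ne_coe r₁.support))).mono fun z hz => by simpa using hz
    intro z
    refine congrFun (hc1.ext_on hden hc2 fun z hz => ?_) z
    have hz : ∀ μ ∈ r₁.support, z ≠ μ := hz
    simp only
    rw [hval z hz, ← hprod z hz, h.value]
    push_cast
    ring
  · have key : ∀ z : ℂ, (∀ μ ∈ r₁.support, z ≠ μ) → (∀ μ ∈ r.support, z ≠ μ) →
        rightSlope p z a = z * nev 0 0 r z * rightValue p z a := fun z hz1 hz => by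
      rw [hval z hz1, hslo z hz1]
      have := hrel z hz1 hz
      push_cast at this
      linear_combination rightValue p z x * this
    intro z hz
    -- A pole of the old data that is not a pole of the new one is a removable exception, filled in
    -- by continuity.
    by_cases hz1 : ∀ μ ∈ r₁.support, z ≠ μ
    · exact key z hz1 hz
    · push Not at hz1
      obtain ⟨μ, hμ, rfl⟩ := hz1
      have hμr : μ ∉ r.support := fun h => hz μ h rfl
      have hL : ContinuousAt (fun z => rightSlope p z a) (μ : ℂ) :=
        (continuous_rightSlope p a).continuousAt
      have hR : ContinuousAt (fun z => z * nev 0 0 r z * rightValue p z a) (μ : ℂ) := by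
        have h1 := continuousAt_nev 0 0 r hμr
        have h2 := (continuous_rightValue p a).continuousAt (x := (μ : ℂ))
        fun_prop
      refine tendsto_nhds_unique (hL.tendsto.mono_left (nhdsWithin_le_nhds (s := {(μ : ℂ)}ᶜ)))
        ((hR.tendsto.mono_left nhdsWithin_le_nhds).congr' ?_)
      filter_upwards [eventually_nhdsNE_ne_coe r₁.support μ, eventually_nhdsNE_ne_coe r.support μ]
        with w h1 h2 using (key w h1 h2).symm
  · intro z hz hs
    rw [hx.rightSlope_eq] at hs
    have hs' := (mul_eq_zero.1 hs).resolve_left (by exact_mod_cast he0.ne')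
    rw [hx.rightValue_eq, hs', mul_zero, sub_zero] at hz
    rw [hz, mul_zero, add_zero] at hs'
    exact h.slope_ne z hz hs'
  · filter_upwards [eventually_cofinite_ne_coe r₁.support, eventually_cofinite_ne_coe r.support,
      eventually_cofinite_ne_coe {0}] with z hz hz' hz0
    have hz0 : z ≠ 0 := by simpa using hz0
    have := mul_left_cancel₀ hz0 (hrel z hz hz')
    push_cast at this
    linear_combination this

theorem exists_isRightData (p : DiscretePair) (a : ℝ) : ∃ r, IsRightData p a r := by
  induction a using right_induction p with
  | h0 a h => exact ⟨0, isRightData_zero h⟩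
  | h1 a x hx ih =>
    obtain ⟨r₁, h₁⟩ := ih
    obtain ⟨r, h, -⟩ := h₁.step hx
    exact ⟨r, h⟩

theorem IsRightData.unique {p : DiscretePair} {a : ℝ} {r r' : ℝ →₀ ℝ} (h : IsRightData p a r)
    (h' : IsRightData p a r') : r = r' :=
  h.eq_of_eventually (by
    filter_upwards [eventually_cofinite_ne_coe r'.support] with z hz using h'.slope z hz)

theorem IsRightData.congr {p p' : DiscretePair} {a : ℝ} {r : ℝ →₀ ℝ} (h : IsRightData p a r)
    (hp : ∀ x, a < x → p.1 x = p'.1 x ∧ p.2 x = p'.2 x) : IsRightData p' a r := by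
  have hc : ∀ z, coef p' z a = coef p z a := fun z => (coef_congr hp z).symm
  have hv : ∀ z, rightValue p' z a = rightValue p z a := fun z => by simp [rightValue, hc]
  have hs : ∀ z, rightSlope p' z a = rightSlope p z a := fun z => by simp [rightSlope, hc]
  refine ⟨h.nonneg, h.zero, ?_, ?_, ?_⟩ <;> simp only [hv, hs]
  exacts [h.value, h.slope, h.slope_ne]

/-- Induction on the number of poles: peel off one mass, realise the remaining residues beyond it,
and restore the mass. -/
theorem exists_pair_of_rightData (a : ℝ) {r : ℝ →₀ ℝ} (hr : 0 ≤ r) (h0 : r 0 = 0) :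
    ∃ p : DiscretePair, (∀ x ≤ a, p.1 x = 0 ∧ p.2 x = 0) ∧ IsRightData p a r := by
  induction hn : r.support.card using Nat.strong_induction_on generalizing a r with
  | _ n ih =>
  by_cases hr0 : r = 0
  · subst hr0
    exact ⟨0, fun x _ => by simp, isRightData_zero (by simp [rightPoints, massPoints])⟩
  obtain ⟨l, v, ω, r₁, hl, hl1, hv, hr₁, hr₁0, hne, hcard, hrel⟩ := exists_nev_peel hr h0 hr0
  -- Chosen so that `exp (a - x) = 1 - l`; then `0 < l < 1` puts `x` to the right of `a`.
  set x := a - Real.log (1 - l) with hx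
  have hax : Real.exp (a - x) = 1 - l := by
    rw [hx, sub_sub_cancel, Real.exp_log (by linarith)]
  have haltx : a < x := by
    have := Real.log_neg (show 0 < 1 - l by linarith) (by linarith)
    linarith
  obtain ⟨p', hp', hd'⟩ := ih _ (hn ▸ hcard) x hr₁ hr₁0 rfl
  let p : DiscretePair := (p'.1 + Finsupp.single x ω, p'.2 + Finsupp.single x v.toNNReal)
  have hpx : p.1 x = ω ∧ ((p.2 x : ℝ≥0) : ℝ) = v := by
    simp [p, hp' x le_rfl, hv]
  have hpy : ∀ y, y ≠ x → p.1 y = p'.1 y ∧ p.2 y = p'.2 y := fun y hy => by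
    simp [p, hy]
  have hnext : IsNext p a x := by
    refine ⟨haltx, ?_, fun y hy hay => ?_⟩
    · by_contra hcon
      obtain ⟨h1, h2⟩ := notMem_massPoints.1 hcon
      rw [h1, h2] at hpx
      rcases hne with h | h
      · exact h hpx.2.symm
      · exact h hpx.1.symm
    · by_contra hlt
      push Not at hlt
      refine notMem_massPoints.2 ?_ hy
      rw [(hpy y hlt.ne).1, (hpy y hlt.ne).2]
      exact hp' y hlt.le
  have hd : IsRightData p x r₁ := hd'.congr fun y hy => by
    rw [(hpy y hy.ne').1, (hpy y hy.ne').2]; exact ⟨rfl, rfl⟩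
  obtain ⟨r', hr', -, hrel'⟩ := hd.step hnext
  refine ⟨p, fun y hy => ?_, ?_⟩
  · rw [(hpy y (hy.trans_lt haltx).ne).1, (hpy y (hy.trans_lt haltx).ne).2]
    exact hp' y (hy.trans haltx.le)
  · have : r' = r := by
      refine (nev_injective (c := 0) (d := 0) (c' := 0) (d' := 0) ?_).2.2
      filter_upwards [hrel, hrel'] with z h1 h2
      rw [hpx.1, hpx.2, hax] at h2
      push_cast at h2
      rw [sub_sub_cancel, h1] at h2
      refine (mul_right_cancel₀ ?_ h2).symm
      intro h3
      rw [h3, mul_zero] at h1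
      have h4 : (1 - l : ℂ) ≠ 0 := by exact_mod_cast (show (1 - l) ≠ 0 by linarith)
      rw [(mul_eq_zero.1 h1).resolve_left h4, mul_zero, sub_zero] at h3
      exact one_ne_zero h3
    exact this ▸ hr'

theorem IsRightData.eq_zero_iff {p : DiscretePair} {a : ℝ} {r : ℝ →₀ ℝ} (h : IsRightData p a r) :
    r = 0 ↔ rightPoints p a = ∅ := by
  constructor
  · rintro rfl
    by_contra hne
    obtain ⟨x, hx⟩ := exists_isNext (Finset.nonempty_iff_ne_empty.2 hne)
    obtain ⟨r₁, h₁⟩ := exists_isRightData p x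
    obtain ⟨r, hr, hsum, -⟩ := h₁.step hx
    rw [← h.unique hr] at hsum
    simp at hsum
    exact (Real.exp_pos _).ne hsum
  · exact fun h0 => h.unique (isRightData_zero h0)

/-- The residue sum `e/(1 - e)`, with `e = exp (a - x)`, locates the nearest mass; the step relation
can then be solved for `F`, and uniqueness of partial fractions reads off the weights and the
residues at `x`. -/
theorem IsRightData.pair_unique {p p' : DiscretePair} {a : ℝ} {r : ℝ →₀ ℝ} (h : IsRightData p a r)
    (h' : IsRightData p' a r) : ∀ x, a < x → p.1 x = p'.1 x ∧ p.2 x = p'.2 x := by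
  induction a using right_induction p generalizing r with
  | h0 a h0 =>
    have h1 := h'.eq_zero_iff.1 (h.eq_zero_iff.2 h0)
    intro x hx
    have key : ∀ q : DiscretePair, rightPoints q a = ∅ → q.1 x = 0 ∧ q.2 x = 0 := fun q hq => by
      refine notMem_massPoints.1 fun hm => ?_
      exact Finset.eq_empty_iff_forall_notMem.1 hq x (mem_rightPoints.2 ⟨hm, hx⟩)
    rw [(key p h0).1, (key p h0).2, (key p' h1).1, (key p' h1).2]
    exact ⟨rfl, rfl⟩
  | h1 a x hx ih =>
    have hne : (rightPoints p' a).Nonempty := by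
      rw [Finset.nonempty_iff_ne_empty, Ne, ← h'.eq_zero_iff, h.eq_zero_iff]
      exact Finset.ne_empty_of_mem (mem_rightPoints.2 ⟨hx.mem, hx.lt⟩)
    obtain ⟨x', hx'⟩ := exists_isNext hne
    obtain ⟨r₁, h₁⟩ := exists_isRightData p x
    obtain ⟨r₁', h₁'⟩ := exists_isRightData p' x'
    obtain ⟨s, hs, hsum, hrel⟩ := h₁.step hx
    obtain ⟨s', hs', hsum', hrel'⟩ := h₁'.step hx'
    obtain rfl := h.unique hs
    obtain rfl := h'.unique hs'
    have hxx : x = x' := by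
      have h1 := hx.exp_lt_one
      have h2 := hx'.exp_lt_one
      set σ := r.sum fun _ w => w
      have : Real.exp (a - x) = Real.exp (a - x') := by
        have h3 : σ = Real.exp (a - x) * (1 + σ) := by linarith
        have h4 : σ = Real.exp (a - x') * (1 + σ) := by linarith
        have h5 : 1 + σ ≠ 0 := by intro h0; rw [h0] at h3 h4; linarith
        exact mul_right_cancel₀ h5 (h3.symm.trans h4)
      have := Real.exp_injective this
      linarith
    subst hxx
    have hF : (p.2 x : ℝ) = p'.2 x ∧ p.1 x = p'.1 x ∧ r₁ = r₁' := by
      refine nev_injective ?_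
      filter_upwards [hrel, hrel'] with z h1 h2
      have he : (Real.exp (a - x) : ℂ) ≠ 0 := by exact_mod_cast (Real.exp_pos _).ne'
      generalize (Real.exp (a - x) : ℂ) = e at *
      generalize nev (p.2 x) (p.1 x) r₁ z = F at *
      generalize nev (p'.2 x) (p'.1 x) r₁' z = F' at *
      generalize nev 0 0 r z = G at *
      -- If the second factor vanished, the step relation would give `G = 0` and then `e = 0`.
      have h3 : (F - F') * (e + (1 - e) * z * G) = 0 := by linear_combination h1 - h2
      rcases mul_eq_zero.1 h3 with h3 | h3
      · exact sub_eq_zero.1 h3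
      · exfalso
        have h4 : G = 0 := by linear_combination F * h3 - h1
        rw [h4, mul_zero, add_zero] at h3
        exact he h3
    obtain ⟨hF1, hF2, rfl⟩ := hF
    intro y hy
    rcases lt_trichotomy y x with hyx | rfl | hyx
    · have key : ∀ q : DiscretePair, IsNext q a x → q.1 y = 0 ∧ q.2 y = 0 := fun q hq =>
        notMem_massPoints.1 fun hm => absurd (hq.le y hm hy) (not_le.2 hyx)
      rw [(key p hx).1, (key p hx).2, (key p' hx').1, (key p' hx').2]
      exact ⟨rfl, rfl⟩
    · exact ⟨hF2, by exact_mod_cast hF1⟩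
    · exact ih h₁ h₁' y hyx

/-! ### Solutions as sums of Green functions -/

/-- The Green function `exp (-|x - y| / 2)` of `-∂² + 1/4`. -/
noncomputable def green (x y : ℝ) : ℝ := Real.exp (-|x - y| / 2)

/-- The derivative of `green` with respect to the second variable. -/
noncomputable def greenDeriv (x y : ℝ) : ℝ := Real.sign (x - y) / 2 * Real.exp (-|x - y| / 2)

theorem green_of_le {x y : ℝ} (h : x ≤ y) : green x y = Real.exp ((x - y) / 2) := by
  rw [green, abs_of_nonpos (by linarith)]; ring_nf

theorem green_of_ge {x y : ℝ} (h : y ≤ x) : green x y = Real.exp ((y - x) / 2) := by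
  rw [green, abs_of_nonneg (by linarith)]; ring_nf

theorem greenDeriv_of_lt {x y : ℝ} (h : x < y) :
    greenDeriv x y = -(1 / 2) * Real.exp ((x - y) / 2) := by
  rw [greenDeriv, abs_of_nonpos (by linarith), Real.sign_of_neg (by linarith)]; ring_nf

theorem greenDeriv_of_gt {x y : ℝ} (h : y < x) :
    greenDeriv x y = 1 / 2 * Real.exp ((y - x) / 2) := by
  rw [greenDeriv, abs_of_nonneg (by linarith), Real.sign_of_pos (by linarith)]; ring_nf

theorem continuous_green (x : ℝ) : Continuous (green x) := by
  unfold green; fun_prop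

theorem hasDerivAt_exp_sub_left (x y : ℝ) :
    HasDerivAt (fun y => Real.exp ((x - y) / 2)) (-(1 / 2) * Real.exp ((x - y) / 2)) y := by
  have := (((hasDerivAt_id y).const_sub x).div_const 2).exp
  exact this.congr_deriv (by simp; ring)

theorem hasDerivAt_exp_sub_right (x y : ℝ) :
    HasDerivAt (fun y => Real.exp ((y - x) / 2)) (1 / 2 * Real.exp ((y - x) / 2)) y := by
  have := (((hasDerivAt_id y).sub_const x).div_const 2).exp
  exact this.congr_deriv (by simp; ring)

theorem hasDerivAt_green {x y : ℝ} (h : y ≠ x) : HasDerivAt (green x) (greenDeriv x y) y := by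
  rcases lt_or_gt_of_ne h with h | h
  · rw [greenDeriv_of_gt h]
    refine (hasDerivAt_exp_sub_right x y).congr_of_eventuallyEq ?_
    filter_upwards [Iio_mem_nhds h] with t ht using green_of_ge (le_of_lt ht)
  · rw [greenDeriv_of_lt h]
    refine (hasDerivAt_exp_sub_left x y).congr_of_eventuallyEq ?_
    filter_upwards [Ioi_mem_nhds h] with t ht using green_of_le (le_of_lt ht)

theorem hasDerivAt_greenDeriv {x y : ℝ} (h : y ≠ x) :
    HasDerivAt (greenDeriv x) (green x y / 4) y := by
  rcases lt_or_gt_of_ne h with h | h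
  · rw [green_of_ge h.le]
    refine (((hasDerivAt_exp_sub_right x y).const_mul (1 / 2)).congr_deriv
      (by ring)).congr_of_eventuallyEq ?_
    filter_upwards [Iio_mem_nhds h] with t ht using greenDeriv_of_gt ht
  · rw [green_of_le (le_of_lt h)]
    refine (((hasDerivAt_exp_sub_left x y).const_mul (-(1 / 2))).congr_deriv
      (by ring)).congr_of_eventuallyEq ?_
    filter_upwards [Ioi_mem_nhds h] with t ht using greenDeriv_of_lt ht

theorem tendsto_greenDeriv_left (x y : ℝ) :
    Tendsto (greenDeriv x) (𝓝[<] y) (𝓝 (greenDeriv x y + if x = y then 1 / 2 else 0)) := by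
  split_ifs with h
  · subst h
    have h0 : greenDeriv x x = 0 := by simp [greenDeriv]
    have h1 := ((hasDerivAt_exp_sub_right x x).continuousAt.const_mul (1 / 2)).tendsto.mono_left
      (nhdsWithin_le_nhds (s := Set.Iio x))
    simp only [sub_self, zero_div, Real.exp_zero, mul_one] at h1
    rw [h0, zero_add]
    refine h1.congr' ?_
    filter_upwards [eventually_mem_nhdsWithin] with t ht using (greenDeriv_of_gt ht).symm
  · rw [add_zero]
    exact (hasDerivAt_greenDeriv (Ne.symm h)).continuousAt.tendsto.mono_left nhdsWithin_le_nhds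

theorem tendsto_greenDeriv_right (x y : ℝ) :
    Tendsto (greenDeriv x) (𝓝[>] y) (𝓝 (greenDeriv x y + if x = y then -(1 / 2) else 0)) := by
  split_ifs with h
  · subst h
    have h0 : greenDeriv x x = 0 := by simp [greenDeriv]
    have h1 := ((hasDerivAt_exp_sub_left x x).continuousAt.const_mul (-(1 / 2))).tendsto.mono_left
      (nhdsWithin_le_nhds (s := Set.Ioi x))
    simp only [sub_self, zero_div, Real.exp_zero, mul_one] at h1
    rw [h0, zero_add]
    refine h1.congr' ?_
    filter_upwards [eventually_mem_nhdsWithin] with t ht using (greenDeriv_of_lt ht).symm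
  · rw [add_zero]
    exact (hasDerivAt_greenDeriv (Ne.symm h)).continuousAt.tendsto.mono_left nhdsWithin_le_nhds

/-- `A exp (-y / 2) + B exp (y / 2) + ∑ c(x) exp (-|x - y| / 2)`. -/
noncomputable def greenSum (S : Finset ℝ) (c : ℝ → ℂ) (A B : ℂ) (y : ℝ) : ℂ :=
  A * Real.exp (-y / 2) + B * Real.exp (y / 2) + ∑ x ∈ S, c x * green x y

/-- The derivative of `greenSum`. -/
noncomputable def greenSumDeriv (S : Finset ℝ) (c : ℝ → ℂ) (A B : ℂ) (y : ℝ) : ℂ :=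
  A * (-(1 / 2) * Real.exp (-y / 2) : ℝ) + B * (1 / 2 * Real.exp (y / 2) : ℝ) +
    ∑ x ∈ S, c x * greenDeriv x y

theorem hasDerivAt_exp_neg_half (y : ℝ) :
    HasDerivAt (fun y => Real.exp (-y / 2)) (-(1 / 2) * Real.exp (-y / 2)) y := by
  simpa using hasDerivAt_exp_sub_left 0 y

theorem hasDerivAt_exp_half (y : ℝ) :
    HasDerivAt (fun y => Real.exp (y / 2)) (1 / 2 * Real.exp (y / 2)) y := by
  simpa using hasDerivAt_exp_sub_right 0 y

section GreenSum

variable {S : Finset ℝ} {c : ℝ → ℂ} {A B : ℂ} {y : ℝ}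

theorem hasDerivAt_greenSum (hy : y ∉ S) :
    HasDerivAt (greenSum S c A B) (greenSumDeriv S c A B y) y := by
  refine (((hasDerivAt_exp_neg_half y).ofReal_comp.const_mul A).add
    ((hasDerivAt_exp_half y).ofReal_comp.const_mul B)).add (HasDerivAt.fun_sum fun x hx => ?_)
  exact (hasDerivAt_green fun h : y = x => hy (h ▸ hx)).ofReal_comp.const_mul (c x)

theorem hasDerivAt_greenSumDeriv (hy : y ∉ S) :
    HasDerivAt (greenSumDeriv S c A B) (greenSum S c A B y / 4) y := by
  have h := ((((hasDerivAt_exp_neg_half y).const_mul (-(1 / 2))).ofReal_comp.const_mul A).add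
    (((hasDerivAt_exp_half y).const_mul (1 / 2)).ofReal_comp.const_mul B)).add
    (HasDerivAt.fun_sum (u := S) fun x hx =>
      (hasDerivAt_greenDeriv fun h : y = x => hy (h ▸ hx)).ofReal_comp.const_mul (c x))
  refine h.congr_deriv ?_
  simp only [greenSum, add_div, Finset.sum_div]
  push_cast
  congr 1
  · ring
  · exact Finset.sum_congr rfl fun x _ => by ring

theorem continuous_greenSum : Continuous (greenSum S c A B) := by
  have := fun x => continuous_green x
  unfold greenSum
  fun_prop

theorem tendsto_greenSumDeriv {l : Filter ℝ} {s : ℝ} (hl : l ≤ 𝓝 y)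
    (h : ∀ x, Tendsto (greenDeriv x) l (𝓝 (greenDeriv x y + if x = y then s else 0))) (hy : y ∈ S) :
    Tendsto (greenSumDeriv S c A B) l (𝓝 (greenSumDeriv S c A B y + c y * s)) := by
  have h1 : Tendsto (fun y => ∑ x ∈ S, c x * (greenDeriv x y : ℂ)) l
      (𝓝 (∑ x ∈ S, c x * ((greenDeriv x y + if x = y then s else 0 : ℝ) : ℂ))) :=
    tendsto_finsetSum _ fun x _ => ((Complex.continuous_ofReal.tendsto _).comp (h x)).const_mul _
  have h2 : ∑ x ∈ S, c x * ((greenDeriv x y + if x = y then s else 0 : ℝ) : ℂ) =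
      ∑ x ∈ S, c x * (greenDeriv x y : ℂ) + c y * s := by
    have : ∀ x, ((greenDeriv x y + if x = y then s else 0 : ℝ) : ℂ) =
        greenDeriv x y + if x = y then (s : ℂ) else 0 := fun x => by split_ifs <;> simp
    simp only [this, mul_add, Finset.sum_add_distrib, mul_ite, mul_zero, Finset.sum_ite_eq', hy,
      if_true]
  have h3 : Continuous fun y : ℝ => A * (-(1 / 2) * Real.exp (-y / 2) : ℝ) +
      B * (1 / 2 * Real.exp (y / 2) : ℝ) := by fun_prop
  rw [h2] at h1
  have := (h3.tendsto y |>.mono_left hl).add h1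
  rw [← add_assoc] at this
  exact this

theorem eventually_nhds_notMem {S : Finset ℝ} {y : ℝ} (hy : y ∉ S) : ∀ᶠ t in 𝓝 y, t ∉ S :=
  S.finite_toSet.isClosed.isOpen_compl.mem_nhds hy

theorem eventually_nhdsNE_notMem (S : Finset ℝ) (y : ℝ) : ∀ᶠ t in 𝓝[≠] y, t ∉ S := by
  have := eventually_nhds_notMem (S := S.erase y) (y := y) (Finset.notMem_erase y S)
  filter_upwards [eventually_nhdsWithin_of_eventually_nhds this, eventually_mem_nhdsWithin]
    with t h1 h2 h3
  exact h1 (Finset.mem_erase.2 ⟨h2, h3⟩)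

end GreenSum

/-- The derivative of `exp (-|x - y|/2)` falls by `1` as `y` crosses `x`, so the coefficient
`potential p z x * f x` produces exactly the required jump. -/
theorem isSolution_of_eq_greenSum {p : DiscretePair} {z : ℂ} {f : ℝ → ℂ} {A B : ℂ}
    (h : f = greenSum (massPoints p) (fun x => potential p z x * f x) A B) : IsSolution p z f := by
  set c : ℝ → ℂ := fun x => potential p z x * f x with hc
  have hd : ∀ y ∉ massPoints p, HasDerivAt f (greenSumDeriv (massPoints p) c A B y) y :=
    fun y hy => h ▸ hasDerivAt_greenSum hy
  refine ⟨h ▸ continuous_greenSum, fun y hy => (hd y hy).differentiableAt, fun y hy => ?_,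
    fun y hy => ?_⟩
  · have : deriv f =ᶠ[𝓝 y] greenSumDeriv (massPoints p) c A B := by
      filter_upwards [eventually_nhds_notMem hy] with t ht using (hd t ht).deriv
    have h1 := (hasDerivAt_greenSumDeriv (c := c) (A := A) (B := B) hy).congr_of_eventuallyEq this
    rwa [← h] at h1
  · have hev : deriv f =ᶠ[𝓝[≠] y] greenSumDeriv (massPoints p) c A B := by
      filter_upwards [eventually_nhdsNE_notMem (massPoints p) y] with t ht using (hd t ht).deriv
    refine ⟨_, _, (tendsto_greenSumDeriv nhdsWithin_le_nhds
      (fun x => tendsto_greenDeriv_left x y) hy).congr' (hev.filter_mono ?_).symm,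
      (tendsto_greenSumDeriv nhdsWithin_le_nhds
      (fun x => tendsto_greenDeriv_right x y) hy).congr' (hev.filter_mono ?_).symm, ?_⟩
    · exact nhdsWithin_mono _ fun t ht => ne_of_lt ht
    · exact nhdsWithin_mono _ fun t ht => ne_of_gt ht
    · simp only [hc, potential]
      push_cast
      ring

/-- Removes exceptional points after the jumps have cancelled. -/
theorem hasDerivAt_of_tendsto_deriv {f : ℝ → ℂ} {x : ℝ} {e : ℂ} (hc : ContinuousAt f x)
    (hd : ∀ᶠ y in 𝓝[≠] x, DifferentiableAt ℝ f y) (hl : Tendsto (deriv f) (𝓝[≠] x) (𝓝 e)) :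
    HasDerivAt f e x := by
  have h1 : HasDerivWithinAt f e (Set.Ici x) x := by
    have hgt : 𝓝[>] x ≤ 𝓝[≠] x := nhdsWithin_mono _ fun t ht => ne_of_gt ht
    refine hasDerivWithinAt_Ici_of_tendsto_deriv
      (s := {y | DifferentiableAt ℝ f y} ∩ Set.Ioi x) (fun y hy => hy.1.differentiableWithinAt)
      hc.continuousWithinAt (inter_mem (hgt hd) self_mem_nhdsWithin) (hl.mono_left hgt)
  have h2 : HasDerivWithinAt f e (Set.Iic x) x := by
    have hlt : 𝓝[<] x ≤ 𝓝[≠] x := nhdsWithin_mono _ fun t ht => ne_of_lt ht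
    refine hasDerivWithinAt_Iic_of_tendsto_deriv
      (s := {y | DifferentiableAt ℝ f y} ∩ Set.Iio x) (fun y hy => hy.1.differentiableWithinAt)
      hc.continuousWithinAt (inter_mem (hlt hd) self_mem_nhdsWithin) (hl.mono_left hlt)
  simpa using h2.union h1

theorem exists_eq_exp_of_hasDerivAt {F G : ℝ → ℂ} (h1 : ∀ y, HasDerivAt F (G y) y)
    (h2 : ∀ y, HasDerivAt G (F y / 4) y) :
    ∃ A B : ℂ, ∀ y, F y = A * Real.exp (-y / 2) + B * Real.exp (y / 2) := by
  have hu : ∀ y, HasDerivAt (fun y => (G y + F y / 2) * (Real.exp (-y / 2) : ℂ)) 0 y := fun y => by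
    refine (((h2 y).add ((h1 y).div_const 2)).mul
      (hasDerivAt_exp_neg_half y).ofReal_comp).congr_deriv ?_
    simp only [Pi.add_apply]
    push_cast; ring
  have hw : ∀ y, HasDerivAt (fun y => (F y / 2 - G y) * (Real.exp (y / 2) : ℂ)) 0 y := fun y => by
    refine ((((h1 y).div_const 2).sub (h2 y)).mul
      (hasDerivAt_exp_half y).ofReal_comp).congr_deriv ?_
    simp only [Pi.sub_apply]
    push_cast; ring
  have hu' := fun y => is_const_of_deriv_eq_zero (fun y => (hu y).differentiableAt)
    (fun y => (hu y).deriv) y 0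
  have hw' := fun y => is_const_of_deriv_eq_zero (fun y => (hw y).differentiableAt)
    (fun y => (hw y).deriv) y 0
  refine ⟨(F 0 / 2 - G 0) * (Real.exp (0 / 2) : ℂ), (G 0 + F 0 / 2) * (Real.exp (-0 / 2) : ℂ),
    fun y => ?_⟩
  have h3 : (Real.exp (-y / 2) : ℂ) * Real.exp (y / 2) = 1 := by rw [exp_half_mul]; simp
  have hu := hu' y
  have hw := hw' y
  rw [← hu, ← hw]
  linear_combination (-F y) * h3

/-- Subtracting the Green sum cancels every jump. The difference then extends to a twice
differentiable solution of the free equation on the whole line, a combination of the two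
exponentials. -/
theorem IsSolution.eq_greenSum {p : DiscretePair} {z : ℂ} {f : ℝ → ℂ} (h : IsSolution p z f) :
    ∃ A B : ℂ, f = greenSum (massPoints p) (fun x => potential p z x * f x) A B := by
  set c : ℝ → ℂ := fun x => potential p z x * f x with hc
  set S := massPoints p with hS
  set F : ℝ → ℂ := fun y => f y - greenSum S c 0 0 y with hF
  have hFc : Continuous F := h.continuous.sub continuous_greenSum
  have hd : ∀ y ∉ S, HasDerivAt F (deriv f y - greenSumDeriv S c 0 0 y) y := fun y hy =>
    (h.differentiableAt y hy).hasDerivAt.sub (hasDerivAt_greenSum hy)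
  have hd2 : ∀ y ∉ S, HasDerivAt (deriv F) (F y / 4) y := fun y hy => by
    have : deriv F =ᶠ[𝓝 y] fun y => deriv f y - greenSumDeriv S c 0 0 y := by
      filter_upwards [eventually_nhds_notMem hy] with t ht using (hd t ht).deriv
    refine (((h.ode y hy).sub (hasDerivAt_greenSumDeriv hy)).congr_deriv ?_).congr_of_eventuallyEq
      this
    simp only [hF]; ring
  have hlim : ∀ y ∈ S, ∃ e, Tendsto (deriv F) (𝓝[≠] y) (𝓝 e) := fun y hy => by
    obtain ⟨l, r, hl, hr, hj⟩ := h.jump y hy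
    have hev : deriv F =ᶠ[𝓝[≠] y] fun y => deriv f y - greenSumDeriv S c 0 0 y := by
      filter_upwards [eventually_nhdsNE_notMem S y] with t ht using (hd t ht).deriv
    have h1 := hl.sub (tendsto_greenSumDeriv (c := c) (A := 0) (B := 0) nhdsWithin_le_nhds
      (fun x => tendsto_greenDeriv_left x y) hy)
    have h2 := hr.sub (tendsto_greenSumDeriv (c := c) (A := 0) (B := 0) nhdsWithin_le_nhds
      (fun x => tendsto_greenDeriv_right x y) hy)
    refine ⟨l - (greenSumDeriv S c 0 0 y + c y * (1 / 2 : ℝ)), ?_⟩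
    have he : r - (greenSumDeriv S c 0 0 y + c y * (-(1 / 2) : ℝ)) =
        l - (greenSumDeriv S c 0 0 y + c y * (1 / 2 : ℝ)) := by
      rw [hj]; simp only [hc, potential]; push_cast; ring
    rw [he] at h2
    refine Tendsto.congr' hev.symm ?_
    rw [← Set.Iio_union_Ioi, nhdsWithin_union]
    exact h1.sup h2
  have hF1 : ∀ y, HasDerivAt F (deriv F y) y := fun y => by
    by_cases hy : y ∈ S
    · obtain ⟨e, he⟩ := hlim y hy
      refine (hasDerivAt_of_tendsto_deriv hFc.continuousAt ?_ he).differentiableAt.hasDerivAt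
      filter_upwards [eventually_nhdsNE_notMem S y] with t ht using (hd t ht).differentiableAt
    · exact (hd y hy).differentiableAt.hasDerivAt
  have hF2 : ∀ y, HasDerivAt (deriv F) (F y / 4) y := fun y => by
    by_cases hy : y ∈ S
    · obtain ⟨e, he⟩ := hlim y hy
      have hdF : HasDerivAt F e y := by
        refine hasDerivAt_of_tendsto_deriv hFc.continuousAt ?_ he
        filter_upwards [eventually_nhdsNE_notMem S y] with t ht using (hd t ht).differentiableAt
      refine hasDerivAt_of_tendsto_deriv ?_ ?_ ?_
      · rw [continuousAt_iff_punctured_nhds, hdF.deriv]; exact he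
      · filter_upwards [eventually_nhdsNE_notMem S y] with t ht using (hd2 t ht).differentiableAt
      · refine Tendsto.congr' (f₁ := fun t => F t / 4) ?_
          ((hFc.div_const 4).continuousAt.tendsto.mono_left nhdsWithin_le_nhds)
        filter_upwards [eventually_nhdsNE_notMem S y] with t ht using (hd2 t ht).deriv.symm
    · exact hd2 y hy
  obtain ⟨A, B, hAB⟩ := exists_eq_exp_of_hasDerivAt hF1 hF2
  refine ⟨A, B, funext fun y => ?_⟩
  have := hAB y
  simp only [hF, greenSum] at this ⊢
  linear_combination this

theorem phiPlus_eq_sub_sum (p : DiscretePair) (z : ℂ) (y : ℝ) :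
    phiPlus p z y = Real.exp (-y / 2) - ∑ x ∈ rightPoints p y, potential p z x * phiPlus p z x *
      (Real.exp ((x - y) / 2) - Real.exp ((y - x) / 2)) := by
  have h1 : (Real.exp (-y / 2) : ℂ) * Real.exp y = Real.exp (y / 2) := by
    rw [← Complex.ofReal_mul, ← Real.exp_add]; ring_nf
  have h2 : ∀ x : ℝ, (Real.exp ((x - y) / 2) : ℂ) = Real.exp (-y / 2) * Real.exp (x / 2) :=
    fun x => (exp_half_mul y x).symm
  have h3 : ∀ x : ℝ, (Real.exp ((y - x) / 2) : ℂ) = Real.exp (y / 2) * Real.exp (-x / 2) :=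
    fun x => by rw [mul_comm, exp_half_mul]
  have h4 : ∑ x ∈ rightPoints p y, potential p z x * phiPlus p z x *
      ((Real.exp ((x - y) / 2) : ℂ) - Real.exp ((y - x) / 2)) =
      Real.exp (-y / 2) * (1 - (coef p z y).1) - Real.exp (y / 2) * (coef p z y).2 := by
    rw [coef_fst, coef_snd, sub_sub_cancel, Finset.mul_sum, Finset.mul_sum,
      ← Finset.sum_sub_distrib]
    exact Finset.sum_congr rfl fun x _ => by rw [h2, h3]; ring
  rw [h4, phiPlus, rightValue]
  linear_combination (coef p z y).2 * h1

/-- The equation is triangular: the value at `y` involves only masses strictly to its right, so the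
constant `C` determines `f`. -/
theorem eq_mul_phiPlus {p : DiscretePair} {z C : ℂ} {f : ℝ → ℂ}
    (h : ∀ y, f y = C * Real.exp (-y / 2) - ∑ x ∈ rightPoints p y, potential p z x * f x *
      (Real.exp ((x - y) / 2) - Real.exp ((y - x) / 2))) (y : ℝ) : f y = C * phiPlus p z y := by
  induction hn : (rightPoints p y).card using Nat.strong_induction_on generalizing y with
  | _ n ih =>
  rw [h y, phiPlus_eq_sub_sum, mul_sub, Finset.mul_sum]
  congr 1
  refine Finset.sum_congr rfl fun x hx => ?_
  have hlt : (rightPoints p x).card < n := by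
    rw [← hn]
    refine Finset.card_lt_card (Finset.ssubset_iff_of_subset (fun t ht => ?_) |>.2
      ⟨x, hx, self_notMem_rightPoints p x⟩)
    obtain ⟨h1, h2⟩ := mem_rightPoints.1 ht
    exact mem_rightPoints.2 ⟨h1, (mem_rightPoints.1 hx).2.trans h2⟩
  rw [ih _ hlt x rfl]
  ring

theorem sum_green_eq (p : DiscretePair) (c : ℝ → ℂ) (y : ℝ) :
    ∑ x ∈ massPoints p, c x * green x y =
      (∑ x ∈ massPoints p, c x * Real.exp (x / 2)) * Real.exp (-y / 2) -
        ∑ x ∈ rightPoints p y, c x * (Real.exp ((x - y) / 2) - Real.exp ((y - x) / 2)) := by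
  rw [rightPoints, Finset.sum_filter, Finset.sum_mul, ← Finset.sum_sub_distrib]
  refine Finset.sum_congr rfl fun x _ => ?_
  rw [mul_assoc, mul_comm (Real.exp (x / 2) : ℂ), exp_half_mul]
  split_ifs with h
  · rw [green_of_ge h.le]; ring
  · rw [green_of_le (not_lt.1 h)]; ring

theorem eq_mul_phiPlus_of_greenSum {p : DiscretePair} {z A : ℂ} {f : ℝ → ℂ}
    (h : f = greenSum (massPoints p) (fun x => potential p z x * f x) A 0) (y : ℝ) :
    f y = (A + ∑ x ∈ massPoints p, potential p z x * f x * Real.exp (x / 2)) * phiPlus p z y := by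
  refine eq_mul_phiPlus (fun y => ?_) y
  have := congrFun h y
  rw [greenSum, sum_green_eq] at this
  linear_combination this

theorem phiPlus_eq_greenSum (p : DiscretePair) (z : ℂ) :
    phiPlus p z = greenSum (massPoints p) (fun x => potential p z x * phiPlus p z x)
      (1 - ∑ x ∈ massPoints p, potential p z x * phiPlus p z x * Real.exp (x / 2)) 0 := by
  funext y
  rw [greenSum, sum_green_eq]
  conv_lhs => rw [phiPlus_eq_sub_sum]
  ring

theorem eventually_rightPoints_eq_empty (p : DiscretePair) :
    ∀ᶠ y in atTop, rightPoints p y = ∅ := by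
  have : ∀ᶠ y in atTop, ∀ x ∈ massPoints p, x ≤ y := by
    rw [Filter.eventually_all_finset]
    exact fun x _ => eventually_ge_atTop x
  filter_upwards [this] with y hy
  rw [Finset.eq_empty_iff_forall_notMem]
  intro x hx
  obtain ⟨h1, h2⟩ := mem_rightPoints.1 hx
  exact absurd h2 (not_lt.2 (hy x h1))

theorem eventually_phiPlus (p : DiscretePair) (z : ℂ) :
    ∀ᶠ y : ℝ in atTop, phiPlus p z y = Real.exp (-y / 2) := by
  filter_upwards [eventually_rightPoints_eq_empty p] with y hy
  rw [phiPlus, rightValue_of_eq_empty hy, mul_one]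

theorem isPhiPlus_phiPlus (p : DiscretePair) (z : ℂ) : IsPhiPlus p z (phiPlus p z) :=
  ⟨isSolution_of_eq_greenSum (phiPlus_eq_greenSum p z), eventually_phiPlus p z⟩

theorem eq_zero_of_eventually_exp {A B : ℂ}
    (h : ∀ᶠ y : ℝ in atTop, A * Real.exp (-y / 2) + B * Real.exp (y / 2) = 0) : A = 0 ∧ B = 0 := by
  have h' : ∀ᶠ y : ℝ in atTop, A + B * Real.exp y = 0 := by
    filter_upwards [h] with y hy
    have h1 : (Real.exp (y / 2) : ℂ) * Real.exp (-y / 2) = 1 := by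
      rw [mul_comm, exp_half_mul]; simp
    have h2 : (Real.exp (y / 2) : ℂ) * Real.exp (y / 2) = Real.exp y := by
      rw [← Complex.ofReal_mul, ← Real.exp_add]; ring_nf
    linear_combination (Real.exp (y / 2) : ℂ) * hy - A * h1 - B * h2
  obtain ⟨y₀, hy₀⟩ := Filter.eventually_atTop.1 h'
  have h1 := hy₀ y₀ le_rfl
  have h2 := hy₀ (y₀ + 1) (by linarith)
  have hne : (Real.exp (y₀ + 1) : ℂ) - Real.exp y₀ ≠ 0 := by
    rw [sub_ne_zero]
    intro h3
    have := Real.exp_injective (Complex.ofReal_injective h3)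
    linarith
  have hB : B = 0 := by
    have : B * ((Real.exp (y₀ + 1) : ℂ) - Real.exp y₀) = 0 := by linear_combination h2 - h1
    exact (mul_eq_zero.1 this).resolve_right hne
  exact ⟨by simpa [hB] using h1, hB⟩

theorem greenSum_of_rightPoints_eq_empty {p : DiscretePair} {y : ℝ} (h : rightPoints p y = ∅)
    (c : ℝ → ℂ) (A B : ℂ) : greenSum (massPoints p) c A B y =
      (A + ∑ x ∈ massPoints p, c x * Real.exp (x / 2)) * Real.exp (-y / 2) +
        B * Real.exp (y / 2) := by
  rw [greenSum, sum_green_eq, h, Finset.sum_empty]; ring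

/-- Makes the existential choice of `f` in `IsNormalizedEigenfunctionValue` harmless. -/
theorem IsPhiPlus.eq {p : DiscretePair} {z : ℂ} {f : ℝ → ℂ} (h : IsPhiPlus p z f) :
    f = phiPlus p z := by
  obtain ⟨A, B, hf⟩ := h.1.eq_greenSum
  have := eq_zero_of_eventually_exp
    (A := A + ∑ x ∈ massPoints p, potential p z x * f x * Real.exp (x / 2) - 1) (B := B) (by
      filter_upwards [h.2, eventually_rightPoints_eq_empty p] with y h1 h2
      have h3 := congrFun hf y
      rw [greenSum_of_rightPoints_eq_empty h2, h1] at h3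
      linear_combination -h3)
  obtain ⟨h1, rfl⟩ := this
  funext y
  rw [eq_mul_phiPlus_of_greenSum hf y, sub_eq_zero.1 h1, one_mul]

theorem green_nonneg (x y : ℝ) : 0 ≤ green x y := (Real.exp_pos _).le

theorem green_le_one (x y : ℝ) : green x y ≤ 1 :=
  Real.exp_le_one_iff.2 (by have := abs_nonneg (x - y); linarith)

theorem norm_sum_green_le (S : Finset ℝ) (c : ℝ → ℂ) (y : ℝ) :
    ‖∑ x ∈ S, c x * green x y‖ ≤ ∑ x ∈ S, ‖c x‖ := by
  refine (norm_sum_le _ _).trans (Finset.sum_le_sum fun x _ => ?_)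
  rw [norm_mul, Complex.norm_real, Real.norm_of_nonneg (green_nonneg x y)]
  exact mul_le_of_le_one_right (norm_nonneg _) (green_le_one x y)

theorem eq_zero_of_bounded_exp {A B : ℂ} {C : ℝ}
    (h : ∀ y : ℝ, ‖A * Real.exp (-y / 2) + B * Real.exp (y / 2)‖ ≤ C) : A = 0 ∧ B = 0 := by
  have key : ∀ {A B : ℂ}, (∀ y : ℝ, ‖A * Real.exp (-y / 2) + B * Real.exp (y / 2)‖ ≤ C) →
      B = 0 := by
    intro A B h
    have h1 : Tendsto (fun y : ℝ => C * Real.exp (-y / 2) + ‖A‖ * Real.exp (-y)) atTop (𝓝 0) := by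
      have e1 : Tendsto (fun y : ℝ => Real.exp (-y)) atTop (𝓝 0) := Real.tendsto_exp_neg_atTop_nhds_zero
      have e2 : Tendsto (fun y : ℝ => Real.exp (-y / 2)) atTop (𝓝 0) := by
        have := e1.comp (tendsto_id.atTop_div_const (show (0 : ℝ) < 2 by norm_num))
        refine this.congr fun y => ?_
        simp [neg_div]
      simpa using (e2.const_mul C).add (e1.const_mul ‖A‖)
    have h2 : ∀ y : ℝ, ‖B‖ ≤ C * Real.exp (-y / 2) + ‖A‖ * Real.exp (-y) := fun y => by
      have e1 : (Real.exp (y / 2) : ℂ) * Real.exp (-y / 2) = 1 := by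
        rw [mul_comm, exp_half_mul]; simp
      have e2 : (Real.exp (-y / 2) : ℂ) * Real.exp (-y / 2) = Real.exp (-y) := by
        rw [← Complex.ofReal_mul, ← Real.exp_add]; ring_nf
      have e3 : B = (A * Real.exp (-y / 2) + B * Real.exp (y / 2)) * (Real.exp (-y / 2) : ℂ) -
          A * (Real.exp (-y) : ℂ) := by linear_combination -A * e2 - B * e1
      have e4 := norm_sub_le ((A * Real.exp (-y / 2) + B * Real.exp (y / 2)) *
        (Real.exp (-y / 2) : ℂ)) (A * (Real.exp (-y) : ℂ))
      rw [← e3, norm_mul, norm_mul, Complex.norm_real, Complex.norm_real,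
        Real.norm_of_nonneg (Real.exp_pos _).le, Real.norm_of_nonneg (Real.exp_pos _).le] at e4
      have := mul_le_mul_of_nonneg_right (h y) (Real.exp_pos (-y / 2)).le
      linarith
    have := ge_of_tendsto' h1 h2
    exact norm_le_zero_iff.1 this
  refine ⟨key (A := B) fun y => ?_, key h⟩
  have := h (-y)
  rw [neg_neg, add_comm] at this
  exact this

/-- The Green sum is always bounded, so a bounded solution has no exponential terms. -/
theorem mem_spectrum_iff_greenSum {p : DiscretePair} {z : ℂ} : z ∈ spectrum p ↔
    ∃ f : ℝ → ℂ, f ≠ 0 ∧ f = greenSum (massPoints p) (fun x => potential p z x * f x) 0 0 := by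
  constructor
  · rintro ⟨f, hs, hne, C, hC⟩
    obtain ⟨A, B, hf⟩ := hs.eq_greenSum
    have := eq_zero_of_bounded_exp (A := A) (B := B)
      (C := C + ∑ x ∈ massPoints p, ‖potential p z x * f x‖) fun y => by
        have h1 := congrFun hf y
        have h2 : A * Real.exp (-y / 2) + B * Real.exp (y / 2) =
            f y - ∑ x ∈ massPoints p, potential p z x * f x * green x y := by
          rw [greenSum] at h1; linear_combination -h1
        rw [h2]
        exact (norm_sub_le _ _).trans (add_le_add (hC y) (norm_sum_green_le _ _ y))
    obtain ⟨rfl, rfl⟩ := this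
    exact ⟨f, hne, hf⟩
  · rintro ⟨f, hne, hf⟩
    refine ⟨f, isSolution_of_eq_greenSum hf, hne, ∑ x ∈ massPoints p, ‖potential p z x * f x‖,
      fun y => ?_⟩
    rw [congrFun hf y, greenSum, zero_mul, zero_mul, zero_add, zero_add]
    exact norm_sum_green_le _ _ y

/-! ### Reflection and matching at the base point -/

/-- The mirror image of a pair. -/
noncomputable def reflect (p : DiscretePair) : DiscretePair :=
  (p.1.equivMapDomain (Equiv.neg ℝ), p.2.equivMapDomain (Equiv.neg ℝ))

@[simp] theorem reflect_fst (p : DiscretePair) (x : ℝ) : (reflect p).1 x = p.1 (-x) := rfl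

@[simp] theorem reflect_snd (p : DiscretePair) (x : ℝ) : (reflect p).2 x = p.2 (-x) := rfl

@[simp] theorem reflect_reflect (p : DiscretePair) : reflect (reflect p) = p := by
  refine Prod.ext (Finsupp.ext fun x => ?_) (Finsupp.ext fun x => ?_) <;> simp

theorem mem_massPoints_reflect {p : DiscretePair} {x : ℝ} :
    x ∈ massPoints (reflect p) ↔ -x ∈ massPoints p := by
  rw [← not_iff_not, notMem_massPoints, notMem_massPoints, reflect_fst, reflect_snd]

theorem potential_reflect (p : DiscretePair) (z : ℂ) (x : ℝ) :
    potential (reflect p) z x = potential p z (-x) := rfl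

theorem sum_massPoints_reflect (p : DiscretePair) (h : ℝ → ℂ) :
    ∑ x ∈ massPoints (reflect p), h x = ∑ x ∈ massPoints p, h (-x) := by
  refine Finset.sum_nbij' (fun x => -x) (fun x => -x) ?_ ?_ ?_ ?_ ?_
  · exact fun x hx => mem_massPoints_reflect.1 hx
  · exact fun x hx => mem_massPoints_reflect.2 (by simpa using hx)
  all_goals simp

theorem sum_massPoints_split (p : DiscretePair) (a : ℝ) {h : ℝ → ℂ}
    (h0 : ∀ x ∉ massPoints p, h x = 0) :
    ∑ x ∈ massPoints p, h x =
      ∑ x ∈ rightPoints p a, h x + h a + ∑ x ∈ rightPoints (reflect p) (-a), h (-x) := by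
  have h1 : ∑ x ∈ rightPoints (reflect p) (-a), h (-x) =
      ∑ x ∈ (massPoints p).filter (· < a), h x := by
    refine Finset.sum_nbij' (fun x => -x) (fun x => -x) ?_ ?_ ?_ ?_ ?_
    · intro x hx
      rw [mem_rightPoints, mem_massPoints_reflect] at hx
      exact Finset.mem_filter.2 ⟨hx.1, by linarith [hx.2]⟩
    · intro x hx
      rw [mem_rightPoints, mem_massPoints_reflect, neg_neg]
      exact ⟨(Finset.mem_filter.1 hx).1, neg_lt_neg (Finset.mem_filter.1 hx).2⟩
    all_goals simp
  have h2 : h a = ∑ x ∈ massPoints p, if x = a then h x else 0 := by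
    rw [Finset.sum_ite_eq']
    split_ifs with ha
    · rfl
    · exact h0 a ha
  rw [h1, rightPoints, Finset.sum_filter, Finset.sum_filter, h2, ← Finset.sum_add_distrib,
    ← Finset.sum_add_distrib]
  refine Finset.sum_congr rfl fun x _ => ?_
  rcases lt_trichotomy x a with hx | rfl | hx
  · simp [hx, hx.ne, hx.le]
  · simp
  · simp [hx, hx.ne', hx.le]

/-- The solution `φ₋(z, ·)`, equal to `exp (x / 2)` near `-∞`. -/
noncomputable def phiMinus (p : DiscretePair) (z : ℂ) (x : ℝ) : ℂ := phiPlus (reflect p) z (-x)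

theorem greenSum_reflect {p : DiscretePair} {z : ℂ} {f : ℝ → ℂ}
    (h : f = greenSum (massPoints p) (fun x => potential p z x * f x) 0 0) :
    (fun y => f (-y)) =
      greenSum (massPoints (reflect p)) (fun x => potential (reflect p) z x * f (-x)) 0 0 := by
  funext y
  conv_lhs => rw [h]
  simp only [greenSum, sum_massPoints_reflect, potential_reflect, neg_neg, zero_mul]
  congr 1
  refine Finset.sum_congr rfl fun x _ => ?_
  have : green x (-y) = green (-x) y := by
    rw [green, green, ← abs_neg (x - -y)]; ring_nf
  rw [this]

theorem sum_potential_phiPlus_split (p : DiscretePair) (z : ℂ) (a : ℝ) {f : ℝ → ℂ} {Cp Cm : ℂ}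
    (hp : ∀ x, a < x → f x = Cp * phiPlus p z x) (hm : ∀ x, x < a → f x = Cm * phiMinus p z x) :
    ∑ x ∈ massPoints p, potential p z x * f x * Real.exp (x / 2) =
      Cp * (1 - (coef p z a).1) + potential p z a * f a * Real.exp (a / 2) +
        Cm * (coef (reflect p) z (-a)).2 := by
  rw [sum_massPoints_split p a (h := fun x => potential p z x * f x * Real.exp (x / 2))
    (fun x hx => by rw [potential_eq_zero hx, zero_mul, zero_mul]), coef_fst, coef_snd,
    sub_sub_cancel, Finset.mul_sum, Finset.mul_sum]
  congr 1
  · congr 1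
    refine Finset.sum_congr rfl fun x hx => ?_
    rw [hp x (mem_rightPoints.1 hx).2]; ring
  · refine Finset.sum_congr rfl fun x hx => ?_
    rw [hm (-x) (by linarith [(mem_rightPoints.1 hx).2]), phiMinus, neg_neg, potential_reflect]
    ring

/-- The matching condition at `a`. -/
structure Matches (p : DiscretePair) (z : ℂ) (a : ℝ) (Cp Cm : ℂ) : Prop where
  value : Cp * phiPlus p z a = Cm * phiMinus p z a
  slope : Cp * phiPlus p z a = potential p z a * (Cp * phiPlus p z a) +
    Cp * Real.exp (-a / 2) * rightSlope p z a +
    Cm * Real.exp (a / 2) * rightSlope (reflect p) z (-a)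

/-- Translates the jump condition at `a` into the statement that the sum of the weights `potential *
f * exp (x/2)` over all masses equals `Cp`, which is what `eq_sum_green_of_sum_eq` consumes. -/
theorem slope_identity (p : DiscretePair) (z : ℂ) (a : ℝ) (Cp Cm : ℂ) :
    Cp * phiPlus p z a = potential p z a * (Cp * phiPlus p z a) +
      Cp * Real.exp (-a / 2) * rightSlope p z a +
      Cm * Real.exp (a / 2) * rightSlope (reflect p) z (-a) ↔
    Cp * (1 - (coef p z a).1) + potential p z a * (Cp * phiPlus p z a) * Real.exp (a / 2) +
        Cm * (coef (reflect p) z (-a)).2 = Cp := by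
  have h1 : (Real.exp (-a / 2) : ℂ) * Real.exp (a / 2) = 1 := by rw [exp_half_mul]; simp
  have h2 : (Real.exp (a / 2) : ℂ) * Real.exp (-a) = Real.exp (-a / 2) := by
    rw [← Complex.ofReal_mul, ← Real.exp_add]; ring_nf
  have hne : (Real.exp (a / 2) : ℂ) ≠ 0 := by exact_mod_cast (Real.exp_pos _).ne'
  rw [← mul_left_inj' hne]
  have e1 : Cp * phiPlus p z a * Real.exp (a / 2) =
      Cp * ((coef p z a).1 + (coef p z a).2 * Real.exp a) := by
    rw [phiPlus, rightValue]
    linear_combination Cp * ((coef p z a).1 + (coef p z a).2 * Real.exp a) * h1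
  have e2 : (potential p z a * (Cp * phiPlus p z a) +
      Cp * Real.exp (-a / 2) * rightSlope p z a +
      Cm * Real.exp (a / 2) * rightSlope (reflect p) z (-a)) * Real.exp (a / 2) =
      potential p z a * (Cp * phiPlus p z a) * Real.exp (a / 2) +
      Cp * ((coef p z a).2 * Real.exp a) + Cm * (coef (reflect p) z (-a)).2 := by
    simp only [rightSlope]
    linear_combination Cp * (coef p z a).2 * Real.exp a * h1 +
      Cm * (coef (reflect p) z (-a)).2 * Real.exp (a / 2) * h2 +
      Cm * (coef (reflect p) z (-a)).2 * h1
  rw [e1, e2]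
  exact ⟨fun h => by linear_combination -h, fun h => by linear_combination -h⟩

theorem exists_matches_of_mem_spectrum {p : DiscretePair} {z : ℂ} (h : z ∈ spectrum p) :
    ∃ Cp Cm : ℂ, Cp ≠ 0 ∧ Cm ≠ 0 ∧ (∀ x, Cp * phiPlus p z x = Cm * phiMinus p z x) ∧
      ∀ a, Matches p z a Cp Cm := by
  obtain ⟨f, hne, hf⟩ := mem_spectrum_iff_greenSum.1 h
  have hp := eq_mul_phiPlus_of_greenSum hf
  have hm' := eq_mul_phiPlus_of_greenSum (p := reflect p) (greenSum_reflect hf)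
  set Cp := 0 + ∑ x ∈ massPoints p, potential p z x * f x * Real.exp (x / 2) with hCp
  set Cm := 0 + ∑ x ∈ massPoints (reflect p), potential (reflect p) z x * f (-x) *
    Real.exp (x / 2) with hCm
  have hm : ∀ y, f y = Cm * phiMinus p z y := fun y => by
    have := hm' (-y)
    rwa [neg_neg] at this
  refine ⟨Cp, Cm, ?_, ?_, fun x => (hp x).symm.trans (hm x), fun a =>
    ⟨(hp a).symm.trans (hm a), ?_⟩⟩
  · intro h0
    exact hne (funext fun y => by rw [hp y, h0, zero_mul]; rfl)
  · intro h0
    exact hne (funext fun y => by rw [hm y, h0, zero_mul]; rfl)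
  · rw [slope_identity, ← hp a, ← sum_potential_phiPlus_split p z a (fun x _ => hp x)
      fun x _ => hm x, hCp, zero_add]

theorem eq_sum_green_of_sum_eq {p : DiscretePair} {z C : ℂ} {a : ℝ} {f : ℝ → ℂ}
    (hp : ∀ x, a ≤ x → f x = C * phiPlus p z x)
    (hC : ∑ x ∈ massPoints p, potential p z x * f x * Real.exp (x / 2) = C) {y : ℝ} (hy : a ≤ y) :
    f y = ∑ x ∈ massPoints p, potential p z x * f x * green x y := by
  rw [sum_green_eq p (fun x => potential p z x * f x), hC, hp y hy, phiPlus_eq_sub_sum, mul_sub,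
    Finset.mul_sum]
  congr 1
  refine Finset.sum_congr rfl fun x hx => ?_
  rw [hp x (hy.trans (mem_rightPoints.1 hx).2.le)]
  ring

theorem Matches.reflect {p : DiscretePair} {z : ℂ} {a : ℝ} {Cp Cm : ℂ} (h : Matches p z a Cp Cm) :
    Matches (reflect p) z (-a) Cm Cp := by
  have hv := h.value
  have hs := h.slope
  refine ⟨?_, ?_⟩
  · simp only [phiMinus, reflect_reflect, neg_neg] at hv ⊢
    exact hv.symm
  · simp only [reflect_reflect, neg_neg, potential_reflect]
    change Cm * phiMinus p z a = potential p z a * (Cm * phiMinus p z a) + _ + _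
    rw [← hv]
    linear_combination hs

/-- Glue the two one-sided solutions at `a`. The Green equation holds on the right by the slope
condition, and on the left by the same argument applied to the mirror image. -/
theorem Matches.mem_spectrum {p : DiscretePair} {z : ℂ} {a : ℝ} {Cp Cm : ℂ}
    (h : Matches p z a Cp Cm) (hne : Cp ≠ 0 ∨ Cm ≠ 0) : z ∈ spectrum p := by
  classical
  set f : ℝ → ℂ := fun x => if a ≤ x then Cp * phiPlus p z x else Cm * phiMinus p z x with hf
  have hp : ∀ x, a ≤ x → f x = Cp * phiPlus p z x := fun x hx => if_pos hx
  have hm : ∀ x, x ≤ a → f x = Cm * phiMinus p z x := fun x hx => by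
    rcases hx.eq_or_lt with rfl | hx
    · rw [hp x le_rfl, h.value]
    · exact if_neg (not_le.2 hx)
  have hsum : ∀ y, f y = ∑ x ∈ massPoints p, potential p z x * f x * green x y := by
    intro y
    rcases le_total a y with hy | hy
    · refine eq_sum_green_of_sum_eq hp ?_ hy
      rw [sum_potential_phiPlus_split p z a (fun x hx => hp x hx.le) fun x hx => hm x hx.le,
        hp a le_rfl]
      exact (slope_identity p z a Cp Cm).1 h.slope
    · have hp' : ∀ x, -a ≤ x → f (-x) = Cm * phiPlus (Multipeakon.reflect p) z x := fun x hx => by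
        rw [hm (-x) (by linarith), phiMinus, neg_neg]
      have hm' : ∀ x, x ≤ -a → f (-x) = Cp * phiMinus (Multipeakon.reflect p) z x := fun x hx => by
        rw [hp (-x) (by linarith), phiMinus, reflect_reflect]
      have := eq_sum_green_of_sum_eq (p := Multipeakon.reflect p) (f := fun x => f (-x)) hp' (by
        rw [sum_potential_phiPlus_split (Multipeakon.reflect p) z (-a) (f := fun x => f (-x))
          (fun x hx => hp' x hx.le) (fun x hx => hm' x hx.le), hp' (-a) le_rfl]
        exact (slope_identity _ z (-a) Cm Cp).1 h.reflect.slope) (y := -y) (by linarith)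
      simp only [neg_neg, sum_massPoints_reflect, potential_reflect] at this
      rw [this]
      refine Finset.sum_congr rfl fun x _ => ?_
      rw [green, green, ← abs_neg (-x - -y)]
      ring_nf
  refine mem_spectrum_iff_greenSum.2 ⟨f, fun h0 => ?_, funext fun y => ?_⟩
  · rcases hne with hne | hne
    · obtain ⟨y, h1, h2⟩ := ((eventually_phiPlus p z).and (eventually_ge_atTop a)).exists
      have h3 := hp y h2
      rw [h0, h1] at h3
      exact mul_ne_zero hne (by exact_mod_cast (Real.exp_pos _).ne') h3.symm
    · obtain ⟨y, h1, h2⟩ := ((eventually_phiPlus (Multipeakon.reflect p) z).and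
        (eventually_ge_atTop (-a))).exists
      have h3 := hm (-y) (by linarith)
      rw [h0, phiMinus, neg_neg, h1] at h3
      exact mul_ne_zero hne (by exact_mod_cast (Real.exp_pos _).ne') h3.symm
  · rw [greenSum, zero_mul, zero_mul, zero_add, zero_add]
    exact hsum y

theorem zero_notMem_spectrum (p : DiscretePair) : (0 : ℂ) ∉ spectrum p := by
  intro h
  obtain ⟨f, hne, hf⟩ := mem_spectrum_iff_greenSum.1 h
  refine hne (funext fun y => ?_)
  rw [hf]
  simp [greenSum, potential]

theorem nevDeriv_add (c c' : ℝ) (r r' : ℝ →₀ ℝ) (x : ℝ) :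
    nevDeriv (c + c') (r + r') x = nevDeriv c r x + nevDeriv c' r' x := by
  unfold nevDeriv
  rw [Finsupp.sum_add_index' (by simp) (by intros; ring)]
  ring

/-! ### Eigenvalues as zeros of a Herglotz–Nevanlinna function -/

/-- The poles and residues of the function whose zeros are the eigenvalues. -/
noncomputable def totalResidues (rp rm : ℝ →₀ ℝ) : ℝ →₀ ℝ := rp + rm + Finsupp.single 0 1

theorem totalResidues_zero {rp rm : ℝ →₀ ℝ} (hp : rp 0 = 0) (hm : rm 0 = 0) :
    totalResidues rp rm 0 = 1 := by simp [totalResidues, hp, hm]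

theorem totalResidues_of_ne {rp rm : ℝ →₀ ℝ} {μ : ℝ} (hμ : μ ≠ 0) :
    totalResidues rp rm μ = rp μ + rm μ := by simp [totalResidues, hμ]

theorem totalResidues_nonneg {rp rm : ℝ →₀ ℝ} (hp : 0 ≤ rp) (hm : 0 ≤ rm) :
    0 ≤ totalResidues rp rm :=
  add_nonneg (add_nonneg hp hm) (Finsupp.single_nonneg.2 zero_le_one)

theorem support_totalResidues {rp rm : ℝ →₀ ℝ} (hp : 0 ≤ rp) (hm : 0 ≤ rm) (hp0 : rp 0 = 0)
    (hm0 : rm 0 = 0) : (totalResidues rp rm).support = insert 0 (rp.support ∪ rm.support) := by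
  ext μ
  by_cases hμ : μ = 0
  · subst hμ
    simp [totalResidues_zero hp0 hm0]
  · have h1 := hp μ
    have h2 := hm μ
    simp only [Finsupp.coe_zero, Pi.zero_apply] at h1 h2
    simp only [Finsupp.mem_support_iff, totalResidues_of_ne hμ, Finset.mem_insert, hμ, false_or,
      Finset.mem_union]
    rw [Ne, add_eq_zero_iff_of_nonneg h1 h2]
    tauto

theorem nev_totalResidues (v ω : ℝ) (rp rm : ℝ →₀ ℝ) (z : ℂ) :
    nev v ω (totalResidues rp rm) z = v * z + ω + nev 0 0 rp z + nev 0 0 rm z - 1 / z := by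
  have h1 := nev_add v 0 ω 0 (rp + rm) (Finsupp.single 0 1) z
  have h2 := nev_add v 0 ω 0 rp rm z
  have h3 := nev_add v 0 ω 0 0 rp z
  simp only [add_zero, zero_add] at h1 h2 h3
  rw [totalResidues, h1, h2, h3, nev_single_zero]
  simp [nev]
  ring

section Eigenvalues

variable {p : DiscretePair} {a : ℝ} {rp rm : ℝ →₀ ℝ}

theorem phiPlus_eq_zero_iff (p : DiscretePair) (z : ℂ) (a : ℝ) :
    phiPlus p z a = 0 ↔ rightValue p z a = 0 := by
  have : (Real.exp (-a / 2) : ℂ) ≠ 0 := by exact_mod_cast (Real.exp_pos _).ne'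
  simp only [phiPlus, mul_eq_zero, this, false_or]

theorem IsRightData.ne_of_phiPlus_ne (h : IsRightData p a rp) {z : ℂ} (hz : phiPlus p z a ≠ 0) :
    ∀ μ ∈ rp.support, z ≠ μ := by
  rintro μ hμ rfl
  exact hz ((phiPlus_eq_zero_iff _ _ _).2 (h.value_eq_zero hμ))

theorem IsRightData.phiPlus_ne (h : IsRightData p a rp) {z : ℂ} (hz : ∀ μ ∈ rp.support, z ≠ μ) :
    phiPlus p z a ≠ 0 := fun h0 => h.value_ne_zero hz ((phiPlus_eq_zero_iff _ _ _).1 h0)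

theorem IsRightData.exp_mul_slope (h : IsRightData p a rp) {z : ℂ} (hz : ∀ μ ∈ rp.support, z ≠ μ) :
    Real.exp (-a / 2) * rightSlope p z a = z * nev 0 0 rp z * phiPlus p z a := by
  rw [h.slope z hz, phiPlus]; ring

/-- Dividing the slope condition by the common value at `a` and by `z` leaves `1/z = v z + ω + m₊ +
m₋`; this is the origin of the unit residue at `0` in `totalResidues`. -/
theorem mem_spectrum_iff_of_ne (hp : IsRightData p a rp) (hm : IsRightData (reflect p) (-a) rm)
    {z : ℂ} (hz0 : z ≠ 0) (hzp : ∀ μ ∈ rp.support, z ≠ μ) (hzm : ∀ μ ∈ rm.support, z ≠ μ) :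
    z ∈ spectrum p ↔ nev (p.2 a) (p.1 a) (totalResidues rp rm) z = 0 := by
  have hP := hp.phiPlus_ne hzp
  have hM : phiMinus p z a ≠ 0 := hm.phiPlus_ne hzm
  have eP := hp.exp_mul_slope hzp
  have eM := hm.exp_mul_slope hzm
  rw [neg_neg] at eM
  change _ = _ * phiMinus p z a at eM
  have key : ∀ {Cp Cm : ℂ}, Cp * phiPlus p z a = Cm * phiMinus p z a →
      (Cp * phiPlus p z a = potential p z a * (Cp * phiPlus p z a) +
        Cp * Real.exp (-a / 2) * rightSlope p z a +
        Cm * Real.exp (a / 2) * rightSlope (reflect p) z (-a) ↔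
      z * nev (p.2 a) (p.1 a) (totalResidues rp rm) z * (Cp * phiPlus p z a) = 0) := by
    intro Cp Cm hv
    rw [mul_assoc Cp, mul_assoc Cm, eP, eM, nev_totalResidues, potential]
    have : z * (1 / z) = 1 := mul_one_div_cancel hz0
    constructor
    · intro h
      linear_combination -h - Cp * phiPlus p z a * this + z * nev 0 0 rm z * hv
    · intro h
      linear_combination -h - Cp * phiPlus p z a * this + z * nev 0 0 rm z * hv
  constructor
  · intro h
    obtain ⟨Cp, Cm, hCp, -, -, hmat⟩ := exists_matches_of_mem_spectrum h
    have := (key (hmat a).value).1 (hmat a).slope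
    have h1 := (mul_eq_zero.1 this).resolve_right (mul_ne_zero hCp hP)
    exact (mul_eq_zero.1 h1).resolve_left hz0
  · intro h
    have hv : (phiPlus p z a)⁻¹ * phiPlus p z a = (phiMinus p z a)⁻¹ * phiMinus p z a := by
      rw [inv_mul_cancel₀ hP, inv_mul_cancel₀ hM]
    exact Matches.mem_spectrum (a := a) ⟨hv, (key hv).2 (by rw [h]; ring)⟩
      (Or.inl (inv_ne_zero hP))

/-- At a common zero of `φ₊` and `φ₋` the value condition is void, and constants balancing the two
slopes, which do not vanish there, give an eigenfunction that is zero at `a`. -/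
theorem mem_spectrum_of_mem_support (hp : IsRightData p a rp)
    (hm : IsRightData (reflect p) (-a) rm) {μ : ℝ} (h1 : μ ∈ rp.support) (h2 : μ ∈ rm.support) :
    (μ : ℂ) ∈ spectrum p := by
  have hP := (phiPlus_eq_zero_iff p μ a).2 (hp.value_eq_zero h1)
  have hM : phiMinus p μ a = 0 := (phiPlus_eq_zero_iff _ _ _).2 (hm.value_eq_zero h2)
  have sP := hp.slope_ne μ (hp.value_eq_zero h1)
  have hexp : (Real.exp (-a / 2) : ℂ) ≠ 0 := by exact_mod_cast (Real.exp_pos _).ne'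
  refine Matches.mem_spectrum (a := a)
    (Cp := Real.exp (a / 2) * rightSlope (reflect p) μ (-a))
    (Cm := -(Real.exp (-a / 2) * rightSlope p μ a)) ⟨?_, ?_⟩ (Or.inr ?_)
  · rw [hP, hM, mul_zero, mul_zero]
  · rw [hP]; ring
  · exact neg_ne_zero.2 (mul_ne_zero hexp sP)

theorem spectrum_ne (hp : IsRightData p a rp) (hm : IsRightData (reflect p) (-a) rm) {z : ℂ}
    (hz : z ∈ spectrum p) (hne : phiPlus p z a ≠ 0) :
    z ≠ 0 ∧ (∀ μ ∈ rp.support, z ≠ μ) ∧ ∀ μ ∈ rm.support, z ≠ μ := by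
  obtain ⟨Cp, Cm, hCp, -, hval, -⟩ := exists_matches_of_mem_spectrum hz
  refine ⟨fun h => zero_notMem_spectrum p (h ▸ hz), hp.ne_of_phiPlus_ne hne,
    hm.ne_of_phiPlus_ne fun h0 => ?_⟩
  have := hval a
  rw [phiMinus, h0, mul_zero] at this
  exact mul_ne_zero hCp hne this

theorem coe_mem_spectrum_iff (hp : IsRightData p a rp) (hm : IsRightData (reflect p) (-a) rm)
    (hdis : Disjoint rp.support rm.support) {c d : ℝ} {r : ℝ →₀ ℝ}
    (hK : IsNegInv (p.2 a) (p.1 a) (totalResidues rp rm) c d r) {z : ℂ} :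
    z ∈ spectrum p ↔ ∃ ν ∈ r.support, z = ν := by
  have hsupp := support_totalResidues hp.nonneg hm.nonneg hp.zero hm.zero
  have hall : ∀ {z : ℂ}, z ≠ 0 → (∀ μ ∈ rp.support, z ≠ μ) → (∀ μ ∈ rm.support, z ≠ μ) →
      ∀ μ ∈ (totalResidues rp rm).support, z ≠ μ := by
    intro z h0 h1 h2 μ hμ
    rw [hsupp, Finset.mem_insert, Finset.mem_union] at hμ
    rcases hμ with rfl | hμ | hμ
    · simpa using h0
    · exact h1 μ hμ
    · exact h2 μ hμ
  constructor
  · intro hz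
    have hne : phiPlus p z a ≠ 0 := by
      intro h0
      obtain ⟨Cp, Cm, -, hCm, hval, -⟩ := exists_matches_of_mem_spectrum hz
      have h1 : phiMinus p z a = 0 := by
        have := hval a
        rw [h0, mul_zero] at this
        exact (mul_eq_zero.1 this.symm).resolve_left hCm
      have e1 : ∃ μ ∈ rp.support, z = μ := by
        by_contra hcon
        push Not at hcon
        exact hp.phiPlus_ne hcon h0
      have e2 : ∃ μ ∈ rm.support, z = μ := by
        by_contra hcon
        push Not at hcon
        exact hm.phiPlus_ne hcon h1
      obtain ⟨μ, hμ, rfl⟩ := e1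
      obtain ⟨μ', hμ', h⟩ := e2
      rw [← Complex.ofReal_inj.1 h] at hμ'
      exact Finset.disjoint_left.1 hdis hμ hμ'
    obtain ⟨h0, h1, h2⟩ := spectrum_ne hp hm hz hne
    exact (hK.eq_zero_iff z (hall h0 h1 h2)).1 ((mem_spectrum_iff_of_ne hp hm h0 h1 h2).1 hz)
  · rintro ⟨ν, hν, rfl⟩
    have hν' : ν ∉ (totalResidues rp rm).support := Finset.disjoint_right.1 hK.disjoint hν
    rw [hsupp, Finset.mem_insert, Finset.mem_union] at hν'
    push Not at hν'
    have h0 : (ν : ℂ) ≠ 0 := by exact_mod_cast hν'.1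
    have h1 := coe_ne_of_notMem hν'.2.1
    have h2 := coe_ne_of_notMem hν'.2.2
    exact (mem_spectrum_iff_of_ne hp hm h0 h1 h2).2
      ((hK.eq_zero_iff _ (hall h0 h1 h2)).2 ⟨ν, hν, rfl⟩)

end Eigenvalues

/-! ### Norming constants and residues -/

section NormingConstants

/-- Lagrange identity: the Wronskian of solutions for `z` and `w` is zero near `+∞` and changes only
at the masses. -/
theorem coef_wronskian (p : DiscretePair) (z w : ℂ) (a : ℝ) :
    (coef p z a).2 * (coef p w a).1 - (coef p z a).1 * (coef p w a).2 =
      ∑ x ∈ rightPoints p a, (potential p z x - potential p w x) *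
        (phiPlus p z x * phiPlus p w x) := by
  induction a using right_induction p with
  | h0 a h => simp [coef_of_eq_empty h, h]
  | h1 a x h ih =>
    rw [h.rightPoints_eq, Finset.sum_insert (self_notMem_rightPoints p x), ← ih, h.coef_eq,
      h.coef_eq]
    have h1 : (Real.exp (-x) : ℂ) * Real.exp x = 1 := by
      rw [← Complex.ofReal_mul, ← Real.exp_add]; simp
    have h2 : (Real.exp (-x / 2) : ℂ) * Real.exp (-x / 2) = Real.exp (-x) := by
      rw [← Complex.ofReal_mul, ← Real.exp_add]; ring_nf
    simp only [transfer, phiPlus, rightValue]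
    generalize (Real.exp (-x / 2) : ℂ) = e at *
    rw [← h2] at h1 ⊢
    generalize (Real.exp x : ℂ) = E at *
    generalize potential p z x = q at *
    generalize potential p w x = q' at *
    generalize coef p z x = u at *
    generalize coef p w x = u' at *
    obtain ⟨A, B⟩ := u
    obtain ⟨A', B'⟩ := u'
    linear_combination (-q * B * (A' - q' * (A' + B' * E)) + q' * B' * (A - q * (A + B * E)) +
      q' * (A' + B' * E) * B - q * (A + B * E) * B') * h1

/-- The weight `ω({x}) + 2 λ v({x})`. -/
noncomputable def normWeight (p : DiscretePair) (lam : ℝ) (x : ℝ) : ℂ := p.1 x + 2 * lam * (p.2 x : ℝ)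

/-- Divide the Wronskian identity by `z - λ` and let `z → λ`: the Weyl function side becomes the
derivative of `z m₊(z)`. -/
theorem IsRightData.deriv_eq {p : DiscretePair} {a : ℝ} {r : ℝ →₀ ℝ} (h : IsRightData p a r)
    {lam : ℝ} (hl : lam ∉ r.support) :
    nev 0 0 r lam + lam * nevDeriv 0 r lam =
      (∑ x ∈ rightPoints p a, normWeight p lam x * phiPlus p lam x ^ 2) / phiPlus p lam a ^ 2 := by
  have hV := h.value_ne_zero (coe_ne_of_notMem hl)
  have hφ := h.phiPlus_ne (coe_ne_of_notMem hl)
  have hd : HasDerivAt (fun z : ℂ => z * nev 0 0 r z) _ (lam : ℂ) :=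
    (hasDerivAt_id (lam : ℂ)).mul (hasDerivAt_nev 0 0 r hl)
  have h1 := hasDerivAt_iff_tendsto_slope.1 hd
  have hcφ : ∀ x, Continuous fun z => phiPlus p z x := continuous_phiPlus p
  have h2 : Tendsto (fun z : ℂ => (∑ x ∈ rightPoints p a,
      ((p.1 x : ℂ) + (z + lam) * (p.2 x : ℝ)) * (phiPlus p z x * phiPlus p lam x)) /
        (phiPlus p z a * phiPlus p lam a)) (𝓝[≠] (lam : ℂ))
      (𝓝 ((∑ x ∈ rightPoints p a,
      ((p.1 x : ℂ) + (lam + lam) * (p.2 x : ℝ)) * (phiPlus p lam x * phiPlus p lam x)) /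
        (phiPlus p lam a * phiPlus p lam a))) := by
    refine Tendsto.mono_left ?_ (nhdsWithin_le_nhds (s := {(lam : ℂ)}ᶜ))
    refine Tendsto.div (Continuous.tendsto ?_ (lam : ℂ)) (Continuous.tendsto ?_ (lam : ℂ))
      (mul_ne_zero hφ hφ)
    · fun_prop
    · fun_prop
  have h3 := tendsto_nhds_unique h1 (h2.congr' (by
    filter_upwards [eventually_nhdsNE_ne_coe r.support lam, eventually_mem_nhdsWithin] with z hz hzl
    have hne : z - lam ≠ 0 := sub_ne_zero.2 hzl
    have hφz := h.phiPlus_ne hz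
    have hW := coef_wronskian p z lam a
    have hsum : ∑ x ∈ rightPoints p a, (potential p z x - potential p lam x) *
        (phiPlus p z x * phiPlus p lam x) = (z - lam) * ∑ x ∈ rightPoints p a,
      ((p.1 x : ℂ) + (z + lam) * (p.2 x : ℝ)) * (phiPlus p z x * phiPlus p lam x) := by
      rw [Finset.mul_sum]
      refine Finset.sum_congr rfl fun x _ => ?_
      simp only [potential]; ring
    rw [hsum] at hW
    have hz' := h.exp_mul_slope hz
    have hl' := h.exp_mul_slope (coe_ne_of_notMem hl)
    rw [slope_def_field, div_eq_div_iff (mul_ne_zero hφz hφ) hne]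
    have e1 : (Real.exp (-a / 2) : ℂ) * Real.exp (-a / 2) * Real.exp a = 1 := by
      rw [← Complex.ofReal_mul, ← Complex.ofReal_mul, ← Real.exp_add, ← Real.exp_add]
      norm_num
    rw [mul_comm _ (z - (lam : ℂ)), ← hW]
    have e2 : (z * nev 0 0 r z - lam * nev 0 0 r lam) * (phiPlus p z a * phiPlus p lam a) =
        (z * nev 0 0 r z * phiPlus p z a) * phiPlus p lam a -
        (lam * nev 0 0 r lam * phiPlus p lam a) * phiPlus p z a := by ring
    rw [e2, ← hz', ← hl']
    simp only [phiPlus, rightValue, rightSlope]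
    linear_combination (-(coef p z a).2 * (coef p lam a).1 +
      (coef p z a).1 * (coef p lam a).2) * e1))
  simp only [id, one_mul] at h3
  rw [h3]
  congr 1
  · refine Finset.sum_congr rfl fun x _ => ?_
    rw [normWeight]; ring
  · ring

theorem phiPlus_ofReal (p : DiscretePair) (lam x : ℝ) :
    phiPlus p lam x = ((phiPlus p lam x).re : ℂ) := by
  obtain ⟨r, h⟩ := exists_isRightData p x
  have : phiPlus p lam x = ((Real.exp (-x / 2) * ∏ μ ∈ r.support, (1 - lam / μ) : ℝ) : ℂ) := by
    rw [phiPlus, h.value]; push_cast; rfl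
  rw [this, Complex.ofReal_re]

theorem ofReal_gammaSq (p : DiscretePair) (lam : ℝ) :
    (gammaSq p lam (phiPlus p lam) : ℂ) =
      ∑ x ∈ massPoints p, normWeight p lam x * phiPlus p lam x ^ 2 := by
  have hn : ∀ x, ((‖phiPlus p lam x‖ ^ 2 : ℝ) : ℂ) = phiPlus p lam x ^ 2 := fun x => by
    rw [phiPlus_ofReal, Complex.norm_real, Real.norm_eq_abs, sq_abs]; push_cast; rfl
  rw [gammaSq, Finsupp.sum_of_support_subset _ (s := massPoints p) Finset.subset_union_left _
    (by simp), Finsupp.sum_of_support_subset _ (s := massPoints p) Finset.subset_union_right _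
    (by simp), Finset.mul_sum, ← Finset.sum_add_distrib, Complex.ofReal_sum]
  refine Finset.sum_congr rfl fun x _ => ?_
  rw [normWeight, ← hn]
  push_cast
  ring

/-- Add the derivative identities of both sides, where the ratios `φ₋(x)/φ₋(a)` and `φ₊(x)/φ₊(a)`
agree at an eigenvalue. The relation `M(λ) = 0` then supplies the contribution `ω + 2 λ v` of a mass
at `a`. -/
theorem nevDeriv_eq_gammaSq {p : DiscretePair} {a : ℝ} {rp rm : ℝ →₀ ℝ} (hp : IsRightData p a rp)
    (hm : IsRightData (reflect p) (-a) rm) {lam : ℝ} (hl : (lam : ℂ) ∈ spectrum p)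
    (hne : phiPlus p lam a ≠ 0) :
    lam * nevDeriv (p.2 a) (totalResidues rp rm) lam * (phiPlus p lam a).re ^ 2 =
      gammaSq p lam (phiPlus p lam) := by
  obtain ⟨h0, h1, h2⟩ := spectrum_ne hp hm hl hne
  have hM := (mem_spectrum_iff_of_ne hp hm h0 h1 h2).1 hl
  have hlp : lam ∉ rp.support := fun h => h1 lam h rfl
  have hlm : lam ∉ rm.support := fun h => h2 lam h rfl
  have dP := hp.deriv_eq hlp
  have dM := hm.deriv_eq hlm
  obtain ⟨Cp, Cm, hCp, hCm, hval, -⟩ := exists_matches_of_mem_spectrum hl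
  have hφm : phiMinus p lam a ≠ 0 := hm.phiPlus_ne h2
  rw [nev_totalResidues] at hM
  have hsplit := sum_massPoints_split p a (h := fun x => normWeight p lam x * phiPlus p lam x ^ 2)
    (fun x hx => by
      obtain ⟨e1, e2⟩ := notMem_massPoints.1 hx
      simp [normWeight, e1, e2])
  have hleft : (∑ x ∈ rightPoints (reflect p) (-a), normWeight p lam (-x) * phiPlus p lam (-x) ^ 2) /
      phiPlus p lam a ^ 2 = (∑ x ∈ rightPoints (reflect p) (-a), normWeight (reflect p) lam x *
      phiPlus (reflect p) lam x ^ 2) / phiPlus (reflect p) lam (-a) ^ 2 := by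
    rw [Finset.sum_div, Finset.sum_div]
    refine Finset.sum_congr rfl fun x _ => ?_
    have e1 : normWeight (reflect p) lam x = normWeight p lam (-x) := rfl
    have e2 := hval (-x)
    have e3 := hval a
    rw [phiMinus, neg_neg] at e2
    change _ = _ / phiMinus p lam a ^ 2
    rw [e1, div_eq_div_iff (pow_ne_zero 2 hne) (pow_ne_zero 2 hφm)]
    have e4 : Cp ^ 2 * Cm ^ 2 ≠ 0 := mul_ne_zero (pow_ne_zero 2 hCp) (pow_ne_zero 2 hCm)
    refine mul_left_cancel₀ e4 ?_
    have e5 : (Cp * phiPlus p lam (-x)) ^ 2 = (Cm * phiPlus (reflect p) lam x) ^ 2 := by rw [e2]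
    have e6 : (Cp * phiPlus p lam a) ^ 2 = (Cm * phiMinus p lam a) ^ 2 := by rw [e3]
    linear_combination normWeight p lam (-x) * (Cm * phiMinus p lam a) ^ 2 * e5 -
      normWeight p lam (-x) * (Cm * phiPlus (reflect p) lam x) ^ 2 * e6
  have key : (lam : ℂ) * nevDeriv (p.2 a) (totalResidues rp rm) lam * phiPlus p lam a ^ 2 =
      (gammaSq p lam (phiPlus p lam) : ℂ) := by
    have hD : nevDeriv (p.2 a) (totalResidues rp rm) lam =
        p.2 a + nevDeriv 0 rp lam + nevDeriv 0 rm lam + 1 / lam ^ 2 := by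
      have := nevDeriv_add (p.2 a) 0 (rp + rm) (Finsupp.single 0 1) lam
      have e2 := nevDeriv_add (p.2 a) 0 rp rm lam
      have e3 := nevDeriv_add (p.2 a) 0 0 rp lam
      simp only [add_zero, zero_add] at this e2 e3
      rw [totalResidues, this, e2, e3]
      simp [nevDeriv]
    rw [ofReal_gammaSq, hsplit]
    rw [← hleft, eq_div_iff (pow_ne_zero 2 hne)] at dM
    rw [eq_div_iff (pow_ne_zero 2 hne)] at dP
    rw [← dP, ← dM, hD]
    simp only [normWeight]
    push_cast
    have e1 : (lam : ℂ) * (1 / lam ^ 2) = 1 / lam := by field_simp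
    linear_combination phiPlus p lam a ^ 2 * e1 - phiPlus p lam a ^ 2 * hM
  rw [phiPlus_ofReal p lam a] at key
  exact_mod_cast key

end NormingConstants

/-! ### Interior spectral data in terms of residues -/

theorem nev_zero_eq (c d : ℝ) (r : ℝ →₀ ℝ) :
    nev c d r 0 = ((d + ∑ μ ∈ r.support, r μ / μ : ℝ) : ℂ) := by
  simp [nev, Finsupp.sum]

/-- The sign-carrying factor of `φ₊(x, a)`. -/
noncomputable def signProd (S : Finset ℝ) (x : ℝ) : ℝ := ∏ μ ∈ S, (1 - x / μ)

theorem IsRightData.phiPlus_re {p : DiscretePair} {a : ℝ} {r : ℝ →₀ ℝ} (h : IsRightData p a r)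
    (x : ℝ) : (phiPlus p x a).re = Real.exp (-a / 2) * signProd r.support x := by
  have : phiPlus p x a = ((Real.exp (-a / 2) * signProd r.support x : ℝ) : ℂ) := by
    rw [phiPlus, h.value, signProd]; push_cast; rfl
  rw [this, Complex.ofReal_re]

theorem isNormalizedEigenfunctionValue_iff {p : DiscretePair} {lam a c : ℝ} :
    IsNormalizedEigenfunctionValue p lam a c ↔
      c = (phiPlus p lam a).re / Real.sqrt (lam * gammaSq p lam (phiPlus p lam)) := by
  constructor
  · rintro ⟨f, hf, hc⟩
    rw [hf.eq, phiPlus_ofReal] at hc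
    exact_mod_cast hc
  · intro h
    refine ⟨_, isPhiPlus_phiPlus p lam, ?_⟩
    rw [phiPlus_ofReal, h]
    push_cast
    rfl

theorem sum_image_eq {N : ℕ} {lam : Fin N → ℝ} (hlam : StrictMono lam) {r : ℝ →₀ ℝ}
    (h : r.support = Finset.univ.image lam) (g : ℝ → ℝ) :
    ∑ μ ∈ r.support, g μ = ∑ i, g (lam i) := by
  rw [h, Finset.sum_image fun i _ j _ hij => hlam.injective hij]

/-- The residue `1` at `0` means the reciprocal has value `0` and derivative `1` there. These two
equations determine its linear part from the spectral data. -/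
theorem IsNegInv.coefficients {c d : ℝ} {r : ℝ →₀ ℝ} {c' d' : ℝ} {r' : ℝ →₀ ℝ}
    (h : IsNegInv c d r c' d' r') (h1 : r 0 = 1) {N : ℕ} {lam phi : Fin N → ℝ}
    (hlam : StrictMono lam) (hs : r'.support = Finset.univ.image lam)
    (hr : ∀ i, r' (lam i) = lam i ^ 2 * phi i ^ 2) :
    c' = 1 - ∑ i, |phi i| ^ 2 ∧ d' = -∑ i, lam i * phi i ^ 2 := by
  have h0 : (0 : ℝ) ∈ r.support := by simp [h1]
  have h0' : (0 : ℝ) ∉ r'.support := Finset.disjoint_left.1 h.disjoint h0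
  have hl0 : ∀ i, lam i ≠ 0 := fun i hi => h0' (by
    rw [hs, ← hi]; exact Finset.mem_image_of_mem _ (Finset.mem_univ i))
  have e1 := h.nev_eq_zero h0
  have e2 := h.nevDeriv_eq h0
  rw [Complex.ofReal_zero, nev_zero_eq, sum_image_eq hlam hs fun μ => r' μ / μ] at e1
  rw [h1, nevDeriv, Finsupp.sum, sum_image_eq hlam hs fun μ => r' μ / (μ - 0) ^ 2] at e2
  have e1 : d' + ∑ i, r' (lam i) / lam i = 0 := by exact_mod_cast e1
  have e3 : ∑ i, r' (lam i) / lam i = ∑ i, lam i * phi i ^ 2 :=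
    Finset.sum_congr rfl fun i _ => by rw [hr]; have := hl0 i; field_simp
  have e4 : ∑ i, r' (lam i) / (lam i - 0) ^ 2 = ∑ i, |phi i| ^ 2 :=
    Finset.sum_congr rfl fun i _ => by
      rw [hr, sub_zero, sq_abs]; have := hl0 i; field_simp
  rw [e3] at e1
  rw [e4] at e2
  constructor <;> linarith

/-- The data of a pair with prescribed interior spectral data, in terms of rational functions. -/
structure IsAnalyzed (p : DiscretePair) (a : ℝ) {N : ℕ} (lam phi : Fin N → ℝ)
    (rp rm r : ℝ →₀ ℝ) : Prop where
  right : IsRightData p a rp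
  left : IsRightData (reflect p) (-a) rm
  disjoint : Disjoint rp.support rm.support
  isNegInv : IsNegInv (p.2 a) (p.1 a) (totalResidues rp rm) (1 - ∑ i, |phi i| ^ 2)
    (-∑ i, lam i * phi i ^ 2) r
  support_eq : r.support = Finset.univ.image lam
  apply_eq : ∀ i, r (lam i) = lam i ^ 2 * phi i ^ 2
  sign : ∀ i, 0 < signProd rp.support (lam i) * phi i

theorem exists_isNegInv_total {p : DiscretePair} {a : ℝ} {rp rm : ℝ →₀ ℝ} (hp : IsRightData p a rp)
    (hm : IsRightData (reflect p) (-a) rm) :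
    ∃ c d r, IsNegInv (p.2 a) (p.1 a) (totalResidues rp rm) c d r := by
  refine exists_isNegInv (p.2 a).2 (totalResidues_nonneg hp.nonneg hm.nonneg)
    (Or.inr (Or.inr fun h => ?_))
  have := totalResidues_zero hp.zero hm.zero
  rw [h] at this
  simp at this

/-- The norming constants are positive. -/
theorem norming_pos {p : DiscretePair} {a : ℝ} {rp rm : ℝ →₀ ℝ} (hp : IsRightData p a rp)
    (hm : IsRightData (reflect p) (-a) rm) {lam : ℝ} (hl : (lam : ℂ) ∈ spectrum p)
    (hne : phiPlus p lam a ≠ 0) :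
    0 < lam * gammaSq p lam (phiPlus p lam) ∧
      1 / nevDeriv (p.2 a) (totalResidues rp rm) lam = lam ^ 2 *
        ((phiPlus p lam a).re / Real.sqrt (lam * gammaSq p lam (phiPlus p lam))) ^ 2 := by
  obtain ⟨h0, h1, h2⟩ := spectrum_ne hp hm hl hne
  have h0 : lam ≠ 0 := by exact_mod_cast h0
  have key := nevDeriv_eq_gammaSq hp hm hl hne
  have hre : (phiPlus p lam a).re ≠ 0 := by
    intro h; rw [phiPlus_ofReal, h] at hne; exact hne rfl
  have hT : totalResidues rp rm ≠ 0 := fun h => by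
    have := totalResidues_zero hp.zero hm.zero
    rw [h] at this
    simp at this
  have hD : 0 < nevDeriv (p.2 a) (totalResidues rp rm) lam := by
    refine nevDeriv_pos (p.2 a).2 (totalResidues_nonneg hp.nonneg hm.nonneg) (Or.inr hT) ?_
    rw [support_totalResidues hp.nonneg hm.nonneg hp.zero hm.zero, Finset.mem_insert,
      Finset.mem_union]
    rintro (h | h | h)
    · exact h0 h
    · exact h1 lam h rfl
    · exact h2 lam h rfl
  have hpos : 0 < lam * gammaSq p lam (phiPlus p lam) := by
    rw [← key]
    have : lam * (lam * nevDeriv (p.2 a) (totalResidues rp rm) lam * (phiPlus p lam a).re ^ 2) =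
      nevDeriv (p.2 a) (totalResidues rp rm) lam * (lam * (phiPlus p lam a).re) ^ 2 := by ring
    rw [this]
    positivity
  refine ⟨hpos, ?_⟩
  rw [div_pow, Real.sq_sqrt hpos.le, ← key]
  field_simp

/-- Since no `φ_i(a)` vanishes, `φ₊` and `φ₋` have no common zero at `a`, so every eigenvalue is
seen by `M`. The sign condition holds because `φ_i(a)` is a positive multiple of `signProd`. -/
theorem IsInteriorSpectralData.exists_isAnalyzed {p : DiscretePair} {a : ℝ} {N : ℕ}
    {lam phi : Fin N → ℝ} (h : IsInteriorSpectralData p a lam phi) (hphi : ∀ i, phi i ≠ 0) :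
    ∃ rp rm r, IsAnalyzed p a lam phi rp rm r := by
  obtain ⟨rp, hp⟩ := exists_isRightData p a
  obtain ⟨rm, hm⟩ := exists_isRightData (reflect p) (-a)
  obtain ⟨c, d, r, hK⟩ := exists_isNegInv_total hp hm
  have hval := fun i => isNormalizedEigenfunctionValue_iff.1 (h.value i)
  have hspec : ∀ i, (lam i : ℂ) ∈ spectrum p := fun i => by rw [h.spectrum_eq]; exact ⟨i, rfl⟩
  have hne : ∀ i, phiPlus p (lam i) a ≠ 0 := fun i h0 => hphi i (by
    rw [hval i, h0, Complex.zero_re, zero_div])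
  have hdis : Disjoint rp.support rm.support := by
    rw [Finset.disjoint_left]
    intro μ h1 h2
    have := mem_spectrum_of_mem_support hp hm h1 h2
    rw [h.spectrum_eq] at this
    obtain ⟨i, hi⟩ := this
    refine hne i ((phiPlus_eq_zero_iff _ _ _).2 ?_)
    simp only at hi
    rw [hi]
    exact hp.value_eq_zero h1
  have hmem := fun z => coe_mem_spectrum_iff hp hm hdis hK (z := z)
  have hsupp : r.support = Finset.univ.image lam := by
    ext ν
    simp only [Finset.mem_image, Finset.mem_univ, true_and]
    have h1 := hmem ν
    rw [h.spectrum_eq] at h1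
    constructor
    · intro hν
      obtain ⟨i, hi⟩ := h1.2 ⟨ν, hν, rfl⟩
      exact ⟨i, Complex.ofReal_inj.1 hi⟩
    · rintro ⟨i, rfl⟩
      obtain ⟨ν, hν, h2⟩ := h1.1 ⟨i, rfl⟩
      rwa [Complex.ofReal_inj.1 h2]
  have hN := fun i => norming_pos hp hm (hspec i) (hne i)
  have hr : ∀ i, r (lam i) = lam i ^ 2 * phi i ^ 2 := fun i => by
    rw [hK.residue (lam i) (by rw [hsupp]; exact Finset.mem_image_of_mem _ (Finset.mem_univ i)),
      (hN i).2, ← hval i]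
  obtain ⟨rfl, rfl⟩ := hK.coefficients (totalResidues_zero hp.zero hm.zero) h.strictMono hsupp hr
  refine ⟨rp, rm, r, hp, hm, hdis, hK, hsupp, hr, fun i => ?_⟩
  have h1 := hval i
  rw [hp.phiPlus_re] at h1
  have hsq := Real.sqrt_pos.2 (hN i).1
  have hs0 : signProd rp.support (lam i) ≠ 0 := fun h0 => hphi i (by rw [h1, h0]; simp)
  rw [h1]
  have e := Real.exp_pos (-a / 2)
  have : signProd rp.support (lam i) * (Real.exp (-a / 2) * signProd rp.support (lam i) /
      Real.sqrt (lam i * gammaSq p (lam i) (phiPlus p (lam i)))) =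
      Real.exp (-a / 2) * signProd rp.support (lam i) ^ 2 /
      Real.sqrt (lam i * gammaSq p (lam i) (phiPlus p (lam i))) := by ring
  rw [this]
  positivity

/-- The residues recover only the squares of the eigenfunction values; the sign condition selects
the root. -/
theorem IsAnalyzed.isInteriorSpectralData {p : DiscretePair} {a : ℝ} {N : ℕ} {lam phi : Fin N → ℝ}
    {rp rm r : ℝ →₀ ℝ} (hlam : StrictMono lam) (h : IsAnalyzed p a lam phi rp rm r) :
    IsInteriorSpectralData p a lam phi := by
  have hspec : spectrum p = Set.range fun i => (lam i : ℂ) := by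
    ext z
    rw [coe_mem_spectrum_iff h.right h.left h.disjoint h.isNegInv, h.support_eq]
    simp [eq_comm]
  refine ⟨hlam, hspec, fun i => ?_⟩
  rw [isNormalizedEigenfunctionValue_iff]
  have hs : (lam i : ℂ) ∈ spectrum p := by rw [hspec]; exact ⟨i, rfl⟩
  have hsg := h.sign i
  have hre := h.right.phiPlus_re (lam i)
  have hne : phiPlus p (lam i) a ≠ 0 := by
    rw [phiPlus_ofReal, hre]
    have : signProd rp.support (lam i) ≠ 0 := fun h0 => by rw [h0, zero_mul] at hsg; exact hsg.false
    exact_mod_cast mul_ne_zero (Real.exp_pos _).ne' this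
  obtain ⟨hpos, hN⟩ := norming_pos h.right h.left hs hne
  have hl0 : lam i ≠ 0 := by
    exact_mod_cast (spectrum_ne h.right h.left hs hne).1
  rw [← h.isNegInv.residue (lam i) (by
    rw [h.support_eq]; exact Finset.mem_image_of_mem _ (Finset.mem_univ i)), h.apply_eq] at hN
  have hsq := mul_left_cancel₀ (pow_ne_zero 2 hl0) hN
  rcases sq_eq_sq_iff_eq_or_eq_neg.1 hsq with h1 | h1
  · exact h1
  · exfalso
    rw [h1, hre] at hsg
    have hsp := Real.sqrt_pos.2 hpos
    have e := Real.exp_pos (-a / 2)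
    have : signProd rp.support (lam i) * -(Real.exp (-a / 2) * signProd rp.support (lam i) /
        Real.sqrt (lam i * gammaSq p (lam i) (phiPlus p (lam i)))) =
        -(Real.exp (-a / 2) * signProd rp.support (lam i) ^ 2 /
        Real.sqrt (lam i * gammaSq p (lam i) (phiPlus p (lam i)))) := by ring
    rw [this] at hsg
    have : 0 ≤ Real.exp (-a / 2) * signProd rp.support (lam i) ^ 2 /
        Real.sqrt (lam i * gammaSq p (lam i) (phiPlus p (lam i))) := by positivity
    linarith

/-! ### Interlacing and sign patterns -/

theorem nev_sub_nev (c d : ℝ) {r : ℝ →₀ ℝ} {x y : ℝ} (hx : x ∉ r.support) (hy : y ∉ r.support) :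
    nev c d r y - nev c d r x =
      (((y - x) * (c + ∑ ν ∈ r.support, r ν / ((ν - x) * (ν - y))) : ℝ) : ℂ) := by
  simp only [nev, Finsupp.sum]
  push_cast
  rw [mul_add, Finset.mul_sum]
  have : ∑ ν ∈ r.support, (r ν : ℂ) / (ν - y) = ∑ ν ∈ r.support, (r ν : ℂ) / (ν - x) +
      ∑ ν ∈ r.support, (y - x : ℂ) * (r ν / ((ν - x) * (ν - y))) := by
    rw [← Finset.sum_add_distrib]
    refine Finset.sum_congr rfl fun ν hν => ?_
    have h1 : (ν : ℂ) - x ≠ 0 := sub_ne_zero.2 (coe_ne_of_notMem hx ν hν).symm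
    have h2 : (ν : ℂ) - y ≠ 0 := sub_ne_zero.2 (coe_ne_of_notMem hy ν hν).symm
    field_simp
    ring
  rw [this]
  ring

/-- The reciprocal vanishes at both points, so its difference quotient `c' + ∑ r'/((ν - x)(ν - y))`
is zero. Without a pole in between every summand is nonnegative, contradicting `c' > 0`. -/
theorem IsNegInv.exists_between {c d : ℝ} {r : ℝ →₀ ℝ} {c' d' : ℝ} {r' : ℝ →₀ ℝ}
    (h : IsNegInv c d r c' d' r') (hc' : 0 < c') {x y : ℝ} (hx : x ∈ r.support)
    (hy : y ∈ r.support) (hxy : x < y) : ∃ ν ∈ r'.support, x < ν ∧ ν < y := by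
  by_contra hcon
  push Not at hcon
  have hx' := Finset.disjoint_left.1 h.disjoint hx
  have hy' := Finset.disjoint_left.1 h.disjoint hy
  have h1 := nev_sub_nev c' d' hx' hy'
  rw [h.nev_eq_zero hx, h.nev_eq_zero hy, sub_zero] at h1
  have h2 : (y - x) * (c' + ∑ ν ∈ r'.support, r' ν / ((ν - x) * (ν - y))) = 0 := by
    exact_mod_cast h1.symm
  have h3 : 0 ≤ ∑ ν ∈ r'.support, r' ν / ((ν - x) * (ν - y)) := by
    refine Finset.sum_nonneg fun ν hν => div_nonneg (h.nonneg ν) ?_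
    have hνx : ν ≠ x := fun e => hx' (e ▸ hν)
    rcases lt_or_gt_of_ne hνx with h4 | h4
    · exact mul_nonneg_of_nonpos_of_nonpos (by linarith) (by linarith)
    · have := hcon ν hν h4
      exact mul_nonneg (by linarith) (by linarith)
  have : 0 < (y - x) * (c' + ∑ ν ∈ r'.support, r' ν / ((ν - x) * (ν - y))) :=
    mul_pos (by linarith) (by linarith)
  exact this.ne' h2

/-- The points of `Z` interlace with the values of `lam` and `0`. -/
structure Interlaces {N : ℕ} (lam : Fin N → ℝ) (Z : Finset ℝ) : Prop where
  zero_notMem : (0 : ℝ) ∉ Z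
  card_eq : Z.card = N
  ne : ∀ i, ∀ μ ∈ insert 0 Z, lam i ≠ μ
  between : ∀ x ∈ insert 0 Z, ∀ y ∈ insert 0 Z, x < y → ∃ i, x < lam i ∧ lam i < y

/-- The number of values of `lam` below `μ`. -/
noncomputable def countBelow {N : ℕ} (lam : Fin N → ℝ) (μ : ℝ) : ℕ :=
  (Finset.univ.filter fun i => lam i < μ).card

/-- The points of `Z` outside the range spanned by `lam`. -/
noncomputable def outerPoints {N : ℕ} (lam : Fin N → ℝ) (Z : Finset ℝ) : Finset ℝ :=
  Z.filter fun μ => countBelow lam μ = 0 ∨ countBelow lam μ = N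

theorem countBelow_le {N : ℕ} (lam : Fin N → ℝ) (μ : ℝ) : countBelow lam μ ≤ N := by
  simpa [countBelow] using Finset.card_filter_le (Finset.univ : Finset (Fin N)) fun i => lam i < μ

theorem countBelow_eq_zero {N : ℕ} {lam : Fin N → ℝ} {μ : ℝ} :
    countBelow lam μ = 0 ↔ ∀ i, μ ≤ lam i := by
  simp [countBelow, Finset.filter_eq_empty_iff]

theorem countBelow_eq_card {N : ℕ} {lam : Fin N → ℝ} {μ : ℝ} :
    countBelow lam μ = N ↔ ∀ i, lam i < μ := by
  have := Finset.card_filter_eq_iff (s := (Finset.univ : Finset (Fin N))) (p := fun i => lam i < μ)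
  simpa [countBelow] using this

namespace Interlaces

variable {N : ℕ} {lam : Fin N → ℝ} {Z : Finset ℝ}

theorem countBelow_lt (h : Interlaces lam Z) {x y : ℝ} (hx : x ∈ insert 0 Z) (hy : y ∈ insert 0 Z)
    (hxy : x < y) : countBelow lam x < countBelow lam y := by
  obtain ⟨i, h1, h2⟩ := h.between x hx y hy hxy
  refine Finset.card_lt_card (Finset.ssubset_iff_of_subset (fun k hk => ?_) |>.2 ⟨i, ?_, ?_⟩)
  · simp only [Finset.mem_filter, Finset.mem_univ, true_and] at hk ⊢
    exact hk.trans hxy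
  · simpa using h2
  · simpa using h1.le

theorem injOn (h : Interlaces lam Z) {x y : ℝ} (hx : x ∈ insert 0 Z) (hy : y ∈ insert 0 Z)
    (hxy : countBelow lam x = countBelow lam y) : x = y := by
  rcases lt_trichotomy x y with h1 | h1 | h1
  · exact absurd hxy (h.countBelow_lt hx hy h1).ne
  · exact h1
  · exact absurd hxy (h.countBelow_lt hy hx h1).ne'

/-- The `N + 1` points of `insert 0 Z` have distinct counts among `0, …, N`, so every count occurs.
-/
theorem exists_eq (h : Interlaces lam Z) {k : ℕ} (hk : k ≤ N) :
    ∃ μ ∈ insert 0 Z, countBelow lam μ = k := by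
  have himg : (insert 0 Z).image (countBelow lam) = Finset.range (N + 1) := by
    refine Finset.eq_of_subset_of_card_le (fun k hk => ?_) ?_
    · obtain ⟨μ, -, rfl⟩ := Finset.mem_image.1 hk
      exact Finset.mem_range.2 (Nat.lt_succ_of_le (countBelow_le lam μ))
    · rw [Finset.card_image_of_injOn fun x hx y hy => h.injOn hx hy,
        Finset.card_insert_of_notMem h.zero_notMem, h.card_eq, Finset.card_range]
  exact Finset.mem_image.1 (himg ▸ Finset.mem_range.2 (Nat.lt_succ_of_le hk))

theorem outerPoints_eq (h : Interlaces lam Z) : ∃ e₀ ∈ insert 0 Z, ∃ e₁ ∈ insert 0 Z,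
    countBelow lam e₀ = 0 ∧ countBelow lam e₁ = N ∧
      outerPoints lam Z = ({e₀, e₁} : Finset ℝ).erase 0 := by
  obtain ⟨e₀, h0, h0'⟩ := h.exists_eq (Nat.zero_le N)
  obtain ⟨e₁, h1, h1'⟩ := h.exists_eq le_rfl
  refine ⟨e₀, h0, e₁, h1, h0', h1', ?_⟩
  ext μ
  simp only [outerPoints, Finset.mem_filter, Finset.mem_erase, Finset.mem_insert,
    Finset.mem_singleton]
  constructor
  · rintro ⟨hμ, hc⟩
    refine ⟨fun e => h.zero_notMem (e ▸ hμ), ?_⟩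
    have hμ' := Finset.mem_insert_of_mem (b := (0 : ℝ)) hμ
    rcases hc with hc | hc
    · exact Or.inl (h.injOn hμ' h0 (hc.trans h0'.symm))
    · exact Or.inr (h.injOn hμ' h1 (hc.trans h1'.symm))
  · rintro ⟨hμ, rfl | rfl⟩
    · exact ⟨(Finset.mem_insert.1 h0).resolve_left hμ, Or.inl h0'⟩
    · exact ⟨(Finset.mem_insert.1 h1).resolve_left hμ, Or.inr h1'⟩

theorem card_outerPoints_of_eq (h : Interlaces lam Z) (hN : 0 < N)
    (h0 : countBelow lam 0 = 0 ∨ countBelow lam 0 = N) : (outerPoints lam Z).card = 1 := by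
  obtain ⟨e₀, he₀, e₁, he₁, hc₀, hc₁, heq⟩ := h.outerPoints_eq
  have hne : e₀ ≠ e₁ := by rintro rfl; omega
  rw [heq]
  have hz : (0 : ℝ) ∈ insert 0 Z := Finset.mem_insert_self _ _
  rcases h0 with h0 | h0
  · obtain rfl := h.injOn hz he₀ (h0.trans hc₀.symm)
    rw [Finset.card_erase_of_mem (by simp), Finset.card_pair hne]
  · obtain rfl := h.injOn hz he₁ (h0.trans hc₁.symm)
    rw [Finset.card_erase_of_mem (by simp), Finset.card_pair hne]

theorem card_outerPoints_of_ne (h : Interlaces lam Z) (hN : 0 < N)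
    (h0 : countBelow lam 0 ≠ 0) (h1 : countBelow lam 0 ≠ N) : (outerPoints lam Z).card = 2 := by
  obtain ⟨e₀, he₀, e₁, he₁, hc₀, hc₁, heq⟩ := h.outerPoints_eq
  have hne : e₀ ≠ e₁ := by rintro rfl; omega
  rw [heq, Finset.erase_eq_of_notMem, Finset.card_pair hne]
  simp only [Finset.mem_insert, Finset.mem_singleton, not_or]
  constructor
  · rintro rfl; exact h0 hc₀
  · rintro rfl; exact h1 hc₁

theorem one_sub_div_ne_zero (h : Interlaces lam Z) (i : Fin N) {μ : ℝ} (hμ : μ ∈ Z) :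
    1 - lam i / μ ≠ 0 := by
  have h0 : μ ≠ 0 := fun e => h.zero_notMem (e ▸ hμ)
  rw [sub_ne_zero, ne_comm, Ne, div_eq_one_iff_eq h0]
  exact h.ne i μ (Finset.mem_insert_of_mem hμ)

theorem signProd_ne_zero (h : Interlaces lam Z) (i : Fin N) {D : Finset ℝ} (hD : D ⊆ Z) :
    signProd D (lam i) ≠ 0 :=
  Finset.prod_ne_zero_iff.2 fun _ hμ => h.one_sub_div_ne_zero i (hD hμ)

/-- An outer point to the left of all eigenvalues is negative, since otherwise an eigenvalue would
lie between `0` and it; symmetrically on the right. Either way `λ_i/μ < 1`. -/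
theorem one_sub_div_pos (h : Interlaces lam Z) (i : Fin N) {μ : ℝ} (hμ : μ ∈ outerPoints lam Z) :
    0 < 1 - lam i / μ := by
  obtain ⟨hμ, hc⟩ := Finset.mem_filter.1 hμ
  have h0 : μ ≠ 0 := fun e => h.zero_notMem (e ▸ hμ)
  have hμ' := Finset.mem_insert_of_mem (b := (0 : ℝ)) hμ
  have hz : (0 : ℝ) ∈ insert 0 Z := Finset.mem_insert_self _ _
  rw [sub_pos]
  rcases hc with hc | hc
  · rw [countBelow_eq_zero] at hc
    have hneg : μ < 0 := by
      refine lt_of_le_of_ne (not_lt.1 fun hpos => ?_) h0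
      obtain ⟨k, -, hk⟩ := h.between 0 hz μ hμ' hpos
      exact absurd (hc k) (not_le.2 hk)
    rw [div_lt_one_of_neg hneg]
    exact lt_of_le_of_ne (hc i) (h.ne i μ hμ').symm
  · rw [countBelow_eq_card] at hc
    have hpos : 0 < μ := by
      refine lt_of_le_of_ne (not_lt.1 fun hneg => ?_) h0.symm
      obtain ⟨k, hk, -⟩ := h.between μ hμ' 0 hz hneg
      exact absurd (hc k) (not_lt.2 hk.le)
    rw [div_lt_one hpos]
    exact hc i

/-- If `ν ∈ D` lies between neighbouring eigenvalues, interlacing makes it the only point of `Z`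
between them, so just its factor changes sign from one to the other and the two products cannot both
be positive. -/
theorem signProd_pos_iff (h : Interlaces lam Z) {D : Finset ℝ} (hD : D ⊆ Z) :
    (∀ i, 0 < signProd D (lam i)) ↔ D ⊆ outerPoints lam Z := by
  constructor
  · intro hpos ν hν
    by_contra hout
    have hνZ := hD hν
    have hν' := Finset.mem_insert_of_mem (b := (0 : ℝ)) hνZ
    have hc : ¬(countBelow lam ν = 0 ∨ countBelow lam ν = N) := fun hc =>
      hout (Finset.mem_filter.2 ⟨hνZ, hc⟩)
    push Not at hc
    rw [Ne, countBelow_eq_zero, Ne, countBelow_eq_card] at hc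
    push Not at hc
    obtain ⟨⟨i₀, hi₀⟩, j₀, hj₀⟩ := hc
    obtain ⟨i, hi, hmax⟩ := Finset.exists_max_image (Finset.univ.filter fun i => lam i < ν) lam
      ⟨i₀, by simpa using hi₀⟩
    obtain ⟨j, hj, hmin⟩ := Finset.exists_min_image (Finset.univ.filter fun i => ν < lam i) lam
      ⟨j₀, by simpa using lt_of_le_of_ne hj₀ (h.ne j₀ ν hν').symm⟩
    simp only [Finset.mem_filter, Finset.mem_univ, true_and] at hi hmax hj hmin
    have hother : ∀ μ ∈ D.erase ν, 0 < (1 - lam i / μ) * (1 - lam j / μ) := by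
      intro μ hμ
      obtain ⟨hμν, hμD⟩ := Finset.mem_erase.1 hμ
      have hμ' := Finset.mem_insert_of_mem (b := (0 : ℝ)) (hD hμD)
      have h0 : μ ≠ 0 := fun e => h.zero_notMem (e ▸ hD hμD)
      have hkey : 0 < (μ - lam i) * (μ - lam j) := by
        rcases lt_or_gt_of_ne (h.ne i μ hμ') with h1 | h1
        · rcases lt_or_gt_of_ne (h.ne j μ hμ') with h2 | h2
          · exact mul_pos (by linarith) (by linarith)
          · exfalso
            rcases lt_or_gt_of_ne hμν with h3 | h3
            · obtain ⟨k, hk1, hk2⟩ := h.between μ hμ' ν hν' h3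
              have := hmax k hk2
              linarith
            · obtain ⟨k, hk1, hk2⟩ := h.between ν hν' μ hμ' h3
              have := hmin k hk1
              linarith
        · exact mul_pos_of_neg_of_neg (by linarith) (by linarith)
      have : (1 - lam i / μ) * (1 - lam j / μ) = (μ - lam i) * (μ - lam j) / μ ^ 2 := by
        field_simp
      rw [this]
      positivity
    have h0 : ν ≠ 0 := fun e => h.zero_notMem (e ▸ hνZ)
    have hneg : (1 - lam i / ν) * (1 - lam j / ν) < 0 := by
      have : (1 - lam i / ν) * (1 - lam j / ν) = -((ν - lam i) * (lam j - ν) / ν ^ 2) := by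
        field_simp
        ring
      rw [this, neg_lt_zero]
      exact div_pos (mul_pos (by linarith) (by linarith)) (by positivity)
    have hprod : signProd D (lam i) * signProd D (lam j) =
        (1 - lam i / ν) * (1 - lam j / ν) *
          ∏ μ ∈ D.erase ν, (1 - lam i / μ) * (1 - lam j / μ) := by
      rw [signProd, signProd, ← Finset.prod_mul_distrib]
      exact (Finset.mul_prod_erase D (fun μ => (1 - lam i / μ) * (1 - lam j / μ)) hν).symm
    have := mul_pos (hpos i) (hpos j)
    rw [hprod] at this
    exact absurd this (not_lt.2 (mul_neg_of_neg_of_pos hneg (Finset.prod_pos hother)).le)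
  · exact fun hsub i => Finset.prod_pos fun μ hμ => h.one_sub_div_pos i (hsub hμ)

theorem signProd_mul (S T : Finset ℝ) (x : ℝ) :
    signProd S x * signProd T x = signProd (symmDiff S T) x * signProd (S ∩ T) x ^ 2 := by
  unfold signProd
  have hd : Disjoint (S \ T) (T \ S) := disjoint_sdiff_sdiff
  rw [← Finset.prod_inter_mul_prod_sdiff S T, ← Finset.prod_inter_mul_prod_sdiff T S,
    symmDiff_def, Finset.sup_eq_union, Finset.prod_union hd, Finset.inter_comm T S]
  ring

/-- Common factors of the two products enter squared, so sign agreement depends only on the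
symmetric difference. -/
theorem signProd_mul_pos_iff (h : Interlaces lam Z) {phi : Fin N → ℝ} {S T : Finset ℝ} (hS : S ⊆ Z)
    (hT : T ⊆ Z) (hsign : ∀ i, 0 < signProd T (lam i) * phi i) :
    (∀ i, 0 < signProd S (lam i) * phi i) ↔ symmDiff S T ⊆ outerPoints lam Z := by
  have hD : symmDiff S T ⊆ Z := fun μ hμ => by
    rcases Finset.mem_symmDiff.1 hμ with h1 | h1
    · exact hS h1.1
    · exact hT h1.1
  rw [← h.signProd_pos_iff hD]
  refine forall_congr' fun i => ?_
  have hI := h.signProd_ne_zero i (Finset.inter_subset_left.trans hS : S ∩ T ⊆ Z)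
  have hT0 := h.signProd_ne_zero i hT
  have e := signProd_mul S T (lam i)
  have hphi : phi i ≠ 0 := fun h0 => by have := hsign i; rw [h0, mul_zero] at this; exact this.false
  have e2 : signProd S (lam i) * phi i * (signProd T (lam i) * phi i) =
      signProd (symmDiff S T) (lam i) * (signProd (S ∩ T) (lam i) * phi i) ^ 2 := by
    linear_combination phi i ^ 2 * e
  have hsq : 0 < (signProd (S ∩ T) (lam i) * phi i) ^ 2 := by positivity
  rw [← mul_pos_iff_of_pos_right (hsign i), e2, mul_pos_iff_of_pos_right hsq]

end Interlaces

/-! ### Reconstruction and counting -/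

theorem IsNegInv.unique_left {c₁ d₁ c₂ d₂ c d : ℝ} {r₁ r₂ r : ℝ →₀ ℝ}
    (h₁ : IsNegInv c₁ d₁ r₁ c d r) (h₂ : IsNegInv c₂ d₂ r₂ c d r) :
    c₁ = c₂ ∧ d₁ = d₂ ∧ r₁ = r₂ := by
  refine nev_injective ?_
  filter_upwards [eventually_cofinite_ne_coe r₁.support, eventually_cofinite_ne_coe r₂.support,
    eventually_cofinite_ne_coe r.support] with z hz₁ hz₂ hz
  have e₁ := h₁.mul_eq z hz₁ hz
  have e₂ := h₂.mul_eq z hz₂ hz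
  refine mul_right_cancel₀ (b := nev c d r z) (fun h0 => ?_) (e₁.trans e₂.symm)
  rw [h0, mul_zero] at e₁
  norm_num at e₁

/-- A linear term in the reciprocal forces the original function to vanish at infinity. Applied to
`M`, the condition `α ≠ 0` excludes a mass at `a`. -/
theorem IsNegInv.pos_of_ne {c d c' d' : ℝ} {r r' : ℝ →₀ ℝ} (h : IsNegInv c d r c' d' r')
    (hc' : c' ≠ 0) : c = 0 ∧ d = 0 ∧ 0 < c' ∧ r'.support.card + 1 = r.support.card := by
  have hc : c = 0 := by
    by_contra hc
    exact hc' (h.card_of_ne hc).2.1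
  have hd : d = 0 := by
    by_contra hd
    exact hc' (h.card_of_eq_of_ne hc hd).2.1
  exact ⟨hc, hd, (h.card_of_eq hc hd).2, (h.card_of_eq hc hd).1⟩

theorem support_add_of_nonneg {rp rm : ℝ →₀ ℝ} (hp : 0 ≤ rp) (hm : 0 ≤ rm) :
    (rp + rm).support = rp.support ∪ rm.support := by
  ext μ
  have h1 := hp μ
  have h2 := hm μ
  simp only [Finsupp.coe_zero, Pi.zero_apply] at h1 h2
  simp only [Finsupp.mem_support_iff, Finsupp.add_apply, Finset.mem_union]
  rw [Ne, add_eq_zero_iff_of_nonneg h1 h2]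
  tauto

section Classical

open scoped Classical

theorem filter_mem_support_of_disjoint {rp rm : ℝ →₀ ℝ} (h : Disjoint rp.support rm.support) :
    (rp + rm).filter (· ∈ rp.support) = rp ∧ (rp + rm).filter (· ∉ rp.support) = rm := by
  constructor
  · ext μ
    by_cases hμ : μ ∈ rp.support
    · rw [Finsupp.filter_apply_pos (· ∈ rp.support) _ hμ, Finsupp.add_apply,
        Finsupp.notMem_support_iff.1 (Finset.disjoint_left.1 h hμ), add_zero]
    · rw [Finsupp.filter_apply_neg (· ∈ rp.support) _ hμ, Finsupp.notMem_support_iff.1 hμ]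
  · ext μ
    by_cases hμ : μ ∈ rp.support
    · rw [Finsupp.filter_apply_neg (· ∉ rp.support) _ (not_not.2 hμ),
        Finsupp.notMem_support_iff.1 (Finset.disjoint_left.1 h hμ)]
    · rw [Finsupp.filter_apply_pos (· ∉ rp.support) _ hμ, Finsupp.add_apply,
        Finsupp.notMem_support_iff.1 hμ, zero_add]

variable {a : ℝ} {N : ℕ} {lam phi : Fin N → ℝ}

theorem IsAnalyzed.residues_unique {p p' : DiscretePair} {rp rm r rp' rm' r' : ℝ →₀ ℝ}
    (h : IsAnalyzed p a lam phi rp rm r) (h' : IsAnalyzed p' a lam phi rp' rm' r') :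
    r = r' ∧ rp + rm = rp' + rm' := by
  have hr : r = r' := by
    ext μ
    by_cases hμ : μ ∈ Finset.univ.image lam
    · obtain ⟨i, -, rfl⟩ := Finset.mem_image.1 hμ
      rw [h.apply_eq, h'.apply_eq]
    · rw [Finsupp.notMem_support_iff.1 (h.support_eq ▸ hμ),
        Finsupp.notMem_support_iff.1 (h'.support_eq ▸ hμ)]
  subst hr
  exact ⟨rfl, add_right_cancel (h.isNegInv.unique_left h'.isNegInv).2.2⟩

theorem IsAnalyzed.pair_unique {p p' : DiscretePair} {rp rm r r' : ℝ →₀ ℝ}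
    (h : IsAnalyzed p a lam phi rp rm r) (h' : IsAnalyzed p' a lam phi rp rm r')
    (halpha : 1 - ∑ i, |phi i| ^ 2 ≠ 0) : p = p' := by
  have hR := h.right.pair_unique h'.right
  have hL := h.left.pair_unique h'.left
  have ha := h.isNegInv.pos_of_ne halpha
  have ha' := h'.isNegInv.pos_of_ne halpha
  have key : ∀ x, p.1 x = p'.1 x ∧ p.2 x = p'.2 x := fun x => by
    rcases lt_trichotomy x a with hx | rfl | hx
    · simpa using hL (-x) (by linarith)
    · refine ⟨ha.2.1.trans ha'.2.1.symm, ?_⟩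
      exact_mod_cast ha.1.trans ha'.1.symm
    · exact hR x hx
  exact Prod.ext (Finsupp.ext fun x => (key x).1) (Finsupp.ext fun x => (key x).2)

theorem exists_pair_of_residues (a : ℝ) {rp rm : ℝ →₀ ℝ} (hp : 0 ≤ rp) (hp0 : rp 0 = 0)
    (hm : 0 ≤ rm) (hm0 : rm 0 = 0) : ∃ p : DiscretePair, p.1 a = 0 ∧ p.2 a = 0 ∧
      IsRightData p a rp ∧ IsRightData (reflect p) (-a) rm := by
  obtain ⟨p₁, h₁, hd₁⟩ := exists_pair_of_rightData a hp hp0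
  obtain ⟨p₂, h₂, hd₂⟩ := exists_pair_of_rightData (-a) hm hm0
  refine ⟨(p₁.1 + (reflect p₂).1, p₁.2 + (reflect p₂).2), ?_, ?_, hd₁.congr fun x hx => ?_,
    hd₂.congr fun x hx => ?_⟩
  · simp [h₁ a le_rfl, h₂ (-a) le_rfl]
  · simp [h₁ a le_rfl, h₂ (-a) le_rfl]
  · simp [h₂ (-x) (by linarith)]
  · simp [h₁ (-x) (by linarith)]

theorem IsAnalyzed.interlaces {p : DiscretePair} {rp rm r : ℝ →₀ ℝ} (hlam : StrictMono lam)
    (h : IsAnalyzed p a lam phi rp rm r) (halpha : 1 - ∑ i, |phi i| ^ 2 ≠ 0) :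
    Interlaces lam (rp + rm).support := by
  have hs : (totalResidues rp rm).support = insert 0 (rp + rm).support := by
    rw [support_totalResidues h.right.nonneg h.left.nonneg h.right.zero h.left.zero,
      support_add_of_nonneg h.right.nonneg h.left.nonneg]
  obtain ⟨-, -, hpos, hcard⟩ := h.isNegInv.pos_of_ne halpha
  have h0 : (0 : ℝ) ∉ (rp + rm).support := by simp [h.right.zero, h.left.zero]
  refine ⟨h0, ?_, ?_, ?_⟩
  · rw [hs, Finset.card_insert_of_notMem h0, h.support_eq,
      Finset.card_image_of_injective _ hlam.injective, Finset.card_univ, Fintype.card_fin] at hcard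
    omega
  · rintro i μ hμ rfl
    rw [← hs] at hμ
    refine Finset.disjoint_left.1 h.isNegInv.disjoint hμ ?_
    rw [h.support_eq]
    exact Finset.mem_image_of_mem _ (Finset.mem_univ i)
  · intro x hx y hy hxy
    rw [← hs] at hx hy
    obtain ⟨ν, hν, h1, h2⟩ := h.isNegInv.exists_between hpos hx hy hxy
    rw [h.support_eq] at hν
    obtain ⟨i, -, rfl⟩ := Finset.mem_image.1 hν
    exact ⟨i, h1, h2⟩

/-- Any splitting of the fixed residues `rp + rm` leaves `M` unchanged, so only the sign condition
constrains the set of poles given to the right side. -/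
theorem IsAnalyzed.exists_of_sign {p : DiscretePair} {rp rm r : ℝ →₀ ℝ}
    (h : IsAnalyzed p a lam phi rp rm r) (halpha : 1 - ∑ i, |phi i| ^ 2 ≠ 0) {S : Finset ℝ}
    (hS : S ⊆ (rp + rm).support) (hsign : ∀ i, 0 < signProd S (lam i) * phi i) :
    ∃ (p' : DiscretePair) (rp' rm' : ℝ →₀ ℝ),
      IsAnalyzed p' a lam phi rp' rm' r ∧ rp'.support = S := by
  set ρ := rp + rm with hρ
  have hρ0 : 0 ≤ ρ := add_nonneg h.right.nonneg h.left.nonneg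
  have hz : ρ 0 = 0 := by simp [hρ, h.right.zero, h.left.zero]
  have hfilter : ∀ (P : ℝ → Prop) [DecidablePred P], 0 ≤ ρ.filter P ∧ ρ.filter P 0 = 0 := by
    intro P _
    refine ⟨fun μ => ?_, ?_⟩
    · rw [Finsupp.filter_apply]
      split_ifs
      · exact hρ0 μ
      · exact le_rfl
    · rw [Finsupp.filter_apply, hz, ite_self]
  obtain ⟨p', hp1, hp2, hR, hL⟩ := exists_pair_of_residues a (hfilter (· ∈ S)).1
    (hfilter (· ∈ S)).2 (hfilter (· ∉ S)).1 (hfilter (· ∉ S)).2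
  have hsupp : (ρ.filter (· ∈ S)).support = S := by
    rw [Finsupp.support_filter, Finset.filter_mem_eq_inter]
    exact Finset.inter_eq_right.2 hS
  have hadd : ρ.filter (· ∈ S) + ρ.filter (· ∉ S) = ρ := Finsupp.filter_add_filter_not ρ _
  obtain ⟨ha1, ha2, -⟩ := h.isNegInv.pos_of_ne halpha
  refine ⟨p', _, _, ⟨hR, hL, ?_, ?_, h.support_eq, h.apply_eq, ?_⟩, hsupp⟩
  · rw [Finset.disjoint_left, hsupp]
    intro μ hμ
    rw [Finsupp.notMem_support_iff, Finsupp.filter_apply_neg (· ∉ S) _ (not_not.2 hμ)]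
  · have := h.isNegInv
    rw [totalResidues, hadd, hp1, hp2]
    rwa [totalResidues, ha1, ha2] at this
  · rwa [hsupp]

/-- The pairs are parametrised by the sets `D` of outer points whose side is switched relative to
the given pair. -/
theorem IsAnalyzed.encard_eq {p : DiscretePair} {rp rm r : ℝ →₀ ℝ} (hlam : StrictMono lam)
    (h : IsAnalyzed p a lam phi rp rm r) (halpha : 1 - ∑ i, |phi i| ^ 2 ≠ 0)
    (hphi : ∀ i, phi i ≠ 0) :
    {p : DiscretePair | IsInteriorSpectralData p a lam phi}.encard =
      (2 ^ (outerPoints lam (rp + rm).support).card : ℕ) := by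
  have hI := h.interlaces hlam halpha
  set Z := (rp + rm).support with hZ
  set E := outerPoints lam Z with hE
  have hEZ : E ⊆ Z := Finset.filter_subset _ _
  have hrpZ : rp.support ⊆ Z := by
    rw [hZ, support_add_of_nonneg h.right.nonneg h.left.nonneg]
    exact Finset.subset_union_left
  have hex : ∀ D : Finset ℝ, ∃ (p' : DiscretePair) (rp' rm' : ℝ →₀ ℝ), D ⊆ E →
      IsAnalyzed p' a lam phi rp' rm' r ∧ rp'.support = symmDiff D rp.support := by
    intro D
    by_cases hD : D ⊆ E
    · have hDZ : symmDiff D rp.support ⊆ Z := fun μ hμ => by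
        rcases Finset.mem_symmDiff.1 hμ with h1 | h1
        · exact hEZ (hD h1.1)
        · exact hrpZ h1.1
      obtain ⟨p', rp', rm', h1, h2⟩ := h.exists_of_sign halpha hDZ
        ((hI.signProd_mul_pos_iff hDZ hrpZ h.sign).2 (by rwa [symmDiff_symmDiff_cancel_right]))
      exact ⟨p', rp', rm', fun _ => ⟨h1, h2⟩⟩
    -- A dummy value, so that the choice function is defined on all finite sets.
    · exact ⟨0, 0, 0, fun h => absurd h hD⟩
  choose g gp gm hg using hex
  have hinj : Set.InjOn g (E.powerset : Set (Finset ℝ)) := by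
    intro D hD D' hD' heq
    obtain ⟨h1, h2⟩ := hg D (Finset.mem_powerset.1 hD)
    obtain ⟨h1', h2'⟩ := hg D' (Finset.mem_powerset.1 hD')
    have hR := h1.right
    rw [heq] at hR
    rw [hR.unique h1'.right, h2'] at h2
    exact (symmDiff_left_injective _ h2).symm
  have himage : {p : DiscretePair | IsInteriorSpectralData p a lam phi} =
      g '' (E.powerset : Set (Finset ℝ)) := by
    ext q
    constructor
    · intro hq
      obtain ⟨qp, qm, s, hs⟩ := IsInteriorSpectralData.exists_isAnalyzed hq hphi
      obtain ⟨rfl, hsum⟩ := hs.residues_unique h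
      have hqZ : qp.support ⊆ Z := by
        rw [hZ, ← hsum, support_add_of_nonneg hs.right.nonneg hs.left.nonneg]
        exact Finset.subset_union_left
      have hD := (hI.signProd_mul_pos_iff hqZ hrpZ h.sign).1 hs.sign
      refine ⟨symmDiff qp.support rp.support, Finset.mem_coe.2 (Finset.mem_powerset.2 hD), ?_⟩
      obtain ⟨h1, h2⟩ := hg _ hD
      rw [symmDiff_symmDiff_cancel_right] at h2
      obtain ⟨-, hsum'⟩ := h1.residues_unique hs
      -- Both pairs have the same residue sum and the same set of right poles, hence the same
      -- residues on each side.
      obtain ⟨e1, e2⟩ := filter_mem_support_of_disjoint h1.disjoint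
      obtain ⟨e1', e2'⟩ := filter_mem_support_of_disjoint hs.disjoint
      rw [hsum', h2] at e1 e2
      rw [e1] at e1'
      rw [e2] at e2'
      rw [e1', e2'] at h1
      exact h1.pair_unique hs halpha
    · rintro ⟨D, hD, rfl⟩
      exact (hg D (Finset.mem_powerset.1 hD)).1.isInteriorSpectralData hlam
  rw [himage, hinj.encard_image, Set.encard_coe_eq_coe_finsetCard, Finset.card_powerset]

end Classical

end Multipeakon

theorem theorem3p7 (a : ℝ) (N : ℕ) (lam phi : Fin N → ℝ)
    (hdata : ∃ p : Multipeakon.DiscretePair, Multipeakon.IsInteriorSpectralData p a lam phi)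
    (halpha : 1 - ∑ i, |phi i| ^ 2 ≠ 0)
    (hphi : ∀ i, phi i ≠ 0) :
    (∀ hN : 0 < N,
      (0 < lam ⟨0, hN⟩ ∨ lam ⟨N - 1, Nat.sub_lt hN Nat.one_pos⟩ < 0) →
        {p : Multipeakon.DiscretePair | Multipeakon.IsInteriorSpectralData p a lam phi}.encard = 2) ∧
    (∀ (j : ℕ) (hj : j + 1 < N),
      lam ⟨j, Nat.lt_of_succ_lt hj⟩ < 0 → 0 < lam ⟨j + 1, hj⟩ →
        {p : Multipeakon.DiscretePair | Multipeakon.IsInteriorSpectralData p a lam phi}.encard = 4) := by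
  obtain ⟨p, hp⟩ := hdata
  have hlam := hp.strictMono
  obtain ⟨rp, rm, r, h⟩ := Multipeakon.IsInteriorSpectralData.exists_isAnalyzed hp hphi
  have hI := h.interlaces hlam halpha
  rw [h.encard_eq hlam halpha hphi]
  constructor
  · intro hN hsgn
    rw [hI.card_outerPoints_of_eq hN]
    · rfl
    · rcases hsgn with hsgn | hsgn
      · left
        rw [Multipeakon.countBelow_eq_zero]
        exact fun i => hsgn.le.trans (hlam.monotone (Fin.mk_le_of_le_val (Nat.zero_le _)))
      · right
        rw [Multipeakon.countBelow_eq_card]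
        exact fun i => (hlam.monotone (Fin.le_def.2 (Nat.le_sub_one_of_lt i.2))).trans_lt hsgn
  · intro j hj hneg hpos
    rw [hI.card_outerPoints_of_ne (by omega)]
    · rfl
    · rw [Ne, Multipeakon.countBelow_eq_zero]
      exact fun hall => absurd (hall _) (not_le.2 hneg)
    · rw [Ne, Multipeakon.countBelow_eq_card]
      exact fun hall => absurd (hall _) (not_lt.2 hpos.le)
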